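/- Let $S$ be a smooth finite-dimensional manifold (Hausdorff, second countable, without boundary) with a symplectic form $\omega$, and let $E\to S$ be a smooth real vector bundle of finite rank which is a transitive Lie algebroid: there are a surjective smooth bundle map (the anchor) $\rho:E\to TS$ and a real Lie algebra bracket $[\cdot,\cdot]$ on $\Gamma(E)$ with $[v,fw]=f[v,w]+(\rho(v)\cdot f)\,w$ for $f\in C^\infty(S)$, $v,w\in\Gamma(E)$. Let $I=\ker\rho$ be the isotropy bundle, $p:I^*\to S$ its dual, $\mathrm{Vert}=\ker p_*\subset TI^*$, and for $s\in\Gamma(I)$ let $\ell(s)\in C^\infty(I^*)$ be the fiberwise linear function $\ell(s)(\xi)=\langle\xi,s(p(\xi))\rangle$. Let $\sigma:TS\to E$ be a connection, i.e. a smooth bundle map with $\rho\circ\sigma=\mathrm{id}$, and put $\nabla_Xs=[\sigma X,s]\in\Gamma(I)$ and $R_\sigma(X,Y)=[\sigma X,\sigma Y]-\sigma[X,Y]\in\Gamma(I)$ for vector fields $X,Y$ on $S$ and $s\in\Gamma(I)$. Then there are a unique Ehresmann connection $\Gamma$ on $I^*$ (a smooth projection $\Gamma:TI^*\to\mathrm{Vert}$;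 write $\mathrm{Hor}=\ker\Gamma$ and $\overline X$ for the horizontal lift of a vector field $X$ on $S$), a unique smooth vertical bivector field $\nu\in\Gamma(\Lambda^2\mathrm{Vert})$ and a unique $\varphi\in\Omega^2(S)\otimes C^\infty(I^*)$ such that, for all $X,Y\in\mathfrak X(S)$ and $s,t\in\Gamma(I)$, $$\overline X\cdot\ell(s)=\ell(\nabla_Xs),\qquad \nu(d\ell(s),d\ell(t))=\ell([s,t]),\qquad \varphi(X,Y)=\omega(X,Y)+\ell(R_\sigma(X,Y)),$$ and $\varphi$ equals $\omega$ on the zero section. The connection $\Gamma$ is homogeneous: the horizontal lifts preserve the space of smooth fiberwise linear functions on $I^*$. Moreover the geometric data $(\Gamma,\nu,\varphi)$ are integrable: with the coupling form $\widehat\omega=p^*\varphi\in\Omega^2(I^*)$, i.e. $\widehat\omega_\xi(u,v)=\varphi_\xi(p_*u,p_*v)$, for all vector fields $X,Y,X_1,X_2,X_3$ on $S$, 1. $[\nu,\nu]=0$; 2. $[\overline X,\nu]=0$; 3. $[\overline X,\overline Y]-\overline{[X,Y]}=\nu\big(d(\widehat\omega(\overline X,\overline Y)),\cdot\big)$; 4.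 $d\widehat\omega(\overline X_1,\overline X_2,\overline X_3)=0$. Consequently the data define a coupling Poisson structure near the zero section: the set $U\subset I^*$ of points at which $\varphi$ is nondegenerate is open and contains the zero section, and on $U$ the bivector field $\pi=\mu+\nu$ satisfies $[\pi,\pi]=0$, where $\mu\in\Gamma(\Lambda^2\mathrm{Hor})$ is the inverse of $\widehat\omega|_{\mathrm{Hor}}$: for a covector $\alpha$, $\mu(\alpha,\cdot)$ is the horizontal vector $h$ with $\widehat\omega(h,v)=\alpha(v)$ for all horizontal $v$. -/

import Mathlib

open Bundle Set Topology
open scoped Manifold ContDiff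

set_option linter.unusedSectionVars false

noncomputable section Algebroids

variable (V : Type*) [NormedAddCommGroup V] [NormedSpace ℝ V]
  {S : Type*} [TopologicalSpace S] [ChartedSpace V S] [IsManifold 𝓘(ℝ, V) ∞ S]
  (F : Type*) [NormedAddCommGroup F] [NormedSpace ℝ F]
  (E : S → Type*) [TopologicalSpace (TotalSpace F E)]
  [∀ x, AddCommGroup (E x)] [∀ x, Module ℝ (E x)] [∀ x, TopologicalSpace (E x)]
  [∀ x, IsTopologicalAddGroup (E x)] [∀ x, ContinuousSMul ℝ (E x)]
  [FiberBundle F E] [VectorBundle ℝ F E] [ContMDiffVectorBundle ∞ F E 𝓘(ℝ, V)]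

/-- Smooth vector fields on a manifold `S` modelled on the vector space `V`. -/
abbrev SmoothVectorField (S : Type*) [TopologicalSpace S] [ChartedSpace V S]
    [IsManifold 𝓘(ℝ, V) ∞ S] : Type _ :=
  ContMDiffSection 𝓘(ℝ, V) V ∞ (TangentSpace 𝓘(ℝ, V) : S → Type _)

/-- Smooth sections of the vector bundle `E` with model fiber `F`. -/
abbrev SmoothSection : Type _ := ContMDiffSection 𝓘(ℝ, V) F ∞ E

variable {V F E}

/-- The product of a smooth function and a smooth section. -/
def smulSection (f : C^∞⟮𝓘(ℝ, V), S; ℝ⟯) (w : SmoothSection V F E) : SmoothSection V F E where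
  toFun := (f : S → ℝ) • (w : ∀ x, E x)
  contMDiff_toFun := f.contMDiff.smul_section w.contMDiff

theorem smulSection_apply (f : C^∞⟮𝓘(ℝ, V), S; ℝ⟯) (w : SmoothSection V F E) (x : S) :
    smulSection f w x = f x • w x := rfl

/-- The Lie bracket of two smooth vector fields, as a smooth vector field. -/
def lieBracketField [CompleteSpace V] (X Y : SmoothVectorField V S) : SmoothVectorField V S where
  toFun := VectorField.mlieBracket 𝓘(ℝ, V) X Y
  contMDiff_toFun := by
    have : IsManifold 𝓘(ℝ, V) ((⊤ : ℕ∞) + 1) S := by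
      simpa using (inferInstance : IsManifold 𝓘(ℝ, V) ∞ S)
    have : IsManifold 𝓘(ℝ, V) (minSmoothness ℝ 2) S := by
      simpa using (inferInstance : IsManifold 𝓘(ℝ, V) 2 S)
    exact ContDiff.mlieBracket_vectorField (n := (⊤ : ℕ∞)) (m := (⊤ : ℕ∞))
      X.contMDiff Y.contMDiff (by simp)

variable (V F E)

/-- A Lie algebroid structure on the smooth real vector bundle `E` over `S`: a smooth bundle map
`anchor : E → TS` and a Lie algebra bracket on the smooth sections of `E`, satisfying the Leibniz
rule. -/
structure LieAlgebroid where
  anchor : ∀ x, E x →L[ℝ] TangentSpace 𝓘(ℝ, V) x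
  contMDiff_anchor : ContMDiff 𝓘(ℝ, V) (𝓘(ℝ, V).prod 𝓘(ℝ, F →L[ℝ] V)) ∞
    (fun x ↦ TotalSpace.mk' (F →L[ℝ] V) (E := fun x ↦ E x →L[ℝ] TangentSpace 𝓘(ℝ, V) x)
      x (anchor x))
  bracket : SmoothSection V F E →ₗ[ℝ] SmoothSection V F E →ₗ[ℝ] SmoothSection V F E
  bracket_self : ∀ u, bracket u u = 0
  jacobi : ∀ u v w, bracket u (bracket v w) + bracket v (bracket w u) + bracket w (bracket u v) = 0
  leibniz : ∀ (f : C^∞⟮𝓘(ℝ, V), S; ℝ⟯) (v w : SmoothSection V F E) (x : S),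
    bracket v (smulSection f w) x = f x • bracket v w x + mvfderiv 𝓘(ℝ, V) f x (anchor x (v x)) • w x

/-- A Lie algebroid is transitive if its anchor is surjective. -/
structure TransitiveLieAlgebroid extends LieAlgebroid V F E where
  surjective_anchor : ∀ x, Function.Surjective (anchor x)

variable {V F E}

namespace LieAlgebroid

/-- The vector field `ρ(u)` on `S` determined by a section `u`. -/
def anchorField (A : LieAlgebroid V F E) (u : SmoothSection V F E) : SmoothVectorField V S where
  toFun x := A.anchor x (u x)
  contMDiff_toFun := ContMDiff.clm_bundle_apply A.contMDiff_anchor u.contMDiff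

end LieAlgebroid

section AnchorMorphism

variable [T2Space S] [FiniteDimensional ℝ V]

/-- The derivative `X f` of a smooth function along a smooth vector field. -/
def derivField (X : SmoothVectorField V S) (f : C^∞⟮𝓘(ℝ, V), S; ℝ⟯) : C^∞⟮𝓘(ℝ, V), S; ℝ⟯ where
  val x := mvfderiv 𝓘(ℝ, V) f x (X x)
  property := by
    have h : ContMDiff 𝓘(ℝ, V) 𝓘(ℝ, ℝ).tangent ∞
        (fun x ↦ tangentMap 𝓘(ℝ, V) 𝓘(ℝ, ℝ) f (X x : TangentBundle 𝓘(ℝ, V) S)) :=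
      (f.contMDiff.contMDiff_tangentMap (m := ∞) (by simp)).comp X.contMDiff
    exact (contMDiff_snd_tangentBundle_modelSpace ℝ 𝓘(ℝ, ℝ)).comp h

theorem exists_section_eq {x : S} (v : E x) : ∃ s : SmoothSection V F E, s x = v := by
  let e := trivializationAt F E x
  have hx : x ∈ e.baseSet := FiberBundle.mem_baseSet_trivializationAt F E x
  obtain ⟨f, hf, -⟩ := (SmoothBumpFunction.nhds_basis_support (I := 𝓘(ℝ, V))
    (e.open_baseSet.mem_nhds hx)).mem_iff.1 (e.open_baseSet.mem_nhds hx)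
  refine ⟨⟨(f : S → ℝ) • (FiberBundle.extend F v : ∀ y, E y), ?_⟩, ?_⟩
  · refine ContMDiffOn.smul_section_of_tsupport f.contMDiff.contMDiffOn e.open_baseSet hf ?_
    rw [e.contMDiffOn_section_baseSet_iff]
    refine (contMDiffOn_const (c := (e ⟨x, v⟩).2)).congr fun y hy ↦ ?_
    simp [FiberBundle.extend, e, e.apply_mk_symm hy]
  · change f x • FiberBundle.extend F v x = v
    simp

theorem eq_zero_of_mvfderiv {x : S} {v : TangentSpace 𝓘(ℝ, V) x}
    (h : ∀ f : C^∞⟮𝓘(ℝ, V), S; ℝ⟯, mvfderiv 𝓘(ℝ, V) f x v = 0) : v = 0 := by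
  let f : SmoothBumpFunction 𝓘(ℝ, V) x := Classical.choice inferInstance
  have hg : ContMDiff 𝓘(ℝ, V) 𝓘(ℝ, V) ∞ (fun y ↦ f y • extChartAt 𝓘(ℝ, V) x y) :=
    f.contMDiff_smul contMDiffOn_extChartAt
  have hinv := isInvertible_mfderiv_extChartAt (I := 𝓘(ℝ, V)) (mem_extChartAt_source (I := 𝓘(ℝ, V)) x)
  have hinj : Function.Injective (mfderiv 𝓘(ℝ, V) 𝓘(ℝ, V) (extChartAt 𝓘(ℝ, V) x) x) := hinv.injective
  have heq : (fun y ↦ f y • extChartAt 𝓘(ℝ, V) x y) =ᶠ[𝓝 x] extChartAt 𝓘(ℝ, V) x := by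
    filter_upwards [f.eventuallyEq_one] with y hy
    simp [hy]
  apply hinj
  rw [map_zero, ← heq.mfderiv_eq]
  by_contra hne
  obtain ⟨φ, hφ⟩ : ∃ φ : V →L[ℝ] ℝ,
      φ (mfderiv 𝓘(ℝ, V) 𝓘(ℝ, V) (fun y ↦ f y • extChartAt 𝓘(ℝ, V) x y) x v : V) ≠ 0 :=
    SeparatingDual.exists_ne_zero (R := ℝ) (V := V) hne
  apply hφ
  have := h ⟨fun y ↦ φ (f y • extChartAt 𝓘(ℝ, V) x y), φ.contMDiff.comp hg⟩
  rw [← this]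
  change _ = mvfderiv 𝓘(ℝ, V) (φ ∘ (fun y ↦ f y • extChartAt 𝓘(ℝ, V) x y)) x v
  have h2 := mfderiv_comp x ((φ.contMDiff (n := 1)).mdifferentiableAt (by simp)) (hg.mdifferentiableAt (by simp))
  rw [mvfderiv, h2, φ.mfderiv_eq]
  rfl

theorem lieBracketField_smul [CompleteSpace V] (X Y : SmoothVectorField V S) (f : C^∞⟮𝓘(ℝ, V), S; ℝ⟯) (x : S) :
    lieBracketField X (smulSection f Y) x
      = f x • lieBracketField X Y x + mvfderiv 𝓘(ℝ, V) f x (X x) • Y x := by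
  rw [add_comm]
  exact VectorField.mlieBracket_smul_right (f.contMDiff.mdifferentiableAt (by simp))
    (Y.contMDiff.mdifferentiableAt (by simp))

/-- `[X, Y] f = X (Y f) - Y (X f)`. -/
theorem mvfderiv_lieBracketField (X Y : SmoothVectorField V S) (f : C^∞⟮𝓘(ℝ, V), S; ℝ⟯) (x : S) :
    mvfderiv 𝓘(ℝ, V) f x (lieBracketField X Y x) =
      derivField X (derivField Y f) x - derivField Y (derivField X f) x := by
  have : IsManifold 𝓘(ℝ, V) (minSmoothness ℝ 3) S := by
    simpa using (inferInstance : IsManifold 𝓘(ℝ, V) 3 S)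
  have smulExt : ∀ (g : C^∞⟮𝓘(ℝ, V), S; ℝ⟯) (a b : SmoothVectorField V S),
      lieBracketField a (smulSection g b)
        = smulSection g (lieBracketField a b) + smulSection (derivField a g) b :=
    fun g a b ↦ ContMDiffSection.ext fun y ↦ lieBracketField_smul a b g y
  have addExt : ∀ a b c : SmoothVectorField V S, lieBracketField a (b + c)
      = lieBracketField a b + lieBracketField a c := fun a b c ↦ ContMDiffSection.ext fun y ↦
    VectorField.mlieBracket_add_right (b.contMDiff.mdifferentiableAt (by simp))
      (c.contMDiff.mdifferentiableAt (by simp))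
  have jac : ∀ a b c : SmoothVectorField V S, lieBracketField a (lieBracketField b c)
      = lieBracketField (lieBracketField a b) c + lieBracketField b (lieBracketField a c) :=
    fun a b c ↦ ContMDiffSection.ext fun y ↦ VectorField.leibniz_identity_mlieBracket_apply
      ((a.contMDiff y).of_le (by simp [ENat.LEInfty.out])) ((b.contMDiff y).of_le (by simp [ENat.LEInfty.out]))
      ((c.contMDiff y).of_le (by simp [ENat.LEInfty.out]))
  by_cases hV : ∀ v : TangentSpace 𝓘(ℝ, V) x, v = 0
  · have h (Z : SmoothVectorField V S) (g : C^∞⟮𝓘(ℝ, V), S; ℝ⟯) : derivField Z g x = 0 := by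
      change mvfderiv 𝓘(ℝ, V) g x (Z x) = 0
      rw [hV (Z x), map_zero]
    rw [h, h, hV (lieBracketField X Y x), map_zero, sub_zero]
  · push Not at hV
    obtain ⟨v, hv⟩ := hV
    obtain ⟨Z, hZ⟩ := exists_section_eq (V := V) (F := V) v
    have j1 := congrArg (fun s : SmoothVectorField V S ↦ s x) (jac X Y (smulSection f Z))
    have j2 := congrArg (fun s : SmoothVectorField V S ↦ s x) (jac X Y Z)
    simp only [smulExt, addExt, ContMDiffSection.coe_add, Pi.add_apply, smulSection_apply] at j1 j2
    rw [j2, hZ] at j1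
    have : (derivField X (derivField Y f) x - derivField Y (derivField X f) x
        - mvfderiv 𝓘(ℝ, V) f x (lieBracketField X Y x)) • v = 0 := by
      change _ = f x • _ + (mvfderiv 𝓘(ℝ, V) f x (lieBracketField X Y x)) • v + _ at j1
      rw [← sub_eq_zero] at j1
      rw [← j1]
      module
    exact (sub_eq_zero.1 ((smul_eq_zero.1 this).resolve_right hv)).symm

/-- The anchor of a Lie algebroid is a morphism of Lie algebras. -/
theorem LieAlgebroid.anchorField_bracket (A : LieAlgebroid V F E) (u v : SmoothSection V F E) :
    A.anchorField (A.bracket u v) = lieBracketField (A.anchorField u) (A.anchorField v) := by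
  have anti : ∀ a b, A.bracket a b = - A.bracket b a := fun a b ↦ by
    have h := A.bracket_self (a + b)
    simp only [map_add, LinearMap.add_apply, A.bracket_self, zero_add, add_zero] at h
    exact eq_neg_of_add_eq_zero_right h
  have smulExt : ∀ (f : C^∞⟮𝓘(ℝ, V), S; ℝ⟯) (a b : SmoothSection V F E),
      A.bracket a (smulSection f b)
        = smulSection f (A.bracket a b) + smulSection (derivField (A.anchorField a) f) b :=
    fun f a b ↦ ContMDiffSection.ext fun x ↦ A.leibniz f a b x
  have key : ∀ (f : C^∞⟮𝓘(ℝ, V), S; ℝ⟯) (w : SmoothSection V F E) (x : S),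
      (derivField (A.anchorField u) (derivField (A.anchorField v) f) x
        - derivField (A.anchorField v) (derivField (A.anchorField u) f) x
        - derivField (A.anchorField (A.bracket u v)) f x) • w x = 0 := by
    intro f w x
    have j1 := congrArg (fun s : SmoothSection V F E ↦ s x) (A.jacobi u v (smulSection f w))
    have j2 := congrArg (fun s : SmoothSection V F E ↦ s x) (A.jacobi u v w)
    rw [anti (smulSection f w) u, anti (smulSection f w) (A.bracket u v)] at j1
    rw [anti w u, anti w (A.bracket u v)] at j2
    simp only [smulExt, map_add, map_neg] at j1 j2
    simp only [ContMDiffSection.coe_add, ContMDiffSection.coe_neg, Pi.add_apply, Pi.neg_apply,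
      ContMDiffSection.coe_zero, Pi.zero_apply] at j1 j2
    simp only [smulSection_apply] at j1
    have h3 : f x • ((A.bracket u) ((A.bracket v) w) x + -(A.bracket v) ((A.bracket u) w) x
      + -(A.bracket (A.bracket u v)) w x) = 0 := by rw [j2, smul_zero]
    refine Eq.trans ?_ (sub_eq_zero.2 (j1.trans h3.symm))
    module
  refine ContMDiffSection.ext fun x ↦ ?_
  by_cases hE : ∀ e : E x, e = 0
  · have hF : Subsingleton F := by
      have : Subsingleton (E x) := ⟨fun a b ↦ by rw [hE a, hE b]⟩
      exact (VectorBundle.continuousLinearEquivAt ℝ F E x).symm.toEquiv.subsingleton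
    have hE' : ∀ y (e : E y), e = 0 := fun y e ↦ by
      have := (VectorBundle.continuousLinearEquivAt ℝ F E y).toEquiv.subsingleton
      exact Subsingleton.elim _ _
    have h0 : ∀ s, A.anchorField s = 0 := fun s ↦ ContMDiffSection.ext fun y ↦ by
      change A.anchor y (s y) = 0
      rw [hE' y (s y), map_zero]
    rw [h0, h0, h0]
    exact (congrFun (VectorField.mlieBracket_self (I := 𝓘(ℝ, V)) (V := 0)) x).symm
  · push Not at hE
    obtain ⟨e, he⟩ := hE
    obtain ⟨w, hw⟩ := exists_section_eq (V := V) (F := F) e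
    rw [← sub_eq_zero]
    refine eq_zero_of_mvfderiv fun f ↦ ?_
    have h := (smul_eq_zero.1 (key f w x)).resolve_right (by rwa [hw])
    rw [map_sub, mvfderiv_lieBracketField, sub_eq_zero]
    exact (sub_eq_zero.1 h).symm
end AnchorMorphism

section Isotropy

namespace TransitiveLieAlgebroid

variable (A : TransitiveLieAlgebroid V F E)

/-- The fiber `ker (ρ_x)` of the isotropy bundle. -/
abbrev Isotropy (x : S) : Type _ := LinearMap.ker (A.anchor x : E x →ₗ[ℝ] TangentSpace 𝓘(ℝ, V) x)

/-- Model fiber of the isotropy bundle: its rank is `rank E - dim S`. -/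
abbrev IsoFiber (V F : Type*) [NormedAddCommGroup V] [NormedSpace ℝ V]
    [NormedAddCommGroup F] [NormedSpace ℝ F] : Type :=
  EuclideanSpace ℝ (Fin (Module.finrank ℝ F - Module.finrank ℝ V))

/-- The anchor read in the preferred trivializations around `x₀`. -/
def anchorCoord (x₀ x : S) : F →L[ℝ] V :=
  ContinuousLinearMap.inCoordinates F E V (TangentSpace 𝓘(ℝ, V)) x₀ x x₀ x (A.anchor x)

/-- The intersection of the base sets of the preferred trivializations of `E` and `TS`. -/
def coordSet (V F) [NormedAddCommGroup V] [NormedSpace ℝ V]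
    {S : Type*} [TopologicalSpace S] [ChartedSpace V S] [IsManifold 𝓘(ℝ, V) ∞ S]
    [NormedAddCommGroup F] [NormedSpace ℝ F]
    (E : S → Type*) [TopologicalSpace (TotalSpace F E)]
    [∀ x, TopologicalSpace (E x)] [FiberBundle F E] (x₀ : S) : Set S :=
  (trivializationAt F E x₀).baseSet ∩ (trivializationAt V (TangentSpace 𝓘(ℝ, V)) x₀).baseSet

theorem contMDiffOn_anchorCoord (x₀ : S) :
    ContMDiffOn 𝓘(ℝ, V) 𝓘(ℝ, F →L[ℝ] V) ∞ (A.anchorCoord x₀) (coordSet V F E x₀) := by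
  let e := trivializationAt (F →L[ℝ] V) (fun x ↦ E x →L[ℝ] TangentSpace 𝓘(ℝ, V) x) x₀
  exact (e.contMDiffOn_section_baseSet_iff (IB := 𝓘(ℝ, V)) (n := ∞) (s := A.anchor)).1 A.contMDiff_anchor.contMDiffOn

theorem anchorCoord_apply {x₀ x : S} (hx : x ∈ coordSet V F E x₀) (w : F) :
    A.anchorCoord x₀ x w = (trivializationAt V (TangentSpace 𝓘(ℝ, V)) x₀).continuousLinearEquivAt ℝ x hx.2
      (A.anchor x (((trivializationAt F E x₀).continuousLinearEquivAt ℝ x hx.1).symm w)) := by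
  rw [anchorCoord, ContinuousLinearMap.inCoordinates_eq hx.1 hx.2]
  rfl

variable [FiniteDimensional ℝ V] [FiniteDimensional ℝ F]

theorem mem_coordSet (x₀ : S) : x₀ ∈ coordSet V F E x₀ :=
  ⟨FiberBundle.mem_baseSet_trivializationAt' x₀, FiberBundle.mem_baseSet_trivializationAt' x₀⟩

theorem exists_complement (x₀ : S) : ∃ K : F →L[ℝ] IsoFiber V F,
    ((A.anchorCoord x₀ x₀).prod K) ∈ Set.range ((↑) : (F ≃L[ℝ] V × IsoFiber V F) → _) := by
  have hx := mem_coordSet (V := V) (F := F) (E := E) x₀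
  have hsurj : Function.Surjective (A.anchorCoord x₀ x₀) := by
    intro w
    obtain ⟨u, hu⟩ := A.surjective_anchor x₀
      (((trivializationAt V (TangentSpace 𝓘(ℝ, V)) x₀).continuousLinearEquivAt ℝ x₀ hx.2).symm w)
    refine ⟨(trivializationAt F E x₀).continuousLinearEquivAt ℝ x₀ hx.1 u, ?_⟩
    rw [A.anchorCoord_apply hx, ContinuousLinearEquiv.symm_apply_apply, hu,
      ContinuousLinearEquiv.apply_symm_apply]
  let f : F →ₗ[ℝ] V := A.anchorCoord x₀ x₀
  have hf : f.range = ⊤ := LinearMap.range_eq_top.2 hsurj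
  have hrank := f.finrank_range_add_finrank_ker
  rw [hf, finrank_top] at hrank
  have hk : Module.finrank ℝ f.ker = Module.finrank ℝ (IsoFiber V F) := by
    rw [finrank_euclideanSpace_fin]; omega
  obtain ⟨q, hq⟩ := f.ker.exists_isCompl
  let k : f.ker ≃ₗ[ℝ] IsoFiber V F := LinearEquiv.ofFinrankEq _ _ hk
  let K : F →ₗ[ℝ] IsoFiber V F := k.toLinearMap ∘ₗ f.ker.projectionOnto q hq
  have hinj : Function.Injective (f.prod K) := by
    rw [← LinearMap.ker_eq_bot, LinearMap.ker_eq_bot']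
    intro v hv
    have h1 : f v = 0 := congrArg Prod.fst hv
    have h2 : K v = 0 := congrArg Prod.snd hv
    have h3 : f.ker.projectionOnto q hq v = 0 := k.injective (by simpa [K] using h2)
    have h4 := Submodule.projectionOnto_apply_left hq ⟨v, h1⟩
    rw [h3] at h4
    exact (congrArg Subtype.val h4).symm
  have hdim : Module.finrank ℝ F = Module.finrank ℝ (V × IsoFiber V F) := by
    rw [Module.finrank_prod, finrank_euclideanSpace_fin]; omega
  let Φ : F ≃ₗ[ℝ] V × IsoFiber V F := LinearEquiv.ofInjectiveOfFinrankEq (f.prod K) hinj hdim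
  refine ⟨LinearMap.toContinuousLinearMap K, Φ.toContinuousLinearEquiv, ?_⟩
  ext v <;> rfl

/-- A linear map whose restriction to `ker ρ` is bijective near `x₀`, in coordinates. -/
def complement (x₀ : S) : F →L[ℝ] IsoFiber V F := (A.exists_complement x₀).choose

/-- The map `(ρ, K)` in coordinates around `x₀`. -/
def splitCoord (x₀ x : S) : F →L[ℝ] V × IsoFiber V F :=
  (A.anchorCoord x₀ x).prod (A.complement x₀)

/-- Domain of the trivialization of the isotropy bundle around `x₀`. -/
def isoSet (x₀ : S) : Set S :=
  coordSet V F E x₀ ∩ A.splitCoord x₀ ⁻¹' Set.range ((↑) : (F ≃L[ℝ] V × IsoFiber V F) → _)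

theorem contMDiffOn_splitCoord (x₀ : S) :
    ContMDiffOn 𝓘(ℝ, V) 𝓘(ℝ, F →L[ℝ] V × IsoFiber V F) ∞ (A.splitCoord x₀)
      (coordSet V F E x₀) := by
  have h : ContMDiff 𝓘(ℝ, F →L[ℝ] V) 𝓘(ℝ, F →L[ℝ] V × IsoFiber V F) ∞
      (fun a : F →L[ℝ] V ↦ a.prod (A.complement x₀)) := by
    refine ContDiff.contMDiff ?_
    have : (fun a : F →L[ℝ] V ↦ a.prod (A.complement x₀)) = fun a ↦
        ContinuousLinearMap.prodₗᵢ (𝕜 := ℝ) (E := F) (F := V) (G := IsoFiber V F) ℝ (a, A.complement x₀) := rfl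
    rw [this]
    exact (LinearIsometryEquiv.contDiff _).comp (contDiff_id.prodMk contDiff_const)
  exact h.comp_contMDiffOn (A.contMDiffOn_anchorCoord x₀)

theorem isOpen_isoSet (x₀ : S) : IsOpen (A.isoSet x₀) :=
  (A.contMDiffOn_splitCoord x₀).continuousOn.isOpen_inter_preimage
    ((trivializationAt F E x₀).open_baseSet.inter
      (trivializationAt V (TangentSpace 𝓘(ℝ, V)) x₀).open_baseSet) ContinuousLinearEquiv.isOpen

theorem mem_isoSet (x₀ : S) : x₀ ∈ A.isoSet x₀ :=
  ⟨mem_coordSet x₀, (A.exists_complement x₀).choose_spec⟩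

theorem contMDiffOn_splitCoord_inverse (x₀ : S) :
    ContMDiffOn 𝓘(ℝ, V) 𝓘(ℝ, V × IsoFiber V F →L[ℝ] F) ∞
      (fun x ↦ (A.splitCoord x₀ x).inverse) (A.isoSet x₀) := by
  intro x hx
  obtain ⟨Φ, hΦ⟩ := hx.2
  have h := (contDiffAt_map_inverse (n := ∞) Φ).contMDiffAt
  rw [hΦ] at h
  exact h.comp_contMDiffWithinAt x ((A.contMDiffOn_splitCoord x₀ x hx.1).mono inter_subset_left)

theorem splitCoord_inverse_apply {x₀ x : S} (hx : x ∈ A.isoSet x₀) (w : V × IsoFiber V F) :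
    A.splitCoord x₀ x ((A.splitCoord x₀ x).inverse w) = w := by
  obtain ⟨Φ, hΦ⟩ := hx.2
  rw [← hΦ, ContinuousLinearMap.inverse_equiv]
  exact Φ.apply_symm_apply w

theorem inverse_splitCoord_apply {x₀ x : S} (hx : x ∈ A.isoSet x₀) (v : F) :
    (A.splitCoord x₀ x).inverse (A.splitCoord x₀ x v) = v := by
  obtain ⟨Φ, hΦ⟩ := hx.2
  rw [← hΦ, ContinuousLinearMap.inverse_equiv]
  exact Φ.symm_apply_apply v

/-- The trivialization of the isotropy bundle around `x₀`, on the fiber over `x`. -/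
def isoMap (x₀ x : S) (hx : x ∈ A.isoSet x₀) : A.Isotropy x ≃ₗ[ℝ] IsoFiber V F where
  toFun v := A.complement x₀ ((trivializationAt F E x₀).continuousLinearEquivAt ℝ x hx.1.1 v)
  map_add' a b := by rw [Submodule.coe_add, map_add, map_add]
  map_smul' c a := by rw [Submodule.coe_smul, map_smul, map_smul]; rfl
  invFun w := ⟨((trivializationAt F E x₀).continuousLinearEquivAt ℝ x hx.1.1).symm
      ((A.splitCoord x₀ x).inverse (0, w)), by
    have h := congrArg Prod.fst (A.splitCoord_inverse_apply hx (0, w))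
    change A.anchorCoord x₀ x _ = 0 at h
    rw [A.anchorCoord_apply hx.1] at h
    exact (map_eq_zero_iff _ (ContinuousLinearEquiv.injective _)).1 h⟩
  left_inv v := by
    apply Subtype.ext
    have h : A.splitCoord x₀ x
        ((trivializationAt F E x₀).continuousLinearEquivAt ℝ x hx.1.1 v) =
        (0, A.complement x₀ ((trivializationAt F E x₀).continuousLinearEquivAt ℝ x hx.1.1 v)) := by
      refine Prod.ext ?_ rfl
      change A.anchorCoord x₀ x _ = 0
      rw [A.anchorCoord_apply hx.1, ContinuousLinearEquiv.symm_apply_apply]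
      have : A.anchor x v = 0 := v.2
      rw [this, map_zero]
    change ((trivializationAt F E x₀).continuousLinearEquivAt ℝ x hx.1.1).symm _ = _
    rw [← h, A.inverse_splitCoord_apply hx, ContinuousLinearEquiv.symm_apply_apply]
  right_inv w := by
    change A.complement x₀ ((trivializationAt F E x₀).continuousLinearEquivAt ℝ x hx.1.1
      (((trivializationAt F E x₀).continuousLinearEquivAt ℝ x hx.1.1).symm _)) = w
    rw [ContinuousLinearEquiv.apply_symm_apply]
    exact congrArg Prod.snd (A.splitCoord_inverse_apply hx (0, w))

/-- The trivialization `(x, v) ↦ (x, K v)` of the isotropy bundle around `x₀`. -/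
def isoPretrivialization (x₀ : S) : Pretrivialization (IsoFiber V F) (π (IsoFiber V F) A.Isotropy) where
  toFun p := (p.1, A.complement x₀ ((trivializationAt F E x₀) ⟨p.1, p.2⟩).2)
  invFun := by
    classical
    exact fun p ↦ ⟨p.1, if hx : p.1 ∈ A.isoSet x₀ then (A.isoMap x₀ p.1 hx).symm p.2 else 0⟩
  source := TotalSpace.proj ⁻¹' A.isoSet x₀
  target := A.isoSet x₀ ×ˢ univ
  map_source' p hp := ⟨hp, mem_univ _⟩
  map_target' p hp := hp.1
  left_inv' := by
    rintro ⟨x, v⟩ hx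
    change x ∈ A.isoSet x₀ at hx
    simp only [hx, dite_true]
    congr 1
    exact (A.isoMap x₀ x hx).symm_apply_apply v
  right_inv' := by
    rintro ⟨x, w⟩ ⟨hx, -⟩
    change x ∈ A.isoSet x₀ at hx
    simp only [hx, dite_true]
    refine Prod.ext rfl ?_
    exact (A.isoMap x₀ x hx).apply_symm_apply w
  open_target := (A.isOpen_isoSet x₀).prod isOpen_univ
  baseSet := A.isoSet x₀
  open_baseSet := A.isOpen_isoSet x₀
  source_eq := rfl
  target_eq := rfl
  proj_toFun _ _ := rfl

theorem isoPretrivialization_apply (x₀ : S) {x : S} (hx : x ∈ A.isoSet x₀) (v : A.Isotropy x) :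
    A.isoPretrivialization x₀ ⟨x, v⟩ = (x, A.isoMap x₀ x hx v) := rfl

theorem isoPretrivialization_symm (x₀ : S) {x : S} (hx : x ∈ A.isoSet x₀) (w : IsoFiber V F) :
    (A.isoPretrivialization x₀).symm x w = (A.isoMap x₀ x hx).symm w := by
  have h : x ∈ (A.isoPretrivialization x₀).baseSet := hx
  apply (A.isoMap x₀ x hx).injective
  have := (A.isoPretrivialization x₀).apply_mk_symm h w
  rw [A.isoPretrivialization_apply x₀ hx] at this
  rw [LinearEquiv.apply_symm_apply]
  exact congrArg Prod.snd this

/-- The coordinate change between two trivializations of the isotropy bundle. -/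
def isoCoordChange (x₀ x₁ x : S) : IsoFiber V F →L[ℝ] IsoFiber V F :=
  (A.complement x₁ ∘L
    ((trivializationAt F E x₀).coordChangeL ℝ (trivializationAt F E x₁) x : F →L[ℝ] F)) ∘L
      ((A.splitCoord x₀ x).inverse ∘L ContinuousLinearMap.inr ℝ V (IsoFiber V F))

theorem contMDiffOn_isoCoordChange (x₀ x₁ : S) :
    ContMDiffOn 𝓘(ℝ, V) 𝓘(ℝ, IsoFiber V F →L[ℝ] IsoFiber V F) ∞ (A.isoCoordChange x₀ x₁)
      (A.isoSet x₀ ∩ A.isoSet x₁) := by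
  refine ContMDiffOn.clm_comp (ContMDiffOn.clm_comp contMDiffOn_const ?_)
    (ContMDiffOn.clm_comp ?_ contMDiffOn_const)
  · exact (contMDiffOn_coordChangeL (IB := 𝓘(ℝ, V)) (n := ∞) _ _).mono
      fun x hx ↦ ⟨hx.1.1.1, hx.2.1.1⟩
  · exact (A.contMDiffOn_splitCoord_inverse x₀).mono inter_subset_left

theorem isoCoordChange_apply (x₀ x₁ : S) {x : S} (hx : x ∈ A.isoSet x₀ ∩ A.isoSet x₁)
    (w : IsoFiber V F) : A.isoCoordChange x₀ x₁ x w =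
      (A.isoPretrivialization x₁ ⟨x, (A.isoPretrivialization x₀).symm x w⟩).2 := by
  rw [A.isoPretrivialization_symm x₀ hx.1]
  change A.complement x₁ ((trivializationAt F E x₀).coordChangeL ℝ (trivializationAt F E x₁) x
    ((A.splitCoord x₀ x).inverse (0, w))) = A.complement x₁ _
  rw [Trivialization.coordChangeL_apply _ _ ⟨hx.1.1.1, hx.2.1.1⟩]
  rfl

/-- The vector bundle structure on the isotropy bundle `I = ker ρ`, as a subbundle of `E`. -/
def isoPrebundle : VectorPrebundle ℝ (IsoFiber V F) A.Isotropy where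
  pretrivializationAtlas := range A.isoPretrivialization
  pretrivialization_linear' := by
    rintro _ ⟨x₀, rfl⟩
    exact ⟨fun x hx ↦ ⟨(A.isoMap x₀ x hx).map_add, (A.isoMap x₀ x hx).map_smul⟩⟩
  pretrivializationAt := A.isoPretrivialization
  mem_base_pretrivializationAt := A.mem_isoSet
  pretrivialization_mem_atlas x := mem_range_self x
  exists_coordChange := by
    rintro _ ⟨x₀, rfl⟩ _ ⟨x₁, rfl⟩
    exact ⟨A.isoCoordChange x₀ x₁, (A.contMDiffOn_isoCoordChange x₀ x₁).continuousOn,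
      fun x hx w ↦ A.isoCoordChange_apply x₀ x₁ hx w⟩
  totalSpaceMk_isInducing := by
    intro x
    have hx := A.mem_isoSet x
    let e := (trivializationAt F E x).continuousLinearEquivAt ℝ x hx.1.1
    have hc : Continuous (A.isoPretrivialization x ∘ TotalSpace.mk x) :=
      continuous_const.prodMk
        ((A.complement x).continuous.comp (e.continuous.comp continuous_subtype_val))
    have hg : Continuous (fun p : S × IsoFiber V F ↦ e.symm ((A.splitCoord x x).inverse (0, p.2))) :=
      e.symm.continuous.comp ((A.splitCoord x x).inverse.continuous.comp
        (continuous_const.prodMk continuous_snd))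
    refine IsInducing.of_comp hc hg ?_
    convert! (IsInducing.subtypeVal : IsInducing ((↑) : A.Isotropy x → E x)) using 1
    funext v
    exact congrArg Subtype.val ((A.isoMap x x hx).symm_apply_apply v)

instance : TopologicalSpace (TotalSpace (IsoFiber V F) A.Isotropy) :=
  A.isoPrebundle.totalSpaceTopology

instance : FiberBundle (IsoFiber V F) A.Isotropy := A.isoPrebundle.toFiberBundle

instance : VectorBundle ℝ (IsoFiber V F) A.Isotropy := A.isoPrebundle.toVectorBundle

instance : A.isoPrebundle.IsContMDiff 𝓘(ℝ, V) ∞ where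
  exists_contMDiffCoordChange := by
    rintro _ ⟨x₀, rfl⟩ _ ⟨x₁, rfl⟩
    exact ⟨A.isoCoordChange x₀ x₁, A.contMDiffOn_isoCoordChange x₀ x₁,
      fun x hx w ↦ A.isoCoordChange_apply x₀ x₁ hx w⟩

instance : ContMDiffVectorBundle ∞ (IsoFiber V F) A.Isotropy 𝓘(ℝ, V) :=
  A.isoPrebundle.contMDiffVectorBundle 𝓘(ℝ, V)

/-- A family of vectors in `ker ρ` is a smooth section of `I` if it is one of `E`. -/
theorem contMDiff_isotropy_section {s : ∀ x, A.Isotropy x}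
    (hs : ContMDiff 𝓘(ℝ, V) (𝓘(ℝ, V).prod 𝓘(ℝ, F)) ∞ fun x ↦ TotalSpace.mk' F x (s x : E x)) :
    ContMDiff 𝓘(ℝ, V) (𝓘(ℝ, V).prod 𝓘(ℝ, IsoFiber V F)) ∞
      fun x ↦ TotalSpace.mk' (IsoFiber V F) x (s x) := by
  intro x₀
  have h := (contMDiffAt_section (IB := 𝓘(ℝ, V)) x₀).1 (hs x₀)
  rw [contMDiffAt_section]
  exact (A.complement x₀).contMDiff.contMDiffAt.comp x₀ h

/-- Smooth sections of the isotropy bundle. -/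
abbrev IsoSection : Type _ := SmoothSection V (IsoFiber V F) A.Isotropy

variable {A}

/-- A smooth section of the isotropy bundle, seen as a section of `E`. -/
def incl (s : A.IsoSection) : SmoothSection V F E where
  toFun x := s x
  contMDiff_toFun := by
    intro x₀
    have h := (contMDiffAt_section (IB := 𝓘(ℝ, V)) x₀).1 (s.contMDiff x₀)
    rw [contMDiffAt_section]
    have hU : A.isoSet x₀ ∈ 𝓝 x₀ := (A.isOpen_isoSet x₀).mem_nhds (A.mem_isoSet x₀)
    have h2 : ContMDiffAt 𝓘(ℝ, V) 𝓘(ℝ, F) ∞ (fun x ↦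
        ((A.splitCoord x₀ x).inverse ∘L ContinuousLinearMap.inr ℝ V (IsoFiber V F))
          (trivializationAt (IsoFiber V F) A.Isotropy x₀ ⟨x, s x⟩).2) x₀ :=
      (((A.contMDiffOn_splitCoord_inverse x₀).contMDiffAt hU).clm_comp contMDiffAt_const).clm_apply h
    refine h2.congr_of_eventuallyEq ?_
    filter_upwards [hU] with x hx
    have h3 := congrArg Subtype.val ((A.isoMap x₀ x hx).symm_apply_apply (s x))
    change ((trivializationAt F E x₀).continuousLinearEquivAt ℝ x hx.1.1).symm
      ((A.splitCoord x₀ x).inverse (0, A.isoMap x₀ x hx (s x))) = (s x : E x) at h3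
    change (trivializationAt F E x₀).continuousLinearEquivAt ℝ x hx.1.1 (s x) =
      (A.splitCoord x₀ x).inverse (0, A.isoMap x₀ x hx (s x))
    rw [← h3, ContinuousLinearEquiv.apply_symm_apply]

/-- A section of `E` killed by the anchor, seen as a section of the isotropy bundle. -/
def toIso (u : SmoothSection V F E) (hu : A.anchorField u = 0) : A.IsoSection where
  toFun x := ⟨u x, congrArg (fun Z : SmoothVectorField V S ↦ Z x) hu⟩
  contMDiff_toFun := A.contMDiff_isotropy_section u.contMDiff

theorem anchorField_incl (s : A.IsoSection) : A.anchorField (incl s) = 0 :=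
  ContMDiffSection.ext fun x ↦ (s x).2

variable (A)

/-- A connection of a transitive Lie algebroid: a smooth splitting `σ : TS → E` of the anchor. -/
structure Connection where
  toFun : ∀ x, TangentSpace 𝓘(ℝ, V) x →L[ℝ] E x
  contMDiff_toFun : ContMDiff 𝓘(ℝ, V) (𝓘(ℝ, V).prod 𝓘(ℝ, V →L[ℝ] F)) ∞
    (fun x ↦ TotalSpace.mk' (V →L[ℝ] F) (E := fun x ↦ TangentSpace 𝓘(ℝ, V) x →L[ℝ] E x)
      x (toFun x))
  anchor_toFun : ∀ x v, A.anchor x (toFun x v) = v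

variable {A}

/-- The section `σ X` of `E` determined by a vector field `X`. -/
def Connection.section (σ : A.Connection) (X : SmoothVectorField V S) : SmoothSection V F E where
  toFun x := σ.toFun x (X x)
  contMDiff_toFun := ContMDiff.clm_bundle_apply σ.contMDiff_toFun X.contMDiff

theorem Connection.anchorField_section (σ : A.Connection) (X : SmoothVectorField V S) :
    A.anchorField (σ.section X) = X :=
  ContMDiffSection.ext fun x ↦ σ.anchor_toFun x (X x)

theorem lieBracketField_zero_right (X : SmoothVectorField V S) : lieBracketField X 0 = 0 :=
  ContMDiffSection.ext fun x ↦
    congrFun (VectorField.mlieBracket_zero_right (I := 𝓘(ℝ, V)) (W := X)) x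

variable [T2Space S]

/-- The bracket of two sections of the isotropy bundle. -/
def isoBracket (s t : A.IsoSection) : A.IsoSection :=
  toIso (A.bracket (incl s) (incl t)) (by
    rw [A.anchorField_bracket, anchorField_incl, anchorField_incl, lieBracketField_zero_right])

/-- The covariant derivative `∇_X s = [σ X, s]` on the isotropy bundle. -/
def Connection.nabla (σ : A.Connection) (X : SmoothVectorField V S) (s : A.IsoSection) :
    A.IsoSection :=
  toIso (A.bracket (σ.section X) (incl s)) (by
    rw [A.anchorField_bracket, anchorField_incl, lieBracketField_zero_right])

/-- The curvature `R_σ(X, Y) = [σ X, σ Y] - σ [X, Y]`, a section of the isotropy bundle. -/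
def Connection.curvature (σ : A.Connection) (X Y : SmoothVectorField V S) : A.IsoSection :=
  toIso (A.bracket (σ.section X) (σ.section Y) - σ.section (lieBracketField X Y)) (by
    have h : ∀ u v : SmoothSection V F E,
        A.anchorField (u - v) = A.anchorField u - A.anchorField v := fun u v ↦
      ContMDiffSection.ext fun x ↦ map_sub (A.anchor x) (u x) (v x)
    rw [h, A.anchorField_bracket, σ.anchorField_section, σ.anchorField_section,
      σ.anchorField_section, sub_self])

variable (A)

/-- The fiber of the dual `I*` of the isotropy bundle. -/
abbrev CoIsotropy (x : S) : Type _ := A.Isotropy x →L[ℝ] ℝ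

/-- Model fiber of `I*`. -/
abbrev CoIsoFiber (V F : Type*) [NormedAddCommGroup V] [NormedSpace ℝ V]
    [NormedAddCommGroup F] [NormedSpace ℝ F] : Type :=
  IsoFiber V F →L[ℝ] ℝ

variable {A}

/-- The fiberwise linear function `ℓ(s)` on `I*` given by the pairing with a section `s` of `I`. -/
def ell (s : A.IsoSection) (y : TotalSpace (CoIsoFiber V F) A.CoIsotropy) : ℝ := y.2 (s y.1)

end TransitiveLieAlgebroid

end Isotropy

end Algebroids

noncomputable section PoissonGeometry

variable {EM : Type*} [NormedAddCommGroup EM] [NormedSpace ℝ EM]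
  {HM : Type*} [TopologicalSpace HM] (I : ModelWithCorners ℝ EM HM)
  {M : Type*} [TopologicalSpace M] [ChartedSpace HM M]

/-- The differential of a function at a point, as a covector. -/
def covec (f : M → ℝ) (y : M) : Module.Dual ℝ (TangentSpace I y) :=
  (mvfderiv I f y : TangentSpace I y →ₗ[ℝ] ℝ)

variable (M) in
/-- A family of bilinear forms on the cotangent spaces of `M`. -/
abbrev BivectorFamily : Type _ :=
  ∀ y : M, Module.Dual ℝ (TangentSpace I y) →ₗ[ℝ] Module.Dual ℝ (TangentSpace I y) →ₗ[ℝ] ℝ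

variable {I}

/-- The function `P(df, dg)`. -/
def BivectorFamily.pair (P : BivectorFamily I M) (f g : M → ℝ) (y : M) : ℝ :=
  P y (covec I f y) (covec I g y)

/-- `P` is a smooth bivector field on the open set `U`: it is skew-symmetric, and `P(df, dg)` is
smooth for all smooth functions `f`, `g` on `U`. -/
structure BivectorFamily.IsBivectorFieldOn (P : BivectorFamily I M) (U : Set M) : Prop where
  alt : ∀ y ∈ U, ∀ α, P y α α = 0
  smooth : ∀ f g : M → ℝ, ContMDiffOn I 𝓘(ℝ, ℝ) ∞ f U → ContMDiffOn I 𝓘(ℝ, ℝ) ∞ g U →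
    ContMDiffOn I 𝓘(ℝ, ℝ) ∞ (P.pair f g) U

/-- The Schouten bracket of two bivector fields, evaluated on the covectors `df`, `dg`, `dh`. -/
def BivectorFamily.schouten (P Q : BivectorFamily I M) (f g h : M → ℝ) (y : M) : ℝ :=
  P.pair (Q.pair f g) h y + P.pair (Q.pair g h) f y + P.pair (Q.pair h f) g y
    + (Q.pair (P.pair f g) h y + Q.pair (P.pair g h) f y + Q.pair (P.pair h f) g y)

/-- `P` is a Poisson bivector field on the open set `U`, that is, a smooth bivector field with
`[P, P] = 0`. -/
structure BivectorFamily.IsPoissonOn (P : BivectorFamily I M) (U : Set M) : Prop extends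
    P.IsBivectorFieldOn U where
  schouten_self : ∀ f g h : M → ℝ, ContMDiffOn I 𝓘(ℝ, ℝ) ∞ f U → ContMDiffOn I 𝓘(ℝ, ℝ) ∞ g U →
    ContMDiffOn I 𝓘(ℝ, ℝ) ∞ h U → ∀ y ∈ U, P.schouten P f g h y = 0

/-- The derivative of a function along a vector field. -/
def derivAlong (Z : ∀ y : M, TangentSpace I y) (f : M → ℝ) (y : M) : ℝ := mvfderiv I f y (Z y)

/-- The Schouten bracket `[Z, P]` (the Lie derivative of the bivector field `P` along the vector
field `Z`), evaluated on the covectors `df`, `dg`. -/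
def BivectorFamily.lieDeriv (Z : ∀ y : M, TangentSpace I y) (P : BivectorFamily I M)
    (f g : M → ℝ) (y : M) : ℝ :=
  derivAlong Z (P.pair f g) y - P.pair (derivAlong Z f) g y - P.pair f (derivAlong Z g) y

/-- The exterior derivative of a 2-form, evaluated on three vector fields. -/
def extDerivTwo (η : ∀ y : M, TangentSpace I y → TangentSpace I y → ℝ)
    (X Y Z : ∀ y : M, TangentSpace I y) (y : M) : ℝ :=
  derivAlong X (fun z ↦ η z (Y z) (Z z)) y - η y (VectorField.mlieBracket I X Y y) (Z y)
    + (derivAlong Y (fun z ↦ η z (Z z) (X z)) y - η y (VectorField.mlieBracket I Y Z y) (X y))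
    + (derivAlong Z (fun z ↦ η z (X z) (Y z)) y - η y (VectorField.mlieBracket I Z X y) (Y y))

/-- A symplectic form on `S`: a smooth, closed, nondegenerate 2-form. -/
structure SymplecticForm (V : Type*) [NormedAddCommGroup V] [NormedSpace ℝ V]
    (S : Type*) [TopologicalSpace S] [ChartedSpace V S] [IsManifold 𝓘(ℝ, V) ∞ S] where
  toFun : ∀ x : S, TangentSpace 𝓘(ℝ, V) x →L[ℝ] TangentSpace 𝓘(ℝ, V) x →L[ℝ] ℝ
  contMDiff_toFun : ContMDiff 𝓘(ℝ, V) (𝓘(ℝ, V).prod 𝓘(ℝ, V →L[ℝ] V →L[ℝ] ℝ)) ∞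
    (fun x ↦ TotalSpace.mk' (V →L[ℝ] V →L[ℝ] ℝ)
      (E := fun x : S ↦ TangentSpace 𝓘(ℝ, V) x →L[ℝ] TangentSpace 𝓘(ℝ, V) x →L[ℝ] ℝ) x (toFun x))
  alt : ∀ x v, toFun x v v = 0
  nondegenerate : ∀ x v, (∀ w, toFun x v w = 0) → v = 0
  closed : ∀ (X Y Z : SmoothVectorField V S) (x : S),
    extDerivTwo (I := 𝓘(ℝ, V)) (fun z v w ↦ toFun z v w) X Y Z x = 0

end PoissonGeometry

noncomputable section GeometricData

variable {V : Type*} [NormedAddCommGroup V] [NormedSpace ℝ V]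
  {S : Type*} [TopologicalSpace S] [ChartedSpace V S] [IsManifold 𝓘(ℝ, V) ∞ S]
  (G : Type*) [NormedAddCommGroup G] [NormedSpace ℝ G]
  (N : S → Type*) [TopologicalSpace (TotalSpace G N)]
  [∀ x, AddCommGroup (N x)] [∀ x, Module ℝ (N x)] [∀ x, TopologicalSpace (N x)]
  [FiberBundle G N] [VectorBundle ℝ G N] [ContMDiffVectorBundle ∞ G N 𝓘(ℝ, V)]

/-- The model of the total space of a vector bundle with fiber `G` over a manifold modelled
on `V`. -/
abbrev totalModel (V G : Type*) [NormedAddCommGroup V] [NormedSpace ℝ V]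
    [NormedAddCommGroup G] [NormedSpace ℝ G] : ModelWithCorners ℝ (V × G) (ModelProd V G) :=
  𝓘(ℝ, V).prod 𝓘(ℝ, G)

variable {G N}

/-- The differential `p_*` of the bundle projection `p`. -/
def dproj (y : TotalSpace G N) :
    TangentSpace (totalModel V G) y →L[ℝ] TangentSpace 𝓘(ℝ, V) y.1 :=
  mfderiv (totalModel V G) 𝓘(ℝ, V) (TotalSpace.proj : TotalSpace G N → S) y

theorem dproj_surjective (y : TotalSpace G N) :
    Function.Surjective (dproj (V := V) y) := by
  let e := trivializationAt G N y.1
  have hy : y.1 ∈ e.baseSet := FiberBundle.mem_baseSet_trivializationAt' y.1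
  let s : ∀ x, N x := FiberBundle.extend G y.2
  have hs : ContMDiffAt 𝓘(ℝ, V) (totalModel V G) ∞ (fun x ↦ TotalSpace.mk' G x (s x)) y.1 := by
    rw [contMDiffAt_section]
    refine (contMDiffAt_const (c := (e ⟨y.1, y.2⟩).2)).congr_of_eventuallyEq ?_
    filter_upwards [e.open_baseSet.mem_nhds hy] with x hx
    simp [s, FiberBundle.extend, e, e.apply_mk_symm hx]
  have hsy : TotalSpace.mk' G y.1 (s y.1) = y := by
    simp only [s, FiberBundle.extend_apply_self]
  intro v
  have hp : MDifferentiableAt (totalModel V G) 𝓘(ℝ, V) (TotalSpace.proj : TotalSpace G N → S)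
      (TotalSpace.mk' G y.1 (s y.1)) :=
    (contMDiff_proj N (n := 1)).mdifferentiableAt (by simp)
  have h := mfderiv_comp y.1 hp (hs.mdifferentiableAt (by simp))
  have hid : ((TotalSpace.proj : TotalSpace G N → S) ∘ fun x ↦ TotalSpace.mk' G x (s x)) = id := rfl
  rw [hid, mfderiv_id, hsy] at h
  exact ⟨mfderiv 𝓘(ℝ, V) (totalModel V G) (fun x ↦ TotalSpace.mk' G x (s x)) y.1 v,
    (congrArg (fun L ↦ L v) h).symm⟩

theorem exists_rightInverse_dproj (y : TotalSpace G N) :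
    ∃ g : TangentSpace 𝓘(ℝ, V) y.1 →ₗ[ℝ] TangentSpace (totalModel V G) y,
      ∀ v, dproj (V := V) y (g v) = v := by
  let p : TangentSpace (totalModel V G) y →ₗ[ℝ] TangentSpace 𝓘(ℝ, V) y.1 := dproj (V := V) y
  obtain ⟨g, hg⟩ := p.exists_rightInverse_of_surjective
    (LinearMap.range_eq_top.2 (dproj_surjective (V := V) y))
  exact ⟨g, LinearMap.congr_fun hg⟩

variable (V G N) in
/-- An Ehresmann connection on a vector bundle `p : N → S`: a smooth bundle projection of `TN`
onto the vertical bundle `Vert = ker p_*`. Smoothness means that smooth vector fields are mapped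
to smooth vector fields. -/
structure EhresmannConnection where
  vert : ∀ y : TotalSpace G N,
    TangentSpace (totalModel V G) y →L[ℝ] TangentSpace (totalModel V G) y
  contMDiff_vert : ∀ Z : ContMDiffSection (totalModel V G) (V × G) ∞
      (TangentSpace (totalModel V G) : TotalSpace G N → Type _),
    ContMDiff (totalModel V G) (totalModel V G).tangent ∞
      (fun y ↦ (⟨y, vert y (Z y)⟩ : TangentBundle (totalModel V G) (TotalSpace G N)))
  dproj_vert : ∀ y v, dproj (V := V) y (vert y v) = 0
  vert_of_dproj_eq_zero : ∀ y v, dproj (V := V) y v = 0 → vert y v = v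

namespace EhresmannConnection

variable (Γ : EhresmannConnection V G N)

/-- The horizontal subspace `Hor_y`. -/
def hor (y : TotalSpace G N) : Submodule ℝ (TangentSpace (totalModel V G) y) :=
  LinearMap.ker (Γ.vert y : TangentSpace (totalModel V G) y →ₗ[ℝ] TangentSpace (totalModel V G) y)

/-- The horizontal lift of a tangent vector of `S` to a point `y` of `N`: the horizontal vector
which projects to it. -/
def lift (y : TotalSpace G N) :
    TangentSpace 𝓘(ℝ, V) y.1 →ₗ[ℝ] TangentSpace (totalModel V G) y :=
  (LinearMap.id - (Γ.vert y : _ →ₗ[ℝ] TangentSpace (totalModel V G) y)) ∘ₗ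
    (exists_rightInverse_dproj y).choose

theorem dproj_lift (y : TotalSpace G N) (v : TangentSpace 𝓘(ℝ, V) y.1) :
    dproj (V := V) y (Γ.lift y v) = v := by
  change dproj (V := V) y (_ - Γ.vert y _) = v
  rw [map_sub, Γ.dproj_vert, sub_zero]
  exact (exists_rightInverse_dproj y).choose_spec v

theorem lift_mem_hor (y : TotalSpace G N) (v : TangentSpace 𝓘(ℝ, V) y.1) :
    Γ.lift y v ∈ Γ.hor y := by
  change Γ.vert y (_ - Γ.vert y _) = 0
  rw [map_sub, Γ.vert_of_dproj_eq_zero y _ (Γ.dproj_vert y _)]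
  exact sub_self _

/-- The horizontal lift of a vector field on `S`. -/
def liftField (X : ∀ x : S, TangentSpace 𝓘(ℝ, V) x) (y : TotalSpace G N) :
    TangentSpace (totalModel V G) y :=
  Γ.lift y (X y.1)

/-- The curvature `[X̄, Ȳ] - \overline{[X, Y]}`. -/
def curv (X Y : ∀ x : S, TangentSpace 𝓘(ℝ, V) x) (y : TotalSpace G N) :
    TangentSpace (totalModel V G) y :=
  VectorField.mlieBracket (totalModel V G) (Γ.liftField X) (Γ.liftField Y) y
    - Γ.liftField (VectorField.mlieBracket 𝓘(ℝ, V) X Y) y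

/-- A connection is homogeneous if horizontal lifts of smooth vector fields preserve the space of
smooth fiberwise linear functions. -/
def IsHomogeneous : Prop :=
  ∀ (X : SmoothVectorField V S) (f : TotalSpace G N → ℝ),
    ContMDiff (totalModel V G) 𝓘(ℝ, ℝ) ∞ f → (∀ x, IsLinearMap ℝ fun ξ : N x ↦ f ⟨x, ξ⟩) →
    ContMDiff (totalModel V G) 𝓘(ℝ, ℝ) ∞ (derivAlong (Γ.liftField X) f) ∧
      ∀ x, IsLinearMap ℝ fun ξ : N x ↦ derivAlong (Γ.liftField X) f ⟨x, ξ⟩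

end EhresmannConnection

variable (G N) in
/-- Geometric data `(Γ, ν, φ)` on a vector bundle `N` over a symplectic manifold `(S, ω)`: an
Ehresmann connection `Γ`, a vertical bivector field `ν`, and a 2-form `φ` on `S` with
coefficients in the smooth functions on `N` which restricts to `ω` on the zero section. (`φ` is
nondegenerate near the zero section, see `nondegenerateLocus`.) -/
structure GeometricData (Ω : SymplecticForm V S) where
  conn : EhresmannConnection V G N
  ν : BivectorFamily (totalModel V G) (TotalSpace G N)
  ν_isBivectorField : ν.IsBivectorFieldOn univ
  ν_vertical : ∀ y α β, (∀ v, dproj (V := V) y v = 0 → α v = 0) → ν y α β = 0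
  φ : ∀ y : TotalSpace G N, TangentSpace 𝓘(ℝ, V) y.1 →ₗ[ℝ] TangentSpace 𝓘(ℝ, V) y.1 →ₗ[ℝ] ℝ
  φ_alt : ∀ y v, φ y v v = 0
  φ_smooth : ∀ X Y : SmoothVectorField V S,
    ContMDiff (totalModel V G) 𝓘(ℝ, ℝ) ∞ (fun y ↦ φ y (X y.1) (Y y.1))
  φ_zeroSection : ∀ x v w, φ (zeroSection G N x) v w = Ω.toFun x v w

namespace GeometricData

variable {Ω : SymplecticForm V S} (D : GeometricData G N Ω)

/-- The set of points of `N` at which `φ` is nondegenerate. -/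
def nondegenerateLocus : Set (TotalSpace G N) :=
  {y | ∀ v, (∀ w, D.φ y v w = 0) → v = 0}

/-- The coupling 2-form `ω̂ = p^* φ` on `N`. -/
def couplingForm (y : TotalSpace G N) :
    TangentSpace (totalModel V G) y →ₗ[ℝ] TangentSpace (totalModel V G) y →ₗ[ℝ] ℝ :=
  (D.φ y).compl₁₂ (dproj (V := V) y : _ →ₗ[ℝ] TangentSpace 𝓘(ℝ, V) y.1)
    (dproj (V := V) y : _ →ₗ[ℝ] TangentSpace 𝓘(ℝ, V) y.1)

/-- The map `Hor_y → Hor_y^*` (`≃ ann (Vert_y)`), `v ↦ ω̂(v, ·)`. -/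
def couplingHor (y : TotalSpace G N) : D.conn.hor y →ₗ[ℝ] Module.Dual ℝ (D.conn.hor y) :=
  (D.couplingForm y).domRestrict₁₂ (D.conn.hor y) (D.conn.hor y)

open Classical in
/-- The horizontal bivector `μ` as a map `T_y^*N → T_yN`: the inverse of `ω̂|_Hor`, extended by
zero on the covectors which vanish on `Hor_y`. (Junk value zero where `ω̂|_Hor` is not
invertible.) -/
def couplingSharp (y : TotalSpace G N) :
    Module.Dual ℝ (TangentSpace (totalModel V G) y) →ₗ[ℝ] TangentSpace (totalModel V G) y :=
  if h : Function.Bijective (D.couplingHor y) then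
    (D.conn.hor y).subtype ∘ₗ (LinearEquiv.ofBijective (D.couplingHor y) h).symm.toLinearMap ∘ₗ
      (D.conn.hor y).dualRestrict
  else 0

/-- The horizontal coupling bivector `μ`, with `μ(α, β) = β(μ α)`. -/
def μ : BivectorFamily (totalModel V G) (TotalSpace G N) := fun y ↦
  (Module.Dual.eval ℝ (TangentSpace (totalModel V G) y)) ∘ₗ D.couplingSharp y

/-- The coupling bivector field `π = μ + ν`. -/
def couplingBivector : BivectorFamily (totalModel V G) (TotalSpace G N) := fun y ↦ D.μ y + D.ν y

/-- The integrability conditions for geometric data; in the third one, both sides are compared by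
evaluating covectors `β` on them, with the convention `β(ν(α)) = ν(α, β)`. -/
structure IsIntegrable : Prop where
  ν_poisson : D.ν.IsPoissonOn univ
  lieDeriv_ν : ∀ (X : SmoothVectorField V S) (f g : TotalSpace G N → ℝ),
    ContMDiff (totalModel V G) 𝓘(ℝ, ℝ) ∞ f → ContMDiff (totalModel V G) 𝓘(ℝ, ℝ) ∞ g →
    ∀ y, D.ν.lieDeriv (D.conn.liftField X) f g y = 0
  curvature : ∀ (X Y : SmoothVectorField V S) (y : TotalSpace G N)
    (β : Module.Dual ℝ (TangentSpace (totalModel V G) y)),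
    β (D.conn.curv X Y y) = D.ν y (covec (totalModel V G)
      (fun z ↦ D.couplingForm z (D.conn.liftField X z) (D.conn.liftField Y z)) y) β
  closed : ∀ (X Y Z : SmoothVectorField V S) (y : TotalSpace G N),
    extDerivTwo (I := totalModel V G) (fun z v w ↦ D.couplingForm z v w) (D.conn.liftField X)
      (D.conn.liftField Y) (D.conn.liftField Z) y = 0

end GeometricData

end GeometricData

noncomputable section Induced

variable {V : Type*} [NormedAddCommGroup V] [NormedSpace ℝ V] [FiniteDimensional ℝ V]
  {S : Type*} [TopologicalSpace S] [ChartedSpace V S] [IsManifold 𝓘(ℝ, V) ∞ S] [T2Space S]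
  {F : Type*} [NormedAddCommGroup F] [NormedSpace ℝ F] [FiniteDimensional ℝ F]
  {E : S → Type*} [TopologicalSpace (TotalSpace F E)]
  [∀ x, AddCommGroup (E x)] [∀ x, Module ℝ (E x)] [∀ x, TopologicalSpace (E x)]
  [∀ x, IsTopologicalAddGroup (E x)] [∀ x, ContinuousSMul ℝ (E x)]
  [FiberBundle F E] [VectorBundle ℝ F E] [ContMDiffVectorBundle ∞ F E 𝓘(ℝ, V)]

namespace TransitiveLieAlgebroid

/-- Geometric data `(Γ, ν, φ)` on the dual `I*` of the isotropy bundle are those induced by the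
connection `σ` if `X̄ ℓ(s) = ℓ(∇_X s)`, `ν(dℓ(s), dℓ(t)) = ℓ([s, t])` and
`φ = ω ⊗ 1 + ℓ ∘ R_σ`. -/
structure Connection.Induces {A : TransitiveLieAlgebroid V F E} (σ : A.Connection)
    {Ω : SymplecticForm V S} (D : GeometricData (CoIsoFiber V F) A.CoIsotropy Ω) : Prop where
  lift_ell : ∀ (X : SmoothVectorField V S) (s : A.IsoSection)
    (y : TotalSpace (CoIsoFiber V F) A.CoIsotropy),
    derivAlong (D.conn.liftField X) (ell s) y = ell (σ.nabla X s) y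
  ν_ell : ∀ (s t : A.IsoSection) (y : TotalSpace (CoIsoFiber V F) A.CoIsotropy),
    D.ν.pair (ell s) (ell t) y = ell (isoBracket s t) y
  φ_eq : ∀ (X Y : SmoothVectorField V S) (y : TotalSpace (CoIsoFiber V F) A.CoIsotropy),
    D.φ y (X y.1) (Y y.1) = Ω.toFun y.1 (X y.1) (Y y.1) + ell (σ.curvature X Y) y

end TransitiveLieAlgebroid

end Induced

/-!
The proof is organised around three observations.

*Everything is determined by linear functions.* The functions `f ∘ p + ℓ(s)` on `I*`, with `f` a
function on the base and `s` a section of `I`, contain all linear combinations of the coordinates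
of the charts, so their differentials exhaust every cotangent space (`IsTestFamily`,
`isTestFamily_dual`). Hence smooth tensors are determined by, and can be tested on, these functions:
brackets of bivector fields depend only on differentials at the given point
(`BivectorFamily.IsBivectorFieldOn.schouten_congr`,
`BivectorFamily.IsBivectorFieldOn.lieDeriv_congr`). A tangent vector of `I*` over `v` is the same
thing as a derivation of the sections of `I` over `v` (`exists_tangent_of_derivation`), which turns
the covariant derivative into the horizontal lift, and the fiberwise bracket and the curvature
define `ν` and `φ` because they are linear over the functions (`eq_of_section_eq`). This gives
existence, uniqueness and homogeneity of the data.

*Integrability is the algebroid Jacobi identity.* Splitting the Jacobi identity of the algebroid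
along `E = σ(TS) ⊕ I` gives the Jacobi identity of the fiberwise bracket, the fact that `∇` is a
derivation of it, `[∇_X, ∇_Y] - ∇_[X, Y] = ad R(X, Y)`, and the Bianchi identity for `R`; these are
the axioms of a `CurvedLieBundle`. Evaluated on the functions `f ∘ p + ℓ(s)` they become the four
integrability conditions, the closedness of `ω` entering the last one
(`CurvedLieBundle.isIntegrable_geometricData`).

*The coupling bivector is Poisson.* Lifting a coordinate frame of the base gives horizontal fields
`X i` in which `μ = ∑ n i j X i ⊗ X j`, with `n` the inverse of the matrix `m i j = φ(X i, X j)`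
(`CouplingFrame`, `GeometricData.IsIntegrable.exists_couplingFrame`). The Jacobiator of `π = μ + ν`
is tensorial, so it suffices to insert base coordinates and functions whose differentials vanish on
the horizontal vectors at the given point. According to the number of base coordinates, zero to
three, the Jacobi identity reduces to `[ν, ν] = 0`, `[X i, ν] = 0`, the curvature formula and the
closedness of the coupling form; the last two use `dn = n (dm) nᵀ`, where the transpose accounts
for the sign in `dn = -n (dm) n` since `n` is skew-symmetric (`CouplingFrame.covec_n`).
-/

/-! ### Derivatives along vector fields -/

noncomputable section VectorFields

variable {EM : Type*} [NormedAddCommGroup EM] [NormedSpace ℝ EM]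
  {HM : Type*} [TopologicalSpace HM] {I : ModelWithCorners ℝ EM HM}
  {M : Type*} [TopologicalSpace M] [ChartedSpace HM M]

/-- A vector field which is smooth on the set `O`. -/
def SmoothFieldOn (Z : ∀ y : M, TangentSpace I y) (O : Set M) [IsManifold I ∞ M] : Prop :=
  ContMDiffOn I I.tangent ∞ (fun y ↦ (⟨y, Z y⟩ : TangentBundle I M)) O

theorem ContMDiffOn.mdifferentiableAt_of_isOpen {O : Set M} {f : M → ℝ}
    (hf : ContMDiffOn I 𝓘(ℝ, ℝ) ∞ f O) (hO : IsOpen O) {y : M} (hy : y ∈ O) :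
    MDifferentiableAt I 𝓘(ℝ, ℝ) f y :=
  (hf.contMDiffAt (hO.mem_nhds hy)).mdifferentiableAt (by simp)

theorem derivAlong_eq_covec (Z : ∀ y : M, TangentSpace I y) (f : M → ℝ) (y : M) :
    derivAlong Z f y = covec I f y (Z y) := rfl

section Rules

variable {f g : M → ℝ} {y : M}

theorem mvfderiv_congr {f g : M → ℝ} (h : f =ᶠ[𝓝 y] g) : mvfderiv I f y = mvfderiv I g y := by
  have h1 := h.eq_of_nhds
  have h2 := h.mfderiv_eq (I := I) (I' := 𝓘(ℝ, ℝ))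
  ext v
  exact congrArg (fun L : EM →L[ℝ] ℝ ↦ L v) h2

theorem covec_congr (h : f =ᶠ[𝓝 y] g) : covec I f y = covec I g y := by
  rw [covec, covec, mvfderiv_congr h]

theorem derivAlong_congr (Z : ∀ y : M, TangentSpace I y) (h : f =ᶠ[𝓝 y] g) :
    derivAlong Z f y = derivAlong Z g y := by
  rw [derivAlong, derivAlong, mvfderiv_congr h]

theorem covec_add (hf : MDifferentiableAt I 𝓘(ℝ, ℝ) f y)
    (hg : MDifferentiableAt I 𝓘(ℝ, ℝ) g y) :
    covec I (fun z ↦ f z + g z) y = covec I f y + covec I g y := by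
  rw [covec, mvfderiv_fun_add hf hg]; rfl

theorem covec_mul (hf : MDifferentiableAt I 𝓘(ℝ, ℝ) f y)
    (hg : MDifferentiableAt I 𝓘(ℝ, ℝ) g y) :
    covec I (fun z ↦ f z * g z) y = f y • covec I g y + g y • covec I f y := by
  rw [covec, mvfderiv_fun_mul hf hg]; rfl

theorem covec_neg : covec I (fun z ↦ - f z) y = - covec I f y := by
  rw [covec, mvfderiv_fun_neg]; rfl

theorem covec_const (c : ℝ) : covec I (fun _ ↦ c) y = 0 := by
  rw [covec, mvfderiv_const]; rfl

theorem mdifferentiableAt_finsetSum {ι : Type*} (s : Finset ι) {f : ι → M → ℝ}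
    (hf : ∀ i, MDifferentiableAt I 𝓘(ℝ, ℝ) (f i) y) :
    MDifferentiableAt I 𝓘(ℝ, ℝ) (fun z ↦ ∑ i ∈ s, f i z) y := by
  classical
  induction s using Finset.induction_on with
  | empty => simpa using mdifferentiableAt_const (I := I) (I' := 𝓘(ℝ, ℝ)) (c := (0 : ℝ))
  | insert a s ha ih =>
    simp only [Finset.sum_insert ha]
    exact (hf a).add ih

theorem covec_sum {ι : Type*} (s : Finset ι) {f : ι → M → ℝ}
    (hf : ∀ i, MDifferentiableAt I 𝓘(ℝ, ℝ) (f i) y) :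
    covec I (fun z ↦ ∑ i ∈ s, f i z) y = ∑ i ∈ s, covec I (f i) y := by
  classical
  induction s using Finset.induction_on with
  | empty => simpa using covec_const (I := I) (y := y) 0
  | insert a s ha ih =>
    have h : MDifferentiableAt I 𝓘(ℝ, ℝ) (fun z ↦ ∑ i ∈ s, f i z) y :=
      mdifferentiableAt_finsetSum s hf
    simp only [Finset.sum_insert ha]
    rw [covec_add (hf a) h, ih]

variable (Z : ∀ y : M, TangentSpace I y)

theorem derivAlong_add (hf : MDifferentiableAt I 𝓘(ℝ, ℝ) f y)
    (hg : MDifferentiableAt I 𝓘(ℝ, ℝ) g y) :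
    derivAlong Z (fun z ↦ f z + g z) y = derivAlong Z f y + derivAlong Z g y := by
  simp only [derivAlong_eq_covec, covec_add hf hg, LinearMap.add_apply]

theorem derivAlong_mul (hf : MDifferentiableAt I 𝓘(ℝ, ℝ) f y)
    (hg : MDifferentiableAt I 𝓘(ℝ, ℝ) g y) :
    derivAlong Z (fun z ↦ f z * g z) y = f y * derivAlong Z g y + g y * derivAlong Z f y := by
  simp only [derivAlong_eq_covec, covec_mul hf hg, LinearMap.add_apply, LinearMap.smul_apply,
    smul_eq_mul]

theorem derivAlong_sum {ι : Type*} (s : Finset ι) {f : ι → M → ℝ}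
    (hf : ∀ i, MDifferentiableAt I 𝓘(ℝ, ℝ) (f i) y) :
    derivAlong Z (fun z ↦ ∑ i ∈ s, f i z) y = ∑ i ∈ s, derivAlong Z (f i) y := by
  simp only [derivAlong_eq_covec, covec_sum s hf, LinearMap.sum_apply]

end Rules

variable [IsManifold I ∞ M]

theorem SmoothFieldOn.derivAlong {Z : ∀ y : M, TangentSpace I y} {O : Set M} {f : M → ℝ}
    (hZ : SmoothFieldOn Z O) (hO : IsOpen O) (hf : ContMDiffOn I 𝓘(ℝ, ℝ) ∞ f O) :
    ContMDiffOn I 𝓘(ℝ, ℝ) ∞ (derivAlong Z f) O := by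
  have h1 : ContMDiffOn I 𝓘(ℝ, ℝ).tangent ∞
      (fun y ↦ tangentMapWithin I 𝓘(ℝ, ℝ) f O (⟨y, Z y⟩ : TangentBundle I M)) O :=
    (hf.contMDiffOn_tangentMapWithin (m := ∞) (by simp) hO.uniqueMDiffOn).comp hZ fun y hy ↦ hy
  refine ((contMDiff_snd_tangentBundle_modelSpace ℝ 𝓘(ℝ, ℝ)).comp_contMDiffOn h1).congr
    fun y hy ↦ ?_
  change mfderiv I 𝓘(ℝ, ℝ) f y (Z y) = mfderivWithin I 𝓘(ℝ, ℝ) f O y (Z y)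
  rw [mfderivWithin_of_isOpen hO hy]

theorem SmoothFieldOn.mono {Z : ∀ y : M, TangentSpace I y} {O O' : Set M}
    (hZ : SmoothFieldOn Z O) (h : O' ⊆ O) : SmoothFieldOn Z O' := ContMDiffOn.mono hZ h

theorem SmoothFieldOn.contMDiffAt {Z : ∀ y : M, TangentSpace I y} {O : Set M}
    (hZ : SmoothFieldOn Z O) (hO : IsOpen O) {y : M} (hy : y ∈ O) :
    ContMDiffAt I I.tangent ∞ (fun y ↦ (⟨y, Z y⟩ : TangentBundle I M)) y :=
  ContMDiffOn.contMDiffAt hZ (hO.mem_nhds hy)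

theorem SmoothFieldOn.mdifferentiableAt {Z : ∀ y : M, TangentSpace I y} {O : Set M}
    (hZ : SmoothFieldOn Z O) (hO : IsOpen O) {y : M} (hy : y ∈ O) :
    MDifferentiableAt I I.tangent (fun y ↦ (⟨y, Z y⟩ : TangentBundle I M)) y :=
  (hZ.contMDiffAt hO hy).mdifferentiableAt (by simp)

/-- The Lie bracket of vector fields is the commutator of the corresponding derivations:
comparing the coefficients of an auxiliary field `W` in the Jacobi identity for `X`, `Y`, `h W`
expresses the derivative of `h` along `[X, Y]`. -/
theorem derivAlong_mlieBracket [CompleteSpace EM] {X Y : ∀ y : M, TangentSpace I y}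
    {O : Set M} (hO : IsOpen O) (hX : SmoothFieldOn X O) (hY : SmoothFieldOn Y O) {h : M → ℝ}
    (hh : ContMDiffOn I 𝓘(ℝ, ℝ) ∞ h O) {y : M} (hy : y ∈ O) :
    derivAlong (VectorField.mlieBracket I X Y) h y
      = derivAlong X (derivAlong Y h) y - derivAlong Y (derivAlong X h) y := by
  have : IsManifold I (minSmoothness ℝ 3) M := by
    simpa using (inferInstance : IsManifold I 3 M)
  have : IsManifold I ((⊤ : ℕ∞) + 1) M := by
    simpa using (inferInstance : IsManifold I ∞ M)
  by_cases hV : ∀ v : TangentSpace I y, v = 0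
  · simp only [derivAlong, hV (X y), hV (Y y), hV (VectorField.mlieBracket I X Y y), map_zero,
      sub_zero]
  push Not at hV
  obtain ⟨v, hv⟩ := hV
  obtain ⟨O', hO', hW⟩ := FiberBundle.exists_contMDiffOn_extend (k := ∞) I EM v
  set W := FiberBundle.extend EM v with hWdef
  have hWy : W y = v := FiberBundle.extend_apply_self _ _
  obtain ⟨U, hUO', hU, hyU⟩ := mem_nhds_iff.1 hO'
  replace hW : SmoothFieldOn W U := ContMDiffOn.mono hW hUO'
  have smulEv : ∀ (A B : ∀ y : M, TangentSpace I y), SmoothFieldOn B U →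
      VectorField.mlieBracket I A (h • B) =ᶠ[𝓝 y]
        (derivAlong A h • B + h • VectorField.mlieBracket I A B) := by
    intro A B hB
    filter_upwards [hU.mem_nhds hyU, hO.mem_nhds hy] with z hz hz'
    rw [VectorField.mlieBracket_smul_right (hh.mdifferentiableAt_of_isOpen hO hz')
      (hB.mdifferentiableAt hU hz)]
    rfl
  have dW := hW.mdifferentiableAt hU hyU
  have dh := hh.mdifferentiableAt_of_isOpen hO hy
  have dXh := (hX.derivAlong hO hh).mdifferentiableAt_of_isOpen hO hy
  have dYh := (hY.derivAlong hO hh).mdifferentiableAt_of_isOpen hO hy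
  have br : ∀ A : ∀ y : M, TangentSpace I y, SmoothFieldOn A O →
      MDifferentiableAt I I.tangent
        (fun z ↦ (⟨z, VectorField.mlieBracket I A W z⟩ : TangentBundle I M)) y := fun A hA ↦
    (ContMDiffAt.mlieBracket_vectorField (n := (⊤ : ℕ∞)) (m := (⊤ : ℕ∞))
      (hA.contMDiffAt hO hy) (hW.contMDiffAt hU hyU) (by simp)).mdifferentiableAt (by simp)
  have s2 : ∀ A : ∀ y : M, TangentSpace I y, ContMDiffAt I I.tangent ∞
      (fun y ↦ (⟨y, A y⟩ : TangentBundle I M)) y → ContMDiffAt I I.tangent (minSmoothness ℝ 2)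
      (fun y ↦ (⟨y, A y⟩ : TangentBundle I M)) y := fun A hA ↦
    hA.of_le (by simp [ENat.LEInfty.out])
  have hhW : ContMDiffAt I I.tangent ∞ (fun y ↦ (⟨y, (h • W) y⟩ : TangentBundle I M)) y :=
    (hh.contMDiffAt (hO.mem_nhds hy)).smul_section (hW.contMDiffAt hU hyU)
  have j1 := VectorField.leibniz_identity_mlieBracket_apply (s2 X (hX.contMDiffAt hO hy))
    (s2 Y (hY.contMDiffAt hO hy)) (s2 _ hhW)
  have j2 := VectorField.leibniz_identity_mlieBracket_apply (s2 X (hX.contMDiffAt hO hy))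
    (s2 Y (hY.contMDiffAt hO hy)) (s2 _ (hW.contMDiffAt hU hyU))
  have smulD : ∀ {a : M → ℝ} {B : ∀ y : M, TangentSpace I y},
      MDifferentiableAt I 𝓘(ℝ, ℝ) a y →
      MDifferentiableAt I I.tangent (fun y ↦ (⟨y, B y⟩ : TangentBundle I M)) y →
      MDifferentiableAt I I.tangent (fun y ↦ (⟨y, (a • B) y⟩ : TangentBundle I M)) y :=
    fun ha hB ↦ ha.smul_section hB
  have expand : ∀ (A B : ∀ y : M, TangentSpace I y), SmoothFieldOn A O → SmoothFieldOn B O →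
      VectorField.mlieBracket I A (VectorField.mlieBracket I B (h • W)) y
        = derivAlong A (derivAlong B h) y • W y
          + derivAlong B h y • VectorField.mlieBracket I A W y
          + (derivAlong A h y • VectorField.mlieBracket I B W y
          + h y • VectorField.mlieBracket I A (VectorField.mlieBracket I B W) y) := by
    intro A B hA hB
    refine (Filter.EventuallyEq.mlieBracket_vectorField_eq (I := I) (V := A) (V₁ := A)
      Filter.EventuallyEq.rfl (smulEv B W hW)).trans ?_
    have dB := (hB.derivAlong hO hh).mdifferentiableAt_of_isOpen hO hy
    rw [VectorField.mlieBracket_add_right (smulD dB dW) (smulD dh (br B hB)),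
      VectorField.mlieBracket_smul_right dB dW, VectorField.mlieBracket_smul_right dh (br B hB)]
    rfl
  rw [expand X Y hX hY, expand Y X hY hX, (smulEv _ W hW).eq_of_nhds] at j1
  simp only [Pi.add_apply, Pi.smul_apply'] at j1
  rw [j2, hWy] at j1
  have key : (derivAlong X (derivAlong Y h) y - derivAlong Y (derivAlong X h) y
      - derivAlong (VectorField.mlieBracket I X Y) h y) • v = 0 := by
    rw [← sub_eq_zero] at j1
    rw [← j1]
    module
  exact (sub_eq_zero.1 ((smul_eq_zero.1 key).resolve_right hv)).symm

end VectorFields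

/-! ### Test functions and bivector fields -/

noncomputable section TestFunctions

variable {EM : Type*} [NormedAddCommGroup EM] [NormedSpace ℝ EM] [FiniteDimensional ℝ EM]
  {HM : Type*} [TopologicalSpace HM] {I : ModelWithCorners ℝ EM HM}
  {M : Type*} [TopologicalSpace M] [ChartedSpace HM M] [IsManifold I ∞ M]

instance (y : M) : FiniteDimensional ℝ (TangentSpace I y) :=
  inferInstanceAs (FiniteDimensional ℝ EM)

/-- A map into a finite-dimensional space is smooth if all its linear components are. -/
theorem contMDiffAt_of_forall_clm {W : Type*} [NormedAddCommGroup W] [NormedSpace ℝ W]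
    [FiniteDimensional ℝ W] {g : M → W} {y : M}
    (h : ∀ l : W →L[ℝ] ℝ, ContMDiffAt I 𝓘(ℝ, ℝ) ∞ (fun z ↦ l (g z)) y) :
    ContMDiffAt I 𝓘(ℝ, W) ∞ g y := by
  let e : W ≃L[ℝ] (Fin (Module.finrank ℝ W) → ℝ) := ContinuousLinearEquiv.ofFinrankEq (by simp)
  have h1 : ContMDiffAt I 𝓘(ℝ, Fin (Module.finrank ℝ W) → ℝ) ∞ (fun z ↦ e (g z)) y :=
    contMDiffAt_pi_space.2 fun i ↦ h ((ContinuousLinearMap.proj i).comp e.toContinuousLinearMap)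
  have h2 := (e.symm.contDiff (n := ∞)).contMDiff.contMDiffAt.comp y h1
  exact h2.congr_of_eventuallyEq (Filter.Eventually.of_forall fun z ↦ by simp)

variable (I) in
/-- A family of smooth functions which contains, near each point, all linear combinations of the
coordinates of the preferred chart at that point. Smooth objects on the
manifold are determined by their values on such a family. -/
structure IsTestFamily (T : Set (M → ℝ)) : Prop where
  smooth : ∀ t ∈ T, ContMDiff I 𝓘(ℝ, ℝ) ∞ t
  exists_eq : ∀ (y : M) (l : EM →L[ℝ] ℝ), ∃ t ∈ T, t =ᶠ[𝓝 y] fun z ↦ l (extChartAt I y z)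

theorem mvfderiv_clm_extChartAt {y z : M} (hz : z ∈ (extChartAt I y).source) (l : EM →L[ℝ] ℝ)
    (v : TangentSpace I z) :
    mvfderiv I (fun z ↦ l (extChartAt I y z)) z v
      = l (mfderiv I 𝓘(ℝ, EM) (extChartAt I y) z v) := by
  have h2 := mfderiv_comp z ((l.contMDiff (n := 1)).mdifferentiableAt (by simp))
    (mdifferentiableAt_extChartAt (I := I) (x := y) (y := z) (by simpa using hz))
  change mvfderiv I (l ∘ extChartAt I y) z v = _
  rw [mvfderiv, h2, l.mfderiv_eq]
  rfl

namespace IsTestFamily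

variable {T : Set (M → ℝ)} (hT : IsTestFamily I T)
include hT

/-- Every covector is the differential of a test function. -/
theorem exists_covec_eq (y : M) (α : Module.Dual ℝ (TangentSpace I y)) :
    ∃ t ∈ T, covec I t y = α := by
  have hinv := isInvertible_mfderiv_extChartAt (mem_extChartAt_source (I := I) y)
  let e : TangentSpace I y ≃L[ℝ] EM := hinv.choose
  have he (v : TangentSpace I y) : mfderiv I 𝓘(ℝ, EM) (extChartAt I y) y v = e v :=
    (congrArg (fun L : TangentSpace I y →L[ℝ] EM ↦ L v) hinv.choose_spec).symm
  let l : EM →ₗ[ℝ] ℝ := α ∘ₗ e.symm.toLinearEquiv.toLinearMap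
  obtain ⟨t, htT, ht⟩ := hT.exists_eq y (LinearMap.toContinuousLinearMap l)
  refine ⟨t, htT, ?_⟩
  rw [covec_congr ht]
  ext v
  change mvfderiv I (fun z ↦ (LinearMap.toContinuousLinearMap l) (extChartAt I y z)) y v = _
  rw [mvfderiv_clm_extChartAt (mem_extChartAt_source (I := I) y), he]
  change α (e.symm (e v)) = α v
  rw [e.symm_apply_apply]

theorem eq_zero_of_covec {y : M} {v : TangentSpace I y} (h : ∀ t ∈ T, covec I t y v = 0) :
    v = 0 := by
  refine (Module.forall_dual_apply_eq_zero_iff ℝ v).1 fun α ↦ ?_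
  obtain ⟨t, ht, rfl⟩ := hT.exists_covec_eq y α
  exact h t ht

theorem eq_of_covec {y : M} {v w : TangentSpace I y} (h : ∀ t ∈ T, covec I t y v = covec I t y w) :
    v = w :=
  sub_eq_zero.1 (hT.eq_zero_of_covec fun t ht ↦ by rw [map_sub, h t ht, sub_self])

/-- A vector field is smooth if its derivatives of all test functions are smooth. -/
theorem smoothFieldOn {Z : ∀ y : M, TangentSpace I y} {O : Set M} (hO : IsOpen O)
    (h : ∀ t ∈ T, ContMDiffOn I 𝓘(ℝ, ℝ) ∞ (derivAlong Z t) O) : SmoothFieldOn Z O := by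
  intro y hy
  refine ContMDiffAt.contMDiffWithinAt ?_
  refine (contMDiffAt_section (F := EM) (E := fun y : M ↦ TangentSpace I y) (s := Z) y).2 ?_
  refine contMDiffAt_of_forall_clm fun l ↦ ?_
  obtain ⟨t, htT, ht⟩ := hT.exists_eq y l
  refine ((h t htT).contMDiffAt (hO.mem_nhds hy)).congr_of_eventuallyEq ?_
  filter_upwards [eventually_eventually_nhds.2 ht,
    extChartAt_source_mem_nhds (I := I) y] with z hz hzs
  rw [derivAlong_congr Z hz, derivAlong, mvfderiv_clm_extChartAt hzs]
  have hzs' : z ∈ (chartAt HM y).source := by simpa using hzs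
  have h1 := congrArg (fun L : TangentSpace I z →L[ℝ] EM ↦ L (Z z))
    (TangentBundle.continuousLinearMapAt_trivializationAt hzs')
  have h2 : (trivializationAt EM (TangentSpace I) y).continuousLinearMapAt ℝ z (Z z)
      = (trivializationAt EM (TangentSpace I) y ⟨z, Z z⟩).2 := by
    rw [Trivialization.continuousLinearMapAt_apply, Trivialization.linearMapAt_apply, if_pos]
    exact hzs'
  exact congrArg l (h2.symm.trans h1)

end IsTestFamily

namespace BivectorFamily

variable {P : BivectorFamily I M} {U : Set M}

/-- The Hamiltonian vector field `P(df, ·)` of `f`. -/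
def hamField (P : BivectorFamily I M) (f : M → ℝ) (y : M) : TangentSpace I y :=
  (Module.evalEquiv ℝ (TangentSpace I y)).symm (P y (covec I f y))

theorem apply_hamField (P : BivectorFamily I M) (f : M → ℝ) (y : M)
    (β : Module.Dual ℝ (TangentSpace I y)) : β (P.hamField f y) = P y (covec I f y) β := by
  rw [hamField, Module.apply_evalEquiv_symm_apply]

theorem derivAlong_hamField (P : BivectorFamily I M) (f g : M → ℝ) :
    derivAlong (P.hamField f) g = P.pair f g :=
  funext fun y ↦ P.apply_hamField f y (covec I g y)

theorem skew_of_alt {y : M} (h : ∀ α, P y α α = 0) (α β) : P y α β = - P y β α := by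
  have := h (α + β)
  simp only [map_add, LinearMap.add_apply, h, zero_add, add_zero] at this
  linarith

theorem schouten_cyclic (P : BivectorFamily I M) (f g h : M → ℝ) (y : M) :
    P.schouten P f g h y = P.schouten P g h f y := by
  rw [schouten, schouten]; ring

namespace IsBivectorFieldOn

variable (hP : P.IsBivectorFieldOn U) (hU : IsOpen U)
include hP

theorem pair_skew {y : M} (hy : y ∈ U) (f g : M → ℝ) : P.pair f g y = - P.pair g f y :=
  skew_of_alt (hP.alt y hy) _ _

include hU

theorem covec_pair_skew {y : M} (hy : y ∈ U) (f g : M → ℝ) :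
    covec I (P.pair f g) y = - covec I (P.pair g f) y := by
  rw [← covec_neg]
  exact covec_congr (by filter_upwards [hU.mem_nhds hy] with z hz using hP.pair_skew hz f g)

theorem lieDeriv_skew {Z : ∀ y : M, TangentSpace I y} (f g : M → ℝ) {y : M} (hy : y ∈ U) :
    P.lieDeriv Z f g y = - P.lieDeriv Z g f y := by
  rw [lieDeriv, lieDeriv, derivAlong_eq_covec, hP.covec_pair_skew hU hy, hP.pair_skew hy _ g,
    hP.pair_skew hy f, derivAlong_eq_covec Z (P.pair g f), LinearMap.neg_apply]
  ring

variable {T : Set (M → ℝ)} (hT : IsTestFamily I T)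
include hT

theorem smooth_hamField {f : M → ℝ} (hf : ContMDiffOn I 𝓘(ℝ, ℝ) ∞ f U) :
    SmoothFieldOn (P.hamField f) U :=
  hT.smoothFieldOn hU fun t ht ↦ by
    rw [derivAlong_hamField]
    exact hP.smooth f t hf (hT.smooth t ht).contMDiffOn

/-- The Jacobiator of `f`, `g`, `h` is the derivative of `h` along the vector field
`X_{f, g} - [X_f, X_g]`. -/
theorem schouten_eq {f g h : M → ℝ} (hf : ContMDiffOn I 𝓘(ℝ, ℝ) ∞ f U)
    (hg : ContMDiffOn I 𝓘(ℝ, ℝ) ∞ g U) (hh : ContMDiffOn I 𝓘(ℝ, ℝ) ∞ h U) {y : M} (hy : y ∈ U) :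
    P.schouten P f g h y = 2 * (covec I h y (P.hamField (P.pair f g) y
      - VectorField.mlieBracket I (P.hamField f) (P.hamField g) y)) := by
  have : CompleteSpace EM := FiniteDimensional.complete ℝ EM
  have hb := derivAlong_mlieBracket hU (hP.smooth_hamField hU hT hf) (hP.smooth_hamField hU hT hg)
    hh hy
  simp only [derivAlong_hamField] at hb
  rw [map_sub, apply_hamField, ← derivAlong_eq_covec, hb, schouten]
  have h1 : P.pair (P.pair g h) f y = - P.pair f (P.pair g h) y := hP.pair_skew hy _ _
  have h2 : P.pair (P.pair h f) g y = P.pair g (P.pair f h) y := by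
    rw [hP.pair_skew hy, pair, hP.covec_pair_skew hU hy h f, map_neg, neg_neg]; rfl
  rw [h1, h2]
  change _ = 2 * (P.pair (P.pair f g) h y - _)
  ring

theorem schouten_congr_right {f g h h' : M → ℝ} (hf : ContMDiffOn I 𝓘(ℝ, ℝ) ∞ f U)
    (hg : ContMDiffOn I 𝓘(ℝ, ℝ) ∞ g U) (hh : ContMDiffOn I 𝓘(ℝ, ℝ) ∞ h U)
    (hh' : ContMDiffOn I 𝓘(ℝ, ℝ) ∞ h' U) {y : M} (hy : y ∈ U) (e : covec I h y = covec I h' y) :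
    P.schouten P f g h y = P.schouten P f g h' y := by
  rw [hP.schouten_eq hU hT hf hg hh hy, hP.schouten_eq hU hT hf hg hh' hy, e]

/-- The Jacobiator of three functions at a point depends only on their differentials there. -/
theorem schouten_congr {f f' g g' h h' : M → ℝ} (hf : ContMDiffOn I 𝓘(ℝ, ℝ) ∞ f U)
    (hf' : ContMDiffOn I 𝓘(ℝ, ℝ) ∞ f' U) (hg : ContMDiffOn I 𝓘(ℝ, ℝ) ∞ g U)
    (hg' : ContMDiffOn I 𝓘(ℝ, ℝ) ∞ g' U) (hh : ContMDiffOn I 𝓘(ℝ, ℝ) ∞ h U)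
    (hh' : ContMDiffOn I 𝓘(ℝ, ℝ) ∞ h' U) {y : M} (hy : y ∈ U) (ef : covec I f y = covec I f' y)
    (eg : covec I g y = covec I g' y) (eh : covec I h y = covec I h' y) :
    P.schouten P f g h y = P.schouten P f' g' h' y := by
  rw [hP.schouten_congr_right hU hT hf hg hh hh' hy eh, P.schouten_cyclic f g h',
    hP.schouten_congr_right hU hT hg hh' hf hf' hy ef, P.schouten_cyclic g h' f',
    hP.schouten_congr_right hU hT hh' hf' hg hg' hy eg, P.schouten_cyclic h' f' g']

theorem lieDeriv_congr_right {Z : ∀ y : M, TangentSpace I y} (hZ : SmoothFieldOn Z U)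
    {f g g' : M → ℝ} (hf : ContMDiffOn I 𝓘(ℝ, ℝ) ∞ f U)
    (hg : ContMDiffOn I 𝓘(ℝ, ℝ) ∞ g U) (hg' : ContMDiffOn I 𝓘(ℝ, ℝ) ∞ g' U) {y : M} (hy : y ∈ U)
    (eg : covec I g y = covec I g' y) : P.lieDeriv Z f g y = P.lieDeriv Z f g' y := by
  have : CompleteSpace EM := FiniteDimensional.complete ℝ EM
  have key : ∀ g : M → ℝ, ContMDiffOn I 𝓘(ℝ, ℝ) ∞ g U → P.lieDeriv Z f g y =
      covec I g y (VectorField.mlieBracket I Z (P.hamField f) y) - P y (covec I (derivAlong Z f) y)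
        (covec I g y) := by
    intro g hg
    have hb := derivAlong_mlieBracket hU hZ (hP.smooth_hamField hU hT hf) hg hy
    simp only [derivAlong_hamField] at hb
    rw [← derivAlong_eq_covec, hb, lieDeriv]
    change _ - P.pair (derivAlong Z f) g y - _ = _ - _ - P.pair (derivAlong Z f) g y
    ring
  rw [key g hg, key g' hg', eg]

/-- The Lie derivative of a bivector field evaluated on two functions depends only on their
differentials at the given point. -/
theorem lieDeriv_congr {Z : ∀ y : M, TangentSpace I y} (hZ : SmoothFieldOn Z U)
    {f f' g g' : M → ℝ} (hf : ContMDiffOn I 𝓘(ℝ, ℝ) ∞ f U) (hf' : ContMDiffOn I 𝓘(ℝ, ℝ) ∞ f' U)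
    (hg : ContMDiffOn I 𝓘(ℝ, ℝ) ∞ g U) (hg' : ContMDiffOn I 𝓘(ℝ, ℝ) ∞ g' U) {y : M} (hy : y ∈ U)
    (ef : covec I f y = covec I f' y) (eg : covec I g y = covec I g' y) :
    P.lieDeriv Z f g y = P.lieDeriv Z f' g' y := by
  rw [hP.lieDeriv_congr_right hU hT hZ hf hg hg' hy eg, hP.lieDeriv_skew hU f g' hy,
    hP.lieDeriv_congr_right hU hT hZ hg' hf hf' hy ef, ← hP.lieDeriv_skew hU f' g' hy]

end IsBivectorFieldOn

end BivectorFamily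

namespace IsTestFamily

variable {T : Set (M → ℝ)} (hT : IsTestFamily I T) {P : BivectorFamily I M} {U : Set M}
  (hU : IsOpen U)
include hT hU

theorem isBivectorFieldOn (halt : ∀ y ∈ U, ∀ α, P y α α = 0)
    (h : ∀ s ∈ T, ∀ t ∈ T, ContMDiffOn I 𝓘(ℝ, ℝ) ∞ (P.pair s t) U) : P.IsBivectorFieldOn U where
  alt := halt
  smooth f g hf hg := by
    -- Apply the smoothness criterion for vector fields to each of the two arguments in turn.
    have h1 : SmoothFieldOn (P.hamField f) U := hT.smoothFieldOn hU fun t ht ↦ by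
      have h2 : SmoothFieldOn (P.hamField t) U := hT.smoothFieldOn hU fun s hs ↦ by
        rw [BivectorFamily.derivAlong_hamField]
        exact h t ht s hs
      have h3 := h2.derivAlong hU hf
      rw [BivectorFamily.derivAlong_hamField] at h3 ⊢
      exact h3.neg.congr fun y hy ↦ BivectorFamily.skew_of_alt (halt y hy) _ _
    have h4 := h1.derivAlong hU hg
    rwa [BivectorFamily.derivAlong_hamField] at h4

theorem isPoissonOn (hP : P.IsBivectorFieldOn U)
    (h : ∀ r ∈ T, ∀ s ∈ T, ∀ t ∈ T, ∀ y ∈ U, P.schouten P r s t y = 0) : P.IsPoissonOn U where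
  toIsBivectorFieldOn := hP
  schouten_self f g k hf hg hk y hy := by
    obtain ⟨r, hr, er⟩ := hT.exists_covec_eq y (covec I f y)
    obtain ⟨s, hs, es⟩ := hT.exists_covec_eq y (covec I g y)
    obtain ⟨t, ht, et⟩ := hT.exists_covec_eq y (covec I k y)
    rw [hP.schouten_congr hU hT hf (hT.smooth r hr).contMDiffOn hg (hT.smooth s hs).contMDiffOn hk
      (hT.smooth t ht).contMDiffOn hy er.symm es.symm et.symm]
    exact h r hr s hs t ht y hy

theorem lieDeriv_eq_zero (hP : P.IsBivectorFieldOn U) {Z : ∀ y : M, TangentSpace I y}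
    (hZ : SmoothFieldOn Z U) {y : M} (hy : y ∈ U)
    (h : ∀ s ∈ T, ∀ t ∈ T, P.lieDeriv Z s t y = 0) {f g : M → ℝ}
    (hf : ContMDiffOn I 𝓘(ℝ, ℝ) ∞ f U) (hg : ContMDiffOn I 𝓘(ℝ, ℝ) ∞ g U) :
    P.lieDeriv Z f g y = 0 := by
  obtain ⟨s, hs, es⟩ := hT.exists_covec_eq y (covec I f y)
  obtain ⟨t, ht, et⟩ := hT.exists_covec_eq y (covec I g y)
  rw [hP.lieDeriv_congr hU hT hZ hf (hT.smooth s hs).contMDiffOn hg (hT.smooth t ht).contMDiffOn hy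
    es.symm et.symm]
  exact h s hs t ht

end IsTestFamily

/-- The restriction of a Poisson bivector field is a Poisson bivector field: although a smooth
function on the smaller set need not extend, its differential at a point is that of a global test
function. -/
theorem BivectorFamily.IsPoissonOn.restrict {T : Set (M → ℝ)} (hT : IsTestFamily I T)
    {P : BivectorFamily I M} (hP : P.IsPoissonOn univ) {U : Set M} (hU : IsOpen U) :
    P.IsPoissonOn U :=
  hT.isPoissonOn hU (hT.isBivectorFieldOn hU (fun y _ ↦ hP.alt y (mem_univ y)) fun s hs t ht ↦
    (hP.smooth s t (hT.smooth s hs).contMDiffOn (hT.smooth t ht).contMDiffOn).mono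
      (subset_univ U)) fun r hr s hs t ht y _ ↦ hP.schouten_self r s t
        (hT.smooth r hr).contMDiffOn (hT.smooth s hs).contMDiffOn (hT.smooth t ht).contMDiffOn y
        (mem_univ y)

end TestFunctions

/-! ### Sections and frames of vector bundles -/

noncomputable section Frames

variable {V : Type*} [NormedAddCommGroup V] [NormedSpace ℝ V] [FiniteDimensional ℝ V]
  {S : Type*} [TopologicalSpace S] [ChartedSpace V S] [IsManifold 𝓘(ℝ, V) ∞ S] [T2Space S]
  {H : Type*} [NormedAddCommGroup H] [NormedSpace ℝ H] [FiniteDimensional ℝ H]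
  {W : S → Type*} [TopologicalSpace (TotalSpace H W)]
  [∀ x, AddCommGroup (W x)] [∀ x, Module ℝ (W x)] [∀ x, TopologicalSpace (W x)]
  [∀ x, IsTopologicalAddGroup (W x)] [∀ x, ContinuousSMul ℝ (W x)]
  [FiberBundle H W] [VectorBundle ℝ H W] [ContMDiffVectorBundle ∞ H W 𝓘(ℝ, V)]

theorem exists_bump {x₀ : S} {U : Set S} (hU : IsOpen U) (hx : x₀ ∈ U) :
    ∃ χ : C^∞⟮𝓘(ℝ, V), S; ℝ⟯, tsupport χ ⊆ U ∧ (χ : S → ℝ) =ᶠ[𝓝 x₀] 1 := by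
  obtain ⟨f, -, hf⟩ := (SmoothBumpFunction.nhds_basis_tsupport (I := 𝓘(ℝ, V)) x₀).mem_iff.1
    (hU.mem_nhds hx)
  exact ⟨⟨f, f.contMDiff⟩, hf, f.eventuallyEq_one⟩

/-- Smooth sections over an open set extend, after shrinking the set. -/
theorem exists_section_eventuallyEq {x₀ : S} {U : Set S} (hU : IsOpen U) (hx : x₀ ∈ U)
    {u : ∀ x, W x}
    (hu : ContMDiffOn 𝓘(ℝ, V) (𝓘(ℝ, V).prod 𝓘(ℝ, H)) ∞ (fun x ↦ TotalSpace.mk' H x (u x)) U) :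
    ∃ s : SmoothSection V H W, ∀ᶠ x in 𝓝 x₀, s x = u x := by
  obtain ⟨χ, hχ, hχ1⟩ := exists_bump (V := V) hU hx
  refine ⟨⟨(χ : S → ℝ) • u, ContMDiffOn.smul_section_of_tsupport χ.contMDiff.contMDiffOn hU hχ hu⟩,
    ?_⟩
  filter_upwards [hχ1] with x hx
  change χ x • u x = u x
  rw [hx, Pi.one_apply, one_smul]

/-- Smooth functions on an open set extend, after shrinking the set. -/
theorem exists_function_eventuallyEq {x₀ : S} {U : Set S} (hU : IsOpen U) (hx : x₀ ∈ U)
    {u : S → ℝ} (hu : ContMDiffOn 𝓘(ℝ, V) 𝓘(ℝ, ℝ) ∞ u U) :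
    ∃ f : C^∞⟮𝓘(ℝ, V), S; ℝ⟯, (f : S → ℝ) =ᶠ[𝓝 x₀] u := by
  obtain ⟨χ, hχ, hχ1⟩ := exists_bump (V := V) hU hx
  refine ⟨⟨fun x ↦ χ x * u x, contMDiff_of_tsupport fun x hx ↦ ?_⟩, ?_⟩
  · have hx' : x ∈ U := hχ (tsupport_mul_subset_left hx)
    exact (χ.contMDiff x).mul (hu.contMDiffAt (hU.mem_nhds hx'))
  · filter_upwards [hχ1] with x hx
    change χ x * u x = u x
    rw [hx, Pi.one_apply, one_mul]

theorem exists_function_mul {χ : C^∞⟮𝓘(ℝ, V), S; ℝ⟯} {U : Set S} (hU : IsOpen U)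
    (hχ : tsupport χ ⊆ U) {u : S → ℝ} (hu : ContMDiffOn 𝓘(ℝ, V) 𝓘(ℝ, ℝ) ∞ u U) :
    ∃ f : C^∞⟮𝓘(ℝ, V), S; ℝ⟯, ∀ x, f x = χ x * u x := by
  refine ⟨⟨fun x ↦ χ x * u x, contMDiff_of_tsupport fun x hx ↦ ?_⟩, fun x ↦ rfl⟩
  have hx' : x ∈ U := hχ (tsupport_mul_subset_left hx)
  exact (χ.contMDiff x).mul (hu.contMDiffAt (hU.mem_nhds hx'))

theorem coe_finsetSum_section {ι : Type*} (s : Finset ι) (u : ι → SmoothSection V H W) (x : S) :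
    (∑ i ∈ s, u i) x = ∑ i ∈ s, u i x := by
  have := map_sum (ContMDiffSection.coeAddHom 𝓘(ℝ, V) H ∞ W) u s
  exact (congrFun this x).trans (Finset.sum_apply _ _ _)

variable (V H W) in
/-- Around each point there are finitely many global smooth sections which generate, over the
smooth functions, a cut-off `ψ • u` of each section `u`. -/
theorem exists_generators (x₀ : S) :
    ∃ (s : Fin (Module.finrank ℝ H) → SmoothSection V H W) (ψ : C^∞⟮𝓘(ℝ, V), S; ℝ⟯),
      (ψ : S → ℝ) =ᶠ[𝓝 x₀] 1 ∧ LinearIndependent ℝ (fun i ↦ s i x₀) ∧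
      ∀ u : SmoothSection V H W, ∃ f : Fin (Module.finrank ℝ H) → C^∞⟮𝓘(ℝ, V), S; ℝ⟯,
        smulSection ψ u = ∑ i, smulSection (f i) (s i) := by
  let e := trivializationAt H W x₀
  let b := Module.finBasis ℝ H
  have hx₀ : x₀ ∈ e.baseSet := FiberBundle.mem_baseSet_trivializationAt' x₀
  obtain ⟨χ, hχ, hχ1⟩ := exists_bump (V := V) e.open_baseSet hx₀
  have hs (i) : ContMDiff 𝓘(ℝ, V) (𝓘(ℝ, V).prod 𝓘(ℝ, H)) ∞
      (fun x ↦ TotalSpace.mk' H x (((χ : S → ℝ) • e.localFrame b i) x)) :=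
    ContMDiffOn.smul_section_of_tsupport χ.contMDiff.contMDiffOn e.open_baseSet hχ
      (e.contMDiffOn_localFrame_baseSet ∞ b i)
  have hχ0 (x) (hx : x ∉ e.baseSet) : χ x = 0 :=
    image_eq_zero_of_notMem_tsupport fun h ↦ hx (hχ h)
  -- One factor `χ` makes the frame global, the other one the coefficients.
  refine ⟨fun i ↦ ⟨(χ : S → ℝ) • e.localFrame b i, hs i⟩, χ * χ, ?_, ?_, fun u ↦ ?_⟩
  · filter_upwards [hχ1] with x hx
    change χ x * χ x = 1
    rw [hx, Pi.one_apply, one_mul]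
  · have h1 : (fun i ↦ ((χ : S → ℝ) • e.localFrame b i) x₀) = e.basisAt b hx₀ := by
      funext i
      change χ x₀ • e.localFrame b i x₀ = _
      rw [hχ1.eq_of_nhds, Pi.one_apply, one_smul, Trivialization.localFrame_apply_of_mem_baseSet]
    change LinearIndependent ℝ (fun i ↦ ((χ : S → ℝ) • e.localFrame b i) x₀)
    rw [h1]
    exact (e.basisAt b hx₀).linearIndependent
  · have hc (i) := (contMDiffOn_baseSet_localFrameCoeff (e := e) b (I := 𝓘(ℝ, V)) (k := ∞)
      u.contMDiff.contMDiffOn i)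
    choose f hf using fun i ↦ exists_function_mul e.open_baseSet hχ (hc i)
    refine ⟨f, ContMDiffSection.ext fun x ↦ ?_⟩
    rw [coe_finsetSum_section]
    change (χ x * χ x) • u x = ∑ i, f i x • χ x • e.localFrame b i x
    by_cases hx : x ∈ e.baseSet
    · conv_lhs => rw [e.eq_sum_localFrameCoeff_smul (I := 𝓘(ℝ, V)) (b := b) (s := u) hx]
      rw [Finset.smul_sum]
      refine Finset.sum_congr rfl fun i _ ↦ ?_
      rw [hf, smul_smul, smul_smul]
      congr 1
      change _ = χ x * e.localFrameCoeff 𝓘(ℝ, V) b i x (u x) * χ x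
      ring
    · simp [hχ0 x hx]

/-- A map on sections which is linear over the smooth functions at `x` vanishes on the sections
which vanish at `x`. -/
theorem eq_zero_of_section_eq_zero {A : Type*} [AddCommGroup A] [Module ℝ A] {x : S}
    {Φ : SmoothSection V H W → A} (hadd : ∀ s t, Φ (s + t) = Φ s + Φ t)
    (hsmul : ∀ f s, Φ (smulSection f s) = f x • Φ s) {s : SmoothSection V H W} (hs : s x = 0) :
    Φ s = 0 := by
  obtain ⟨u, ψ, hψ, hlin, hu⟩ := exists_generators V H W x
  obtain ⟨f, hf⟩ := hu s
  have hf0 : ∀ i, f i x = 0 := by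
    have h := congrArg (fun s : SmoothSection V H W ↦ s x) hf
    simp only [coe_finsetSum_section, smulSection_apply, hs, smul_zero] at h
    exact Fintype.linearIndependent_iff.1 hlin _ h.symm
  have h1 : Φ (smulSection ψ s) = Φ s := by
    rw [hsmul, hψ.eq_of_nhds, Pi.one_apply, one_smul]
  rw [← h1, hf]
  have h2 := map_sum (AddMonoidHom.mk' Φ hadd) (fun i ↦ smulSection (f i) (u i)) Finset.univ
  refine h2.trans (Finset.sum_eq_zero fun i _ ↦ ?_)
  exact (hsmul _ _).trans (by rw [hf0, zero_smul])

theorem eq_of_section_eq {A : Type*} [AddCommGroup A] [Module ℝ A] {x : S}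
    {Φ : SmoothSection V H W → A} (hadd : ∀ s t, Φ (s + t) = Φ s + Φ t)
    (hsmul : ∀ f s, Φ (smulSection f s) = f x • Φ s) {s t : SmoothSection V H W} (hs : s x = t x) :
    Φ s = Φ t := by
  have h := eq_zero_of_section_eq_zero hadd hsmul (s := s - t)
    (by rw [ContMDiffSection.coe_sub, Pi.sub_apply, hs, sub_self])
  have h2 := hadd (s - t) t
  rwa [sub_add_cancel, h, zero_add] at h2

variable (V H W) in
/-- A linear choice of global sections through the vectors of a fiber. -/
theorem exists_linear_section (x : S) :
    ∃ ext : W x →ₗ[ℝ] SmoothSection V H W, ∀ w, ext w x = w := by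
  let ev : SmoothSection V H W →ₗ[ℝ] W x :=
    { toFun := fun s ↦ s x, map_add' := fun _ _ ↦ rfl, map_smul' := fun _ _ ↦ rfl }
  obtain ⟨g, hg⟩ := ev.exists_rightInverse_of_surjective
    (LinearMap.range_eq_top.2 fun w ↦ exists_section_eq (V := V) w)
  exact ⟨g, LinearMap.congr_fun hg⟩

variable (V S) in
/-- The smooth functions on the base are a test family. -/
theorem isTestFamily_base :
    IsTestFamily 𝓘(ℝ, V) (Set.range fun f : C^∞⟮𝓘(ℝ, V), S; ℝ⟯ ↦ (f : S → ℝ)) where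
  smooth := by rintro _ ⟨f, rfl⟩; exact f.contMDiff
  exists_eq x l := by
    obtain ⟨f, hf⟩ := exists_function_eventuallyEq (isOpen_extChartAt_source (I := 𝓘(ℝ, V)) x)
      (mem_extChartAt_source x) (u := fun z ↦ l (extChartAt 𝓘(ℝ, V) x z))
      ((l.contMDiff (n := ∞)).comp_contMDiffOn (by
        simpa using contMDiffOn_extChartAt (I := 𝓘(ℝ, V)) (n := ∞) (x := x)))
    exact ⟨f, ⟨f, rfl⟩, hf⟩

/-- Around each point of the base there are global vector fields `X i` and functions `f i` which
form, near the point, dual bases of the tangent and cotangent spaces. -/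
theorem exists_coordinate_frame (x₀ : S) :
    ∃ (X : Fin (Module.finrank ℝ V) → SmoothVectorField V S)
      (f : Fin (Module.finrank ℝ V) → C^∞⟮𝓘(ℝ, V), S; ℝ⟯), ∀ᶠ x in 𝓝 x₀,
      (∀ v : TangentSpace 𝓘(ℝ, V) x, v = ∑ i, mvfderiv 𝓘(ℝ, V) (f i) x v • X i x) ∧
      ∀ i j, mvfderiv 𝓘(ℝ, V) (f i) x (X j x) = if i = j then 1 else 0 := by
  let e := trivializationAt V (TangentSpace 𝓘(ℝ, V) : S → Type _) x₀
  let b := Module.finBasis ℝ V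
  have hx₀ : x₀ ∈ e.baseSet := FiberBundle.mem_baseSet_trivializationAt' x₀
  choose X hX using fun i ↦ exists_section_eventuallyEq (V := V) (H := V) e.open_baseSet hx₀
    (e.contMDiffOn_localFrame_baseSet (I := 𝓘(ℝ, V)) ∞ b i)
  choose t ht hf using fun i ↦ (isTestFamily_base V S).exists_eq x₀
    (LinearMap.toContinuousLinearMap (b.coord i))
  choose f hft using ht
  refine ⟨X, f, ?_⟩
  filter_upwards [Filter.eventually_all.2 hX,
    Filter.eventually_all.2 fun i ↦ eventually_eventually_nhds.2 (hf i),
    extChartAt_source_mem_nhds (I := 𝓘(ℝ, V)) x₀, e.open_baseSet.mem_nhds hx₀] with x hX hf hxs hxe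
  have hxs' : x ∈ (chartAt V x₀).source := by simpa using hxs
  have key : ∀ i (v : TangentSpace 𝓘(ℝ, V) x), mvfderiv 𝓘(ℝ, V) (f i) x v
      = (e.basisAt b hxe).repr v i := by
    intro i v
    have h0 : (f i : S → ℝ) = t i := hft i
    rw [h0, mvfderiv_congr (hf i), mvfderiv_clm_extChartAt hxs]
    have h1 := congrArg (fun L : TangentSpace 𝓘(ℝ, V) x →L[ℝ] V ↦ L v)
      (TangentBundle.continuousLinearMapAt_trivializationAt hxs')
    have h2 : e.continuousLinearMapAt ℝ x v = (e ⟨x, v⟩).2 := by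
      rw [Trivialization.continuousLinearMapAt_apply, Trivialization.linearMapAt_apply, if_pos hxe]
    exact congrArg (b.coord i) (h1.symm.trans h2)
  have hXb : ∀ i, X i x = e.basisAt b hxe i := fun i ↦ by
    rw [hX i, Trivialization.localFrame_apply_of_mem_baseSet]
  constructor
  · intro v
    simp only [key, hXb]
    exact ((e.basisAt b hxe).sum_repr v).symm
  · intro i j
    rw [key, hXb, Module.Basis.repr_self, Finsupp.single_apply]
    simp only [eq_comm]

end Frames

/-! ### Functions and tangent vectors on the dual of a vector bundle -/

noncomputable section DualBundles

variable {V : Type*} [NormedAddCommGroup V] [NormedSpace ℝ V] [FiniteDimensional ℝ V]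
  {S : Type*} [TopologicalSpace S] [ChartedSpace V S] [IsManifold 𝓘(ℝ, V) ∞ S] [T2Space S]
  {H : Type*} [NormedAddCommGroup H] [NormedSpace ℝ H] [FiniteDimensional ℝ H]
  {W : S → Type*} [TopologicalSpace (TotalSpace H W)]
  [∀ x, AddCommGroup (W x)] [∀ x, Module ℝ (W x)] [∀ x, TopologicalSpace (W x)]
  [∀ x, IsTopologicalAddGroup (W x)] [∀ x, ContinuousSMul ℝ (W x)]
  [FiberBundle H W] [VectorBundle ℝ H W] [ContMDiffVectorBundle ∞ H W 𝓘(ℝ, V)]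

variable (W) in
/-- The dual of a vector bundle. -/
abbrev DualBundle (x : S) : Type _ := W x →L[ℝ] ℝ

variable (H) in
/-- Model fiber of the dual bundle. -/
abbrev DualFiber : Type _ := H →L[ℝ] ℝ

variable (H W) in
/-- The total space of the dual bundle. -/
abbrev DualTotal : Type _ := TotalSpace (DualFiber H) (DualBundle W)

/-- The fiberwise linear function on the dual bundle given by the pairing with a section. -/
def ellFn (s : SmoothSection V H W) (y : DualTotal H W) : ℝ := y.2 (s y.1)

theorem contMDiff_ellFn (s : SmoothSection V H W) :
    ContMDiff (totalModel V (DualFiber H)) 𝓘(ℝ, ℝ) ∞ (ellFn s) := by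
  have h1 : ContMDiff (totalModel V (DualFiber H)) (𝓘(ℝ, V).prod 𝓘(ℝ, DualFiber H)) ∞
    (fun y : DualTotal H W ↦ TotalSpace.mk' (DualFiber H) (E := DualBundle W) y.1 y.2) :=
    contMDiff_id
  have h2 := ContMDiff.clm_bundle_apply (F₂ := ℝ) (E₂ := Bundle.Trivial S ℝ) h1
    (s.contMDiff.comp (contMDiff_proj (DualBundle W)))
  intro y
  exact ((contMDiffAt_totalSpace ..).1 (h2 y)).2

theorem contMDiff_proj_comp (f : C^∞⟮𝓘(ℝ, V), S; ℝ⟯) :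
    ContMDiff (totalModel V (DualFiber H)) 𝓘(ℝ, ℝ) ∞ (fun y : DualTotal H W ↦ f y.1) :=
  f.contMDiff.comp (contMDiff_proj (DualBundle W))

theorem covec_proj_comp {f : S → ℝ} {y : DualTotal H W}
    (hf : MDifferentiableAt 𝓘(ℝ, V) 𝓘(ℝ, ℝ) f y.1)
    (w : TangentSpace (totalModel V (DualFiber H)) y) :
    covec (totalModel V (DualFiber H)) (fun y : DualTotal H W ↦ f y.1) y w
      = mvfderiv 𝓘(ℝ, V) f y.1 (dproj (V := V) y w) := by
  have hp : MDifferentiableAt (totalModel V (DualFiber H)) 𝓘(ℝ, V)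
      (TotalSpace.proj : DualTotal H W → S) y :=
    (contMDiff_proj (DualBundle W) (n := 1)).mdifferentiableAt (by simp)
  exact mvfderiv_comp_apply y hf hp w

theorem ellFn_add (s t : SmoothSection V H W) (y : DualTotal H W) :
    ellFn (s + t) y = ellFn s y + ellFn t y := map_add y.2 (s y.1) (t y.1)

theorem ellFn_smul (f : C^∞⟮𝓘(ℝ, V), S; ℝ⟯) (s : SmoothSection V H W) (y : DualTotal H W) :
    ellFn (smulSection f s) y = f y.1 * ellFn s y := map_smul y.2 (f y.1) (s y.1)

theorem mdifferentiableAt_ellFn (s : SmoothSection V H W) (y : DualTotal H W) :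
    MDifferentiableAt (totalModel V (DualFiber H)) 𝓘(ℝ, ℝ) (ellFn s) y :=
  (contMDiff_ellFn s).mdifferentiableAt (by simp)

theorem mdifferentiableAt_proj_comp (f : C^∞⟮𝓘(ℝ, V), S; ℝ⟯) (y : DualTotal H W) :
    MDifferentiableAt (totalModel V (DualFiber H)) 𝓘(ℝ, ℝ) (fun y : DualTotal H W ↦ f y.1) y :=
  (contMDiff_proj_comp f).mdifferentiableAt (by simp)

theorem covec_ellFn_add (s t : SmoothSection V H W) (y : DualTotal H W) :
    covec (totalModel V (DualFiber H)) (ellFn (s + t)) y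
      = covec (totalModel V (DualFiber H)) (ellFn s) y
        + covec (totalModel V (DualFiber H)) (ellFn t) y := by
  rw [← covec_add (mdifferentiableAt_ellFn s y) (mdifferentiableAt_ellFn t y)]
  exact congrArg (fun F ↦ covec _ F y) (funext fun z ↦ ellFn_add s t z)

theorem covec_ellFn_smul (f : C^∞⟮𝓘(ℝ, V), S; ℝ⟯) (s : SmoothSection V H W) (y : DualTotal H W)
    (w : TangentSpace (totalModel V (DualFiber H)) y) :
    covec (totalModel V (DualFiber H)) (ellFn (smulSection f s)) y w
      = f y.1 * covec (totalModel V (DualFiber H)) (ellFn s) y w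
        + ellFn s y * mvfderiv 𝓘(ℝ, V) f y.1 (dproj (V := V) y w) := by
  have h := covec_mul (mdifferentiableAt_proj_comp f y) (mdifferentiableAt_ellFn s y)
  have h2 : ellFn (smulSection f s) = fun y : DualTotal H W ↦ f y.1 * ellFn s y :=
    funext fun z ↦ ellFn_smul f s z
  rw [h2, h, LinearMap.add_apply, LinearMap.smul_apply, LinearMap.smul_apply,
    covec_proj_comp (f.contMDiff.mdifferentiableAt (by simp))]
  rfl

theorem exists_eval_eq (l : DualFiber H →L[ℝ] ℝ) : ∃ h : H, ∀ g : DualFiber H, l g = g h := by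
  let l' : Module.Dual ℝ (Module.Dual ℝ H) :=
    l.toLinearMap ∘ₗ (LinearMap.toContinuousLinearMap : (H →ₗ[ℝ] ℝ) ≃ₗ[ℝ] (H →L[ℝ] ℝ)).toLinearMap
  refine ⟨(Module.evalEquiv ℝ H).symm l', fun g ↦ ?_⟩
  have h := Module.apply_evalEquiv_symm_apply (R := ℝ) (M := H) (g : H →ₗ[ℝ] ℝ) l'
  exact h.symm

theorem exists_section_eventuallyEq_symm (x₀ : S) (h : H) :
    ∃ s : SmoothSection V H W, ∀ᶠ x in 𝓝 x₀, s x = (trivializationAt H W x₀).symm x h := by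
  let e := trivializationAt H W x₀
  refine exists_section_eventuallyEq (V := V) e.open_baseSet
    (FiberBundle.mem_baseSet_trivializationAt' x₀) ?_
  rw [e.contMDiffOn_section_baseSet_iff]
  refine (contMDiffOn_const (c := h)).congr fun y hy ↦ ?_
  rw [e.apply_mk_symm hy]

theorem trivializationAt_dual_apply {x₀ : S} {y : DualTotal H W}
    (hy : y.1 ∈ (trivializationAt H W x₀).baseSet) (h : H) :
    (trivializationAt (DualFiber H) (DualBundle W) x₀ y).2 h
      = y.2 ((trivializationAt H W x₀).symm y.1 h) := by
  have h0 := hom_trivializationAt_apply (RingHom.id ℝ) (F₁ := H) (E₁ := W) (F₂ := ℝ)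
    (E₂ := Bundle.Trivial S ℝ) x₀ y
  rw [congrArg Prod.snd h0]
  rw [ContinuousLinearMap.inCoordinates_eq hy (mem_univ _)]
  rfl

variable (V H W) in
/-- The functions `f ∘ p + ℓ(s)` are a test family on the total space of the dual bundle. -/
theorem isTestFamily_dual :
    IsTestFamily (totalModel V (DualFiber H)) {t : DualTotal H W → ℝ |
      ∃ (f : C^∞⟮𝓘(ℝ, V), S; ℝ⟯) (s : SmoothSection V H W), t = fun y ↦ f y.1 + ellFn s y} where
  smooth := by
    rintro _ ⟨f, s, rfl⟩
    exact (contMDiff_proj_comp f).add (contMDiff_ellFn s)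
  exists_eq y₀ l := by
    obtain ⟨_, ⟨f, rfl⟩, hf⟩ := (isTestFamily_base V S).exists_eq y₀.1
      (l.comp (ContinuousLinearMap.inl ℝ V (DualFiber H)))
    obtain ⟨h, hh⟩ := exists_eval_eq (l.comp (ContinuousLinearMap.inr ℝ V (DualFiber H)))
    obtain ⟨s, hs⟩ := exists_section_eventuallyEq_symm (V := V) (W := W) y₀.1 h
    refine ⟨_, ⟨f, s, rfl⟩, ?_⟩
    have hc : Filter.Tendsto (TotalSpace.proj : DualTotal H W → S) (𝓝 y₀) (𝓝 y₀.1) :=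
      (FiberBundle.continuous_proj (DualFiber H) (DualBundle W)).continuousAt
    filter_upwards [hc.eventually hf, hc.eventually hs, hc.eventually
      ((trivializationAt H W y₀.1).open_baseSet.mem_nhds
        (FiberBundle.mem_baseSet_trivializationAt' y₀.1))] with z hz1 hz2 hz3
    have hE : extChartAt (totalModel V (DualFiber H)) y₀ z = (extChartAt 𝓘(ℝ, V) y₀.1 z.1,
        (trivializationAt (DualFiber H) (DualBundle W) y₀.1 z).2) := by
      rw [FiberBundle.extChartAt]
      refine Prod.ext ?_ rfl
      change extChartAt 𝓘(ℝ, V) y₀.1 (trivializationAt (DualFiber H) (DualBundle W) y₀.1 z).1 = _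
      rw [Trivialization.coe_fst']
      exact ⟨hz3, mem_univ _⟩
    have hl : ∀ (a : V) (g : DualFiber H), l (a, g) = l (a, 0) + l (0, g) := fun a g ↦ by
      rw [← map_add]; simp
    rw [hE, hl, ellFn, hz2, ← trivializationAt_dual_apply hz3]
    congr 1
    exact (hh _).symm

theorem covec_test (f : C^∞⟮𝓘(ℝ, V), S; ℝ⟯) (s : SmoothSection V H W) (y : DualTotal H W) :
    covec (totalModel V (DualFiber H)) (fun y : DualTotal H W ↦ f y.1 + ellFn s y) y
      = covec (totalModel V (DualFiber H)) (fun y : DualTotal H W ↦ f y.1) y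
        + covec (totalModel V (DualFiber H)) (ellFn s) y :=
  covec_add (mdifferentiableAt_proj_comp f y) (mdifferentiableAt_ellFn s y)

/-- A tangent vector of the dual bundle is determined by its projection and its action on the
linear functions. -/
theorem eq_of_dproj_of_ellFn {y : DualTotal H W}
    {w w' : TangentSpace (totalModel V (DualFiber H)) y}
    (h1 : dproj (V := V) y w = dproj (V := V) y w')
    (h2 : ∀ s : SmoothSection V H W, covec (totalModel V (DualFiber H)) (ellFn s) y w
      = covec (totalModel V (DualFiber H)) (ellFn s) y w') : w = w' := by
  refine (isTestFamily_dual V H W).eq_of_covec ?_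
  rintro _ ⟨f, s, rfl⟩
  rw [covec_test, LinearMap.add_apply, LinearMap.add_apply, h2,
    covec_proj_comp (f.contMDiff.mdifferentiableAt (by simp)),
    covec_proj_comp (f.contMDiff.mdifferentiableAt (by simp)), h1]

/-- A derivation `δ` along `y` of the linear functions over a tangent vector `v` of the base is the
action of a tangent vector of the dual bundle. -/
theorem exists_tangent_of_derivation (y : DualTotal H W) (v : TangentSpace 𝓘(ℝ, V) y.1)
    (δ : SmoothSection V H W → ℝ) (hadd : ∀ s t, δ (s + t) = δ s + δ t)
    (hsmul : ∀ (f : C^∞⟮𝓘(ℝ, V), S; ℝ⟯) s,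
      δ (smulSection f s) = f y.1 * δ s + ellFn s y * mvfderiv 𝓘(ℝ, V) f y.1 v) :
    ∃ w : TangentSpace (totalModel V (DualFiber H)) y, dproj (V := V) y w = v ∧
      ∀ s : SmoothSection V H W, covec (totalModel V (DualFiber H)) (ellFn s) y w = δ s := by
  obtain ⟨u, ψ, hψ, -, hu⟩ := exists_generators V H W y.1
  -- A derivation over `v` is determined by its values on the generators `u i`.
  have determined : ∀ (v : TangentSpace 𝓘(ℝ, V) y.1) (δ₁ δ₂ : SmoothSection V H W → ℝ),
      (∀ s t, δ₁ (s + t) = δ₁ s + δ₁ t) → (∀ s t, δ₂ (s + t) = δ₂ s + δ₂ t) →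
      (∀ (f : C^∞⟮𝓘(ℝ, V), S; ℝ⟯) s,
        δ₁ (smulSection f s) = f y.1 * δ₁ s + ellFn s y * mvfderiv 𝓘(ℝ, V) f y.1 v) →
      (∀ (f : C^∞⟮𝓘(ℝ, V), S; ℝ⟯) s,
        δ₂ (smulSection f s) = f y.1 * δ₂ s + ellFn s y * mvfderiv 𝓘(ℝ, V) f y.1 v) →
      (∀ i, δ₁ (u i) = δ₂ (u i)) → ∀ s, δ₁ s = δ₂ s := by
    intro v δ₁ δ₂ a₁ a₂ m₁ m₂ hi s
    obtain ⟨f, hf⟩ := hu s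
    have hψ0 : mvfderiv 𝓘(ℝ, V) ψ y.1 v = 0 := by
      rw [mvfderiv_congr hψ]
      exact congrArg (fun L ↦ L v) (mvfderiv_const (I := 𝓘(ℝ, V)) (1 : ℝ) (x := y.1))
    have hψ1 : ψ y.1 = 1 := hψ.eq_of_nhds
    have e₁ := m₁ ψ s
    have e₂ := m₂ ψ s
    rw [hψ0, hψ1, one_mul, mul_zero, add_zero] at e₁ e₂
    rw [← e₁, ← e₂, hf]
    have s₁ := map_sum (AddMonoidHom.mk' δ₁ a₁) (fun i ↦ smulSection (f i) (u i)) Finset.univ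
    have s₂ := map_sum (AddMonoidHom.mk' δ₂ a₂) (fun i ↦ smulSection (f i) (u i)) Finset.univ
    refine s₁.trans (Eq.trans (Finset.sum_congr rfl fun i _ ↦ ?_) s₂.symm)
    exact (m₁ _ _).trans (by rw [hi]; exact (m₂ _ _).symm)
  have leib : ∀ w : TangentSpace (totalModel V (DualFiber H)) y, ∀ (f : C^∞⟮𝓘(ℝ, V), S; ℝ⟯)
      (s : SmoothSection V H W), covec (totalModel V (DualFiber H)) (ellFn (smulSection f s)) y w
      = f y.1 * covec (totalModel V (DualFiber H)) (ellFn s) y w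
        + ellFn s y * mvfderiv 𝓘(ℝ, V) f y.1 (dproj (V := V) y w) :=
    fun w f s ↦ covec_ellFn_smul f s y w
  let Θ : TangentSpace (totalModel V (DualFiber H)) y →ₗ[ℝ]
      TangentSpace 𝓘(ℝ, V) y.1 × (Fin (Module.finrank ℝ H) → ℝ) :=
    (dproj (V := V) y : _ →ₗ[ℝ] TangentSpace 𝓘(ℝ, V) y.1).prod
      (LinearMap.pi fun i ↦ covec (totalModel V (DualFiber H)) (ellFn (u i)) y)
  have hinj : Function.Injective Θ := by
    intro w w' h
    have h1 : dproj (V := V) y w = dproj (V := V) y w' := congrArg Prod.fst h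
    refine eq_of_dproj_of_ellFn h1 (determined (dproj (V := V) y w) _ _ ?_ ?_ (leib w) ?_ ?_)
    · intro s t; rw [covec_ellFn_add]; rfl
    · intro s t; rw [covec_ellFn_add]; rfl
    · rw [h1]; exact leib w'
    · intro i; exact congrFun (congrArg Prod.snd h) i
  have hdim : Module.finrank ℝ (TangentSpace (totalModel V (DualFiber H)) y)
      = Module.finrank ℝ (TangentSpace 𝓘(ℝ, V) y.1 × (Fin (Module.finrank ℝ H) → ℝ)) := by
    have h1 : Module.finrank ℝ (DualFiber H) = Module.finrank ℝ H := by
      rw [← (LinearMap.toContinuousLinearMap : (H →ₗ[ℝ] ℝ) ≃ₗ[ℝ] (H →L[ℝ] ℝ)).finrank_eq]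
      exact Subspace.dual_finrank_eq
    rw [Module.finrank_prod, Module.finrank_fin_fun]
    change Module.finrank ℝ (V × DualFiber H) = Module.finrank ℝ V + _
    rw [Module.finrank_prod, h1]
  obtain ⟨w, hw⟩ := (LinearMap.injective_iff_surjective_of_finrank_eq_finrank hdim).1 hinj
    (v, fun i ↦ δ (u i))
  have hw1 : dproj (V := V) y w = v := congrArg Prod.fst hw
  refine ⟨w, hw1, determined v _ _ ?_ hadd ?_ hsmul fun i ↦ congrFun (congrArg Prod.snd hw) i⟩
  · intro s t; rw [covec_ellFn_add]; rfl
  · rw [← hw1]; exact leib w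

end DualBundles

/-! ### Bundles of Lie algebras with a connection -/

noncomputable section Projection

variable {V : Type*} [NormedAddCommGroup V] [NormedSpace ℝ V]
  {S : Type*} [TopologicalSpace S] [ChartedSpace V S] [IsManifold 𝓘(ℝ, V) ∞ S]
  {G : Type*} [NormedAddCommGroup G] [NormedSpace ℝ G]
  {N : S → Type*} [TopologicalSpace (TotalSpace G N)]
  [∀ x, AddCommGroup (N x)] [∀ x, Module ℝ (N x)] [∀ x, TopologicalSpace (N x)]
  [FiberBundle G N] [VectorBundle ℝ G N] [ContMDiffVectorBundle ∞ G N 𝓘(ℝ, V)]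

theorem dproj_add (y : TotalSpace G N) (v w : TangentSpace (totalModel V G) y) :
    dproj (V := V) y (v + w) = dproj (V := V) y v + dproj (V := V) y w := map_add _ v w

theorem dproj_sub (y : TotalSpace G N) (v w : TangentSpace (totalModel V G) y) :
    dproj (V := V) y (v - w) = dproj (V := V) y v - dproj (V := V) y w := map_sub _ v w

theorem dproj_smul (y : TotalSpace G N) (c : ℝ) (v : TangentSpace (totalModel V G) y) :
    dproj (V := V) y (c • v) = c • dproj (V := V) y v := map_smul _ c v

theorem EhresmannConnection.vert_sub (Γ : EhresmannConnection V G N) (y : TotalSpace G N)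
    (v w : TangentSpace (totalModel V G) y) : Γ.vert y (v - w) = Γ.vert y v - Γ.vert y w :=
  map_sub _ v w

/-- The horizontal lift is the only horizontal vector over a given tangent vector. -/
theorem EhresmannConnection.eq_lift (Γ : EhresmannConnection V G N) {y : TotalSpace G N}
    {w : TangentSpace (totalModel V G) y} (hw : Γ.vert y w = 0) :
    w = Γ.lift y (dproj (V := V) y w) := by
  have h1 : Γ.vert y (Γ.lift y (dproj (V := V) y w)) = 0 := Γ.lift_mem_hor y _
  have h2 := Γ.vert_of_dproj_eq_zero y (w - Γ.lift y (dproj (V := V) y w))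
    (by rw [dproj_sub, Γ.dproj_lift, sub_self])
  rw [Γ.vert_sub, hw, h1, sub_self] at h2
  exact sub_eq_zero.1 h2.symm

theorem EhresmannConnection.vert_eq (Γ : EhresmannConnection V G N) (y : TotalSpace G N)
    (w : TangentSpace (totalModel V G) y) :
    Γ.vert y w = w - Γ.lift y (dproj (V := V) y w) := by
  have h := Γ.eq_lift (y := y) (w := w - Γ.vert y w)
    (by rw [Γ.vert_sub, Γ.vert_of_dproj_eq_zero y _ (Γ.dproj_vert y w), sub_self])
  rw [dproj_sub, Γ.dproj_vert, sub_zero] at h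
  rw [← h, sub_sub_cancel]

end Projection

noncomputable section LieBundles

variable {V : Type*} [NormedAddCommGroup V] [NormedSpace ℝ V] [FiniteDimensional ℝ V]
  {S : Type*} [TopologicalSpace S] [ChartedSpace V S] [IsManifold 𝓘(ℝ, V) ∞ S] [T2Space S]
  {H : Type*} [NormedAddCommGroup H] [NormedSpace ℝ H] [FiniteDimensional ℝ H]
  {W : S → Type*} [TopologicalSpace (TotalSpace H W)]
  [∀ x, AddCommGroup (W x)] [∀ x, Module ℝ (W x)] [∀ x, TopologicalSpace (W x)]
  [∀ x, IsTopologicalAddGroup (W x)] [∀ x, ContinuousSMul ℝ (W x)]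
  [FiberBundle H W] [VectorBundle ℝ H W] [ContMDiffVectorBundle ∞ H W 𝓘(ℝ, V)]

variable (V H W) in
/-- A bundle of Lie algebras with a covariant derivative by derivations of the fiberwise bracket,
and a 2-form `curv` with values in the bundle, which induces the curvature of the covariant
derivative through the adjoint action and satisfies the Bianchi identity. This is the structure on
the isotropy bundle of a transitive Lie algebroid given by a splitting of the anchor. -/
structure CurvedLieBundle where
  br : SmoothSection V H W → SmoothSection V H W → SmoothSection V H W
  nabla : SmoothVectorField V S → SmoothSection V H W → SmoothSection V H W
  curv : SmoothVectorField V S → SmoothVectorField V S → SmoothSection V H W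
  br_skew : ∀ s t, br s t = - br t s
  br_add_right : ∀ s t t', br s (t + t') = br s t + br s t'
  br_smul_right : ∀ s f t, br s (smulSection f t) = smulSection f (br s t)
  br_jacobi : ∀ s t r, br s (br t r) + br t (br r s) + br r (br s t) = 0
  nabla_add_left : ∀ X X' s, nabla (X + X') s = nabla X s + nabla X' s
  nabla_smul_left : ∀ f X s, nabla (smulSection f X) s = smulSection f (nabla X s)
  nabla_add_right : ∀ X s s', nabla X (s + s') = nabla X s + nabla X s'
  nabla_smul_right : ∀ X f s,
    nabla X (smulSection f s) = smulSection f (nabla X s) + smulSection (derivField X f) s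
  nabla_br : ∀ X s t, nabla X (br s t) = br (nabla X s) t + br s (nabla X t)
  curv_skew : ∀ X Y, curv X Y = - curv Y X
  curv_add_right : ∀ X Y Y', curv X (Y + Y') = curv X Y + curv X Y'
  curv_smul_right : ∀ X f Y, curv X (smulSection f Y) = smulSection f (curv X Y)
  nabla_comm : ∀ X Y s, nabla X (nabla Y s) - nabla Y (nabla X s) - nabla (lieBracketField X Y) s
    = br (curv X Y) s
  bianchi : ∀ X Y Z, nabla X (curv Y Z) + nabla Y (curv Z X) + nabla Z (curv X Y)
    = curv (lieBracketField X Y) Z + curv (lieBracketField Y Z) X + curv (lieBracketField Z X) Y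

/-- Constant functions. -/
def constFun (c : ℝ) : C^∞⟮𝓘(ℝ, V), S; ℝ⟯ := ⟨fun _ ↦ c, contMDiff_const⟩

theorem smul_eq_smulSection (c : ℝ) (s : SmoothSection V H W) :
    c • s = smulSection (constFun c) s := rfl

theorem ellFn_neg (s : SmoothSection V H W) (y : DualTotal H W) : ellFn (-s) y = - ellFn s y :=
  map_neg y.2 (s y.1)

theorem ellFn_sub (s t : SmoothSection V H W) (y : DualTotal H W) :
    ellFn (s - t) y = ellFn s y - ellFn t y := map_sub y.2 (s y.1) (t y.1)

theorem ellFn_zero (y : DualTotal H W) : ellFn (0 : SmoothSection V H W) y = 0 := map_zero y.2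

theorem covec_ellFn_const_smul (c : ℝ) (s : SmoothSection V H W) (y : DualTotal H W) :
    covec (totalModel V (DualFiber H)) (ellFn (c • s)) y
      = c • covec (totalModel V (DualFiber H)) (ellFn s) y := by
  ext w
  have h := covec_ellFn_smul (constFun c) s y w
  have h0 : mvfderiv 𝓘(ℝ, V) (constFun (V := V) (S := S) c) y.1 = 0 := mvfderiv_const c
  rw [h0] at h
  refine h.trans ?_
  change c * _ + _ * 0 = c * _
  ring

/-- A section is zero at the base point of `y` if the differential of its linear function kills
the vertical vectors at `y`. -/
theorem eq_zero_of_covec_ellFn_vertical {y : DualTotal H W} {r : SmoothSection V H W}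
    (h : ∀ v, dproj (V := V) y v = 0 → covec (totalModel V (DualFiber H)) (ellFn r) y v = 0) :
    r y.1 = 0 := by
  let e := VectorBundle.continuousLinearEquivAt ℝ H W y.1
  have key : ∀ l : H →L[ℝ] ℝ, l (e (r y.1)) = 0 := by
    intro l
    obtain ⟨w, hw, hw2⟩ := exists_tangent_of_derivation (V := V) (W := W) y 0
      (fun s ↦ l (e (s y.1))) (fun s t ↦ by
        rw [ContMDiffSection.coe_add, Pi.add_apply, map_add, map_add])
      (fun f s ↦ by rw [smulSection_apply, map_smul, map_smul, map_zero, mul_zero, add_zero]; rfl)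
    rw [← hw2]
    exact h w hw
  by_contra hne
  obtain ⟨l, hl⟩ := SeparatingDual.exists_ne_zero (R := ℝ) (V := H)
    (show e (r y.1) ≠ 0 from fun h0 ↦ hne ((map_eq_zero_iff e e.injective).1 h0))
  exact hl (key l)

variable (V H W) in
/-- A linear choice of sections whose linear functions have prescribed vertical differentials. -/
theorem exists_vertical_section (y : DualTotal H W) :
    ∃ κ : Module.Dual ℝ (TangentSpace (totalModel V (DualFiber H)) y) →ₗ[ℝ] SmoothSection V H W,
      ∀ α v, dproj (V := V) y v = 0 →
        covec (totalModel V (DualFiber H)) (ellFn (κ α)) y v = α v := by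
  let vert : Submodule ℝ (TangentSpace (totalModel V (DualFiber H)) y) :=
    LinearMap.ker (dproj (V := V) y : _ →ₗ[ℝ] TangentSpace 𝓘(ℝ, V) y.1)
  let R : SmoothSection V H W →ₗ[ℝ] Module.Dual ℝ vert :=
    { toFun := fun s ↦ (covec (totalModel V (DualFiber H)) (ellFn s) y).domRestrict vert
      map_add' := fun s t ↦ by rw [covec_ellFn_add]; rfl
      map_smul' := fun c s ↦ by rw [covec_ellFn_const_smul]; rfl }
  have hR : LinearMap.range R = ⊤ := by
    refine LinearMap.range_eq_top.2 fun a ↦ ?_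
    obtain ⟨α, hα⟩ := a.exists_extend
    obtain ⟨_, ⟨f, s, rfl⟩, ht⟩ := (isTestFamily_dual V H W).exists_covec_eq y α
    refine ⟨s, LinearMap.ext fun v ↦ ?_⟩
    rw [← hα, ← ht, covec_test]
    change _ = covec (totalModel V (DualFiber H)) (fun y : DualTotal H W ↦ f y.1) y v
      + covec (totalModel V (DualFiber H)) (ellFn s) y v
    have hv : dproj (V := V) y v = 0 := v.2
    rw [covec_proj_comp (f.contMDiff.mdifferentiableAt (by simp)), hv, map_zero, zero_add]
    rfl
  obtain ⟨g, hg⟩ := R.exists_rightInverse_of_surjective hR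
  refine ⟨g ∘ₗ vert.dualRestrict, fun α v hv ↦ ?_⟩
  have h := LinearMap.congr_fun (LinearMap.congr_fun hg (vert.dualRestrict α)) ⟨v, hv⟩
  exact h

namespace CurvedLieBundle

variable (K : CurvedLieBundle V H W)

theorem br_add_left (s s' t : SmoothSection V H W) : K.br (s + s') t = K.br s t + K.br s' t := by
  rw [K.br_skew, K.br_add_right, K.br_skew s t, K.br_skew s' t]; abel

theorem smulSection_neg (f : C^∞⟮𝓘(ℝ, V), S; ℝ⟯) (t : SmoothSection V H W) :
    smulSection f (-t) = - smulSection f t := ContMDiffSection.ext fun x ↦ smul_neg (f x) (t x)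

theorem br_smul_left (f : C^∞⟮𝓘(ℝ, V), S; ℝ⟯) (s t : SmoothSection V H W) :
    K.br (smulSection f s) t = smulSection f (K.br s t) := by
  rw [K.br_skew, K.br_smul_right, K.br_skew s t, smulSection_neg]

theorem curv_add_left (X X' Y : SmoothVectorField V S) :
    K.curv (X + X') Y = K.curv X Y + K.curv X' Y := by
  rw [K.curv_skew, K.curv_add_right, K.curv_skew X Y, K.curv_skew X' Y]; abel

theorem curv_smul_left (f : C^∞⟮𝓘(ℝ, V), S; ℝ⟯) (X Y : SmoothVectorField V S) :
    K.curv (smulSection f X) Y = smulSection f (K.curv X Y) := by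
  rw [K.curv_skew, K.curv_smul_right, K.curv_skew X Y, smulSection_neg]

theorem br_congr {x : S} {s s' t t' : SmoothSection V H W} (hs : s x = s' x) (ht : t x = t' x) :
    K.br s t x = K.br s' t' x :=
  (eq_of_section_eq (Φ := fun s ↦ K.br s t x) (fun a b ↦ by rw [K.br_add_left]; rfl)
    (fun f a ↦ by rw [K.br_smul_left]; rfl) hs).trans
  (eq_of_section_eq (Φ := fun t ↦ K.br s' t x) (fun a b ↦ by rw [K.br_add_right]; rfl)
    (fun f a ↦ by rw [K.br_smul_right]; rfl) ht)

theorem curv_congr {x : S} {X X' Y Y' : SmoothVectorField V S} (hX : X x = X' x)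
    (hY : Y x = Y' x) : K.curv X Y x = K.curv X' Y' x :=
  (eq_of_section_eq (Φ := fun s ↦ K.curv s Y x) (fun a b ↦ by rw [K.curv_add_left]; rfl)
    (fun f a ↦ by rw [K.curv_smul_left]; rfl) hX).trans
  (eq_of_section_eq (Φ := fun t ↦ K.curv X' t x) (fun a b ↦ by rw [K.curv_add_right]; rfl)
    (fun f a ↦ by rw [K.curv_smul_right]; rfl) hY)

theorem nabla_congr {x : S} {X X' : SmoothVectorField V S} (hX : X x = X' x)
    (s : SmoothSection V H W) : K.nabla X s x = K.nabla X' s x :=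
  eq_of_section_eq (Φ := fun X ↦ K.nabla X s x) (fun a b ↦ by rw [K.nabla_add_left]; rfl)
    (fun f a ↦ by rw [K.nabla_smul_left]; rfl) hX

theorem ellFn_congr {y : DualTotal H W} {s t : SmoothSection V H W} (h : s y.1 = t y.1) :
    ellFn s y = ellFn t y := by rw [ellFn, h, ellFn]

theorem exists_lift (y : DualTotal H W) :
    ∃ L : TangentSpace 𝓘(ℝ, V) y.1 →ₗ[ℝ] TangentSpace (totalModel V (DualFiber H)) y,
      (∀ v, dproj (V := V) y (L v) = v) ∧ ∀ (X : SmoothVectorField V S) (s : SmoothSection V H W),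
        covec (totalModel V (DualFiber H)) (ellFn s) y (L (X y.1)) = ellFn (K.nabla X s) y := by
  have h : ∀ v : TangentSpace 𝓘(ℝ, V) y.1, ∃ w : TangentSpace (totalModel V (DualFiber H)) y,
      dproj (V := V) y w = v ∧ ∀ (X : SmoothVectorField V S) (s : SmoothSection V H W), X y.1 = v →
        covec (totalModel V (DualFiber H)) (ellFn s) y w = ellFn (K.nabla X s) y := by
    intro v
    obtain ⟨X, hX⟩ := exists_section_eq (V := V) (F := V) v
    obtain ⟨w, hw, hw2⟩ := exists_tangent_of_derivation (V := V) (W := W) y v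
      (fun s ↦ ellFn (K.nabla X s) y) (fun s t ↦ by rw [K.nabla_add_right, ellFn_add])
      (fun f s ↦ by
        rw [K.nabla_smul_right, ellFn_add, ellFn_smul, ellFn_smul, mul_comm (ellFn s y), ← hX]
        rfl)
    exact ⟨w, hw, fun X' s hX' ↦ (hw2 s).trans
      (ellFn_congr (K.nabla_congr (hX.trans hX'.symm) s))⟩
  choose L hL1 hL2 using h
  refine ⟨{ toFun := L, map_add' := fun v w ↦ ?_, map_smul' := fun c v ↦ ?_ }, hL1,
    fun X s ↦ hL2 _ X s rfl⟩
  · obtain ⟨X, rfl⟩ := exists_section_eq (V := V) (F := V) v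
    obtain ⟨Y, rfl⟩ := exists_section_eq (V := V) (F := V) w
    refine eq_of_dproj_of_ellFn (by rw [dproj_add, hL1, hL1, hL1]) fun s ↦ ?_
    rw [map_add, hL2 _ X s rfl, hL2 _ Y s rfl, hL2 (X y.1 + Y y.1) (X + Y) s rfl,
      K.nabla_add_left, ellFn_add]
  · obtain ⟨X, rfl⟩ := exists_section_eq (V := V) (F := V) v
    refine eq_of_dproj_of_ellFn (by rw [dproj_smul, hL1, hL1]; rfl) fun s ↦ ?_
    rw [map_smul, hL2 _ X s rfl, hL2 (c • X y.1) (c • X) s rfl, smul_eq_smulSection,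
      K.nabla_smul_left,
      ellFn_smul]
    rfl

/-- The horizontal lift of tangent vectors determined by `X̄ ℓ(s) = ℓ(∇_X s)`. -/
def lift (y : DualTotal H W) :
    TangentSpace 𝓘(ℝ, V) y.1 →ₗ[ℝ] TangentSpace (totalModel V (DualFiber H)) y :=
  (K.exists_lift y).choose

theorem dproj_lift (y : DualTotal H W) (v : TangentSpace 𝓘(ℝ, V) y.1) :
    dproj (V := V) y (K.lift y v) = v := (K.exists_lift y).choose_spec.1 v

theorem covec_ellFn_lift (y : DualTotal H W) (X : SmoothVectorField V S)
    (s : SmoothSection V H W) :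
    covec (totalModel V (DualFiber H)) (ellFn s) y (K.lift y (X y.1)) = ellFn (K.nabla X s) y :=
  (K.exists_lift y).choose_spec.2 X s

/-- The action of the lift of an arbitrary tangent vector on a linear function, in a coordinate
frame. -/
theorem eventually_covec_ellFn_lift (y₀ : DualTotal H W) (s : SmoothSection V H W) :
    ∃ (X : Fin (Module.finrank ℝ V) → SmoothVectorField V S)
      (f : Fin (Module.finrank ℝ V) → C^∞⟮𝓘(ℝ, V), S; ℝ⟯), ∀ᶠ y in 𝓝 y₀,
      ∀ w : TangentSpace (totalModel V (DualFiber H)) y,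
      covec (totalModel V (DualFiber H)) (ellFn s) y (K.lift y (dproj (V := V) y w))
        = ∑ i, covec (totalModel V (DualFiber H)) (fun y : DualTotal H W ↦ f i y.1) y w
          * ellFn (K.nabla (X i) s) y := by
  obtain ⟨X, f, h⟩ := exists_coordinate_frame (V := V) y₀.1
  have hc : Filter.Tendsto (TotalSpace.proj : DualTotal H W → S) (𝓝 y₀) (𝓝 y₀.1) :=
    (FiberBundle.continuous_proj (DualFiber H) (DualBundle W)).continuousAt
  refine ⟨X, f, ?_⟩
  filter_upwards [hc.eventually h] with y hy w
  have h1 := hy.1 (dproj (V := V) y w)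
  conv_lhs => rw [h1]
  rw [map_sum, map_sum]
  refine Finset.sum_congr rfl fun i _ ↦ ?_
  rw [map_smul, map_smul, K.covec_ellFn_lift,
    covec_proj_comp ((f i).contMDiff.mdifferentiableAt (by simp))]
  rfl

/-- The Ehresmann connection on the dual bundle induced by the covariant derivative. The tangent
spaces are by definition the finite-dimensional model spaces, so the linear lift is continuous. -/
def conn : EhresmannConnection V (DualFiber H) (DualBundle W) where
  vert y := ContinuousLinearMap.id ℝ _ - (show V →L[ℝ] V × DualFiber H from
    LinearMap.toContinuousLinearMap (show V →ₗ[ℝ] V × DualFiber H from K.lift y)).comp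
      (dproj (V := V) y)
  contMDiff_vert Z := by
    rw [← contMDiffOn_univ]
    refine (isTestFamily_dual V H W).smoothFieldOn isOpen_univ ?_
    rintro _ ⟨f, s, rfl⟩
    rw [contMDiffOn_univ]
    intro y₀
    have hZ : SmoothFieldOn (fun y ↦ Z y) (univ : Set (DualTotal H W)) := Z.contMDiff.contMDiffOn
    obtain ⟨X, g, hX⟩ := K.eventually_covec_ellFn_lift y₀ s
    have hs : ContMDiff (totalModel V (DualFiber H)) 𝓘(ℝ, ℝ) ∞
        (fun y : DualTotal H W ↦ derivAlong (fun y ↦ Z y) (ellFn s) y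
          - ∑ i, derivAlong (fun y ↦ Z y) (fun y : DualTotal H W ↦ g i y.1) y
            * ellFn (K.nabla (X i) s) y) := by
      have h0 : ∀ t : DualTotal H W → ℝ, ContMDiff (totalModel V (DualFiber H)) 𝓘(ℝ, ℝ) ∞ t →
          ContMDiff (totalModel V (DualFiber H)) 𝓘(ℝ, ℝ) ∞ (derivAlong (fun y ↦ Z y) t) :=
        fun t ht ↦ contMDiffOn_univ.1 (hZ.derivAlong isOpen_univ ht.contMDiffOn)
      refine (h0 _ (contMDiff_ellFn s)).sub (contMDiff_finsetSum fun i _ ↦ ?_)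
      exact (h0 _ (contMDiff_proj_comp (g i))).mul (contMDiff_ellFn _)
    refine (hs y₀).congr_of_eventuallyEq ?_
    filter_upwards [hX] with y hy
    rw [derivAlong_eq_covec, covec_test, LinearMap.add_apply]
    change covec _ _ y (Z y - K.lift y (dproj (V := V) y (Z y)))
      + covec _ _ y (Z y - K.lift y (dproj (V := V) y (Z y))) = _
    rw [map_sub, map_sub, hy, covec_proj_comp (f.contMDiff.mdifferentiableAt (by simp)),
      covec_proj_comp (f.contMDiff.mdifferentiableAt (by simp)), dproj_lift, sub_self, zero_add]
    rfl
  dproj_vert y v := by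
    change dproj (V := V) y (v - K.lift y (dproj (V := V) y v)) = 0
    rw [dproj_sub, dproj_lift, sub_self]
  vert_of_dproj_eq_zero y v hv := by
    change v - K.lift y (dproj (V := V) y v) = v
    rw [hv, map_zero, sub_zero]

end CurvedLieBundle

end LieBundles

/-! ### The induced geometric data -/

noncomputable section InducedData

variable {V : Type*} [NormedAddCommGroup V] [NormedSpace ℝ V] [FiniteDimensional ℝ V]
  {S : Type*} [TopologicalSpace S] [ChartedSpace V S] [IsManifold 𝓘(ℝ, V) ∞ S] [T2Space S]
  {H : Type*} [NormedAddCommGroup H] [NormedSpace ℝ H] [FiniteDimensional ℝ H]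
  {W : S → Type*} [TopologicalSpace (TotalSpace H W)]
  [∀ x, AddCommGroup (W x)] [∀ x, Module ℝ (W x)] [∀ x, TopologicalSpace (W x)]
  [∀ x, IsTopologicalAddGroup (W x)] [∀ x, ContinuousSMul ℝ (W x)]
  [FiberBundle H W] [VectorBundle ℝ H W] [ContMDiffVectorBundle ∞ H W 𝓘(ℝ, V)]

/-- The smooth function `ω(X, Y)`. -/
def SymplecticForm.fn (Ω : SymplecticForm V S) (X Y : SmoothVectorField V S) :
    C^∞⟮𝓘(ℝ, V), S; ℝ⟯ where
  val x := Ω.toFun x (X x) (Y x)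
  property := by
    have h1 := ContMDiff.clm_bundle_apply (F₂ := V →L[ℝ] ℝ)
      (E₂ := fun x : S ↦ TangentSpace 𝓘(ℝ, V) x →L[ℝ] ℝ) Ω.contMDiff_toFun X.contMDiff
    have h2 := ContMDiff.clm_bundle_apply (F₂ := ℝ) (E₂ := Bundle.Trivial S ℝ) h1 Y.contMDiff
    intro y
    exact ((contMDiffAt_totalSpace ..).1 (h2 y)).2

theorem ellFn_zeroSection (s : SmoothSection V H W) (x : S) :
    ellFn s (zeroSection (DualFiber H) (DualBundle W) x) = 0 := rfl

namespace CurvedLieBundle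

variable (K : CurvedLieBundle V H W)

/-- A linear choice of sections whose linear functions have prescribed vertical differentials at
`y`. -/
def vertSection (y : DualTotal H W) :
    Module.Dual ℝ (TangentSpace (totalModel V (DualFiber H)) y) →ₗ[ℝ] SmoothSection V H W :=
  (exists_vertical_section V H W y).choose

theorem vertSection_apply {y : DualTotal H W}
    {α : Module.Dual ℝ (TangentSpace (totalModel V (DualFiber H)) y)} {s : SmoothSection V H W}
    (h : ∀ v, dproj (V := V) y v = 0 → covec (totalModel V (DualFiber H)) (ellFn s) y v = α v) :
    vertSection y α y.1 = s y.1 := by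
  have h1 := (exists_vertical_section V H W y).choose_spec α
  have h2 := eq_zero_of_covec_ellFn_vertical (y := y) (r := vertSection y α + (-1 : ℝ) • s)
    fun v hv ↦ by
      rw [covec_ellFn_add, covec_ellFn_const_smul, LinearMap.add_apply, LinearMap.smul_apply,
        h v hv, vertSection, h1 v hv, smul_eq_mul]
      ring
  have h3 : vertSection y α y.1 + (-1 : ℝ) • s y.1 = 0 := h2
  rw [neg_smul, one_smul] at h3
  exact (sub_eq_zero.1 ((sub_eq_add_neg _ _).trans h3))

/-- The vertical bivector `ν` with `ν(dℓ(s), dℓ(t)) = ℓ([s, t])`: the fiberwise linear Poisson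
structure on the dual of a bundle of Lie algebras. -/
def linearBivector : BivectorFamily (totalModel V (DualFiber H)) (DualTotal H W) := fun y ↦
  LinearMap.mk₂ ℝ (fun α β ↦ ellFn (K.br (vertSection y α) (vertSection y β)) y)
    (fun α α' β ↦ by rw [map_add, K.br_add_left, ellFn_add])
    (fun c α β ↦ by rw [map_smul, smul_eq_smulSection, K.br_smul_left, ellFn_smul]; rfl)
    (fun α β β' ↦ by rw [map_add, K.br_add_right, ellFn_add])
    (fun c α β ↦ by rw [map_smul, smul_eq_smulSection, K.br_smul_right, ellFn_smul]; rfl)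

theorem linearBivector_apply {y : DualTotal H W}
    {α β : Module.Dual ℝ (TangentSpace (totalModel V (DualFiber H)) y)}
    {s t : SmoothSection V H W}
    (hs : ∀ v, dproj (V := V) y v = 0 → covec (totalModel V (DualFiber H)) (ellFn s) y v = α v)
    (ht : ∀ v, dproj (V := V) y v = 0 → covec (totalModel V (DualFiber H)) (ellFn t) y v = β v) :
    K.linearBivector y α β = ellFn (K.br s t) y :=
  ellFn_congr (K.br_congr (vertSection_apply hs) (vertSection_apply ht))

theorem covec_test_vertical (f : C^∞⟮𝓘(ℝ, V), S; ℝ⟯) (s : SmoothSection V H W) (y : DualTotal H W)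
    (v : TangentSpace (totalModel V (DualFiber H)) y) (hv : dproj (V := V) y v = 0) :
    covec (totalModel V (DualFiber H)) (ellFn s) y v
      = covec (totalModel V (DualFiber H)) (fun y : DualTotal H W ↦ f y.1 + ellFn s y) y v := by
  rw [covec_test, LinearMap.add_apply, covec_proj_comp (f.contMDiff.mdifferentiableAt (by simp)),
    hv, map_zero, zero_add]

theorem linearBivector_test (f g : C^∞⟮𝓘(ℝ, V), S; ℝ⟯) (s t : SmoothSection V H W) :
    K.linearBivector.pair (fun y ↦ f y.1 + ellFn s y) (fun y ↦ g y.1 + ellFn t y)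
      = ellFn (K.br s t) :=
  funext fun y ↦ K.linearBivector_apply (covec_test_vertical f s y) (covec_test_vertical g t y)

theorem ellFn_eq_test (s : SmoothSection V H W) :
    ellFn s = fun y : DualTotal H W ↦ constFun (V := V) (S := S) 0 y.1 + ellFn s y :=
  funext fun y ↦ (zero_add (ellFn s y)).symm

theorem linearBivector_ellFn (s t : SmoothSection V H W) :
    K.linearBivector.pair (ellFn s) (ellFn t) = ellFn (K.br s t) := by
  conv_lhs => rw [ellFn_eq_test s, ellFn_eq_test t]
  exact K.linearBivector_test _ _ s t

theorem linearBivector_alt (y : DualTotal H W) (α) : K.linearBivector y α α = 0 := by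
  have h : ellFn (K.br (vertSection y α) (vertSection y α)) y
      = - ellFn (K.br (vertSection y α) (vertSection y α)) y := by
    conv_lhs => rw [K.br_skew, ellFn_neg]
  change ellFn (K.br (vertSection y α) (vertSection y α)) y = 0
  linarith

theorem linearBivector_vertical (y : DualTotal H W) (α β)
    (h : ∀ v, dproj (V := V) y v = 0 → α v = 0) : K.linearBivector y α β = 0 := by
  obtain ⟨_, ⟨g, t, rfl⟩, rfl⟩ := (isTestFamily_dual V H W).exists_covec_eq y β
  rw [K.linearBivector_apply (s := 0) (fun v hv ↦ ?_) (covec_test_vertical g t y)]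
  · exact (ellFn_congr (K.br_congr (s := 0) (s' := (0 : ℝ) • 0) (zero_smul ℝ _).symm rfl)).trans
      (by rw [smul_eq_smulSection, K.br_smul_left, ellFn_smul]; exact zero_mul _)
  · rw [h v hv, ← zero_smul ℝ (0 : SmoothSection V H W), covec_ellFn_const_smul, zero_smul]
    rfl

theorem isBivectorField_linearBivector : K.linearBivector.IsBivectorFieldOn univ := by
  refine (isTestFamily_dual V H W).isBivectorFieldOn isOpen_univ
    (fun y _ ↦ K.linearBivector_alt y) ?_
  rintro _ ⟨f, s, rfl⟩ _ ⟨g, t, rfl⟩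
  rw [linearBivector_test]
  exact (contMDiff_ellFn _).contMDiffOn

variable (Ω : SymplecticForm V S)

/-- The 2-form `ω ⊗ 1 + ℓ ∘ R` on the base with values in the functions on the dual bundle. -/
def couplingTwo (y : DualTotal H W) :
    TangentSpace 𝓘(ℝ, V) y.1 →ₗ[ℝ] TangentSpace 𝓘(ℝ, V) y.1 →ₗ[ℝ] ℝ :=
  let ext := (exists_linear_section V V (TangentSpace 𝓘(ℝ, V) : S → Type _) y.1).choose
  LinearMap.mk₂ ℝ (fun v w ↦ Ω.toFun y.1 v w + ellFn (K.curv (ext v) (ext w)) y)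
    (fun v v' w ↦ by
      rw [map_add, map_add, K.curv_add_left, ellFn_add, add_apply]; ring)
    (fun c v w ↦ by
      rw [map_smul, map_smul, smul_eq_smulSection, K.curv_smul_left, ellFn_smul,
        smul_apply, smul_eq_mul, smul_eq_mul, mul_add]; rfl)
    (fun v w w' ↦ by rw [map_add, map_add, K.curv_add_right, ellFn_add]; ring)
    (fun c v w ↦ by
      rw [map_smul, map_smul, smul_eq_smulSection, K.curv_smul_right, ellFn_smul,
        smul_eq_mul, smul_eq_mul, mul_add]; rfl)

theorem couplingTwo_apply (X Y : SmoothVectorField V S) (y : DualTotal H W) :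
    K.couplingTwo Ω y (X y.1) (Y y.1) = Ω.fn X Y y.1 + ellFn (K.curv X Y) y := by
  have h := (exists_linear_section V V (TangentSpace 𝓘(ℝ, V) : S → Type _) y.1).choose_spec
  change Ω.toFun y.1 (X y.1) (Y y.1) + _ = Ω.toFun y.1 (X y.1) (Y y.1) + _
  exact congrArg _ (ellFn_congr (K.curv_congr (h _) (h _)))

/-- The geometric data induced by a bundle of Lie algebras with connection and curvature. -/
def geometricData : GeometricData (DualFiber H) (DualBundle W) Ω where
  conn := K.conn
  ν := K.linearBivector
  ν_isBivectorField := K.isBivectorField_linearBivector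
  ν_vertical := K.linearBivector_vertical
  φ := K.couplingTwo Ω
  φ_alt y v := by
    obtain ⟨X, rfl⟩ := exists_section_eq (V := V) (F := V) v
    have h : ellFn (K.curv X X) y = - ellFn (K.curv X X) y := by
      conv_lhs => rw [K.curv_skew, ellFn_neg]
    have h2 : Ω.fn X X y.1 = 0 := Ω.alt _ _
    rw [K.couplingTwo_apply, h2]
    linarith
  φ_smooth X Y := by
    simp only [K.couplingTwo_apply]
    exact (contMDiff_proj_comp _).add (contMDiff_ellFn _)
  φ_zeroSection x v w := by
    obtain ⟨X, rfl⟩ := exists_section_eq (V := V) (F := V) v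
    obtain ⟨Y, rfl⟩ := exists_section_eq (V := V) (F := V) w
    have h := K.couplingTwo_apply Ω X Y (zeroSection (DualFiber H) (DualBundle W) x)
    rw [ellFn_zeroSection, add_zero] at h
    exact h

theorem conn_lift (y : DualTotal H W) (v : TangentSpace 𝓘(ℝ, V) y.1) :
    K.conn.lift y v = K.lift y v := by
  have h := K.conn.eq_lift (y := y) (w := K.lift y v) (by
    change K.lift y v - K.lift y (dproj (V := V) y (K.lift y v)) = 0
    rw [K.dproj_lift, sub_self])
  rw [K.dproj_lift] at h
  exact h.symm

theorem derivAlong_liftField_ellFn (X : SmoothVectorField V S) (s : SmoothSection V H W) :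
    derivAlong (K.conn.liftField X) (ellFn s) = ellFn (K.nabla X s) := by
  funext y
  rw [derivAlong_eq_covec, EhresmannConnection.liftField, K.conn_lift, K.covec_ellFn_lift]

end CurvedLieBundle

section Lifts

variable (Γ : EhresmannConnection V (DualFiber H) (DualBundle W))

theorem derivAlong_liftField_proj (X : SmoothVectorField V S) (f : C^∞⟮𝓘(ℝ, V), S; ℝ⟯) :
    derivAlong (Γ.liftField X) (fun y ↦ f y.1) = fun y ↦ derivField X f y.1 := by
  funext y
  rw [derivAlong_eq_covec, covec_proj_comp (f.contMDiff.mdifferentiableAt (by simp)),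
    EhresmannConnection.liftField, Γ.dproj_lift]
  rfl

end Lifts

namespace CurvedLieBundle

variable (K : CurvedLieBundle V H W)

theorem derivAlong_liftField_test (X : SmoothVectorField V S) (f : C^∞⟮𝓘(ℝ, V), S; ℝ⟯)
    (s : SmoothSection V H W) :
    derivAlong (K.conn.liftField X) (fun y ↦ f y.1 + ellFn s y)
      = fun y ↦ derivField X f y.1 + ellFn (K.nabla X s) y := by
  funext y
  rw [derivAlong_add _ (mdifferentiableAt_proj_comp f y) (mdifferentiableAt_ellFn s y),
    derivAlong_liftField_proj, K.derivAlong_liftField_ellFn]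

theorem smoothFieldOn_liftField (X : SmoothVectorField V S) :
    SmoothFieldOn (K.conn.liftField X) univ := by
  refine (isTestFamily_dual V H W).smoothFieldOn isOpen_univ ?_
  rintro _ ⟨f, s, rfl⟩
  rw [K.derivAlong_liftField_test]
  exact ((contMDiff_proj_comp _).add (contMDiff_ellFn _)).contMDiffOn

/-- The induced geometric data are determined by their values on linear functions. -/
theorem geometricData_unique {Ω : SymplecticForm V S}
    (D : GeometricData (DualFiber H) (DualBundle W) Ω)
    (h1 : ∀ (X : SmoothVectorField V S) (s : SmoothSection V H W) (y : DualTotal H W),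
      derivAlong (D.conn.liftField X) (ellFn s) y = ellFn (K.nabla X s) y)
    (h2 : ∀ (s t : SmoothSection V H W) (y : DualTotal H W),
      D.ν.pair (ellFn s) (ellFn t) y = ellFn (K.br s t) y)
    (h3 : ∀ (X Y : SmoothVectorField V S) (y : DualTotal H W),
      D.φ y (X y.1) (Y y.1) = Ω.toFun y.1 (X y.1) (Y y.1) + ellFn (K.curv X Y) y) :
    D = K.geometricData Ω := by
  have hconn : D.conn = K.conn := by
    have hlift : ∀ (y : DualTotal H W) (v : TangentSpace 𝓘(ℝ, V) y.1),
        D.conn.lift y v = K.conn.lift y v := by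
      intro y v
      obtain ⟨X, rfl⟩ := exists_section_eq (V := V) (F := V) v
      refine eq_of_dproj_of_ellFn (by rw [EhresmannConnection.dproj_lift,
        EhresmannConnection.dproj_lift]) fun s ↦ ?_
      exact (h1 X s y).trans (congrFun (K.derivAlong_liftField_ellFn X s) y).symm
    have hvert : D.conn.vert = K.conn.vert := by
      funext y
      ext1 w
      rw [EhresmannConnection.vert_eq, EhresmannConnection.vert_eq, hlift]
    cases hD : D.conn
    cases hK : K.conn
    rw [hD, hK] at hvert
    congr
  have hν : D.ν = K.linearBivector := by
    funext y
    have hvl : ∀ α β, (∀ v, dproj (V := V) y v = 0 → α v = 0) → D.ν y α β = 0 := D.ν_vertical y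
    have hsk : ∀ α β, D.ν y α β = - D.ν y β α :=
      BivectorFamily.skew_of_alt (D.ν_isBivectorField.alt y (mem_univ y))
    have hbase : ∀ (f : C^∞⟮𝓘(ℝ, V), S; ℝ⟯) (v), dproj (V := V) y v = 0 →
        covec (totalModel V (DualFiber H)) (fun y : DualTotal H W ↦ f y.1) y v = 0 :=
      fun f v hv ↦ by
        rw [covec_proj_comp (f.contMDiff.mdifferentiableAt (by simp)), hv, map_zero]
    refine LinearMap.ext fun α ↦ LinearMap.ext fun β ↦ ?_
    obtain ⟨_, ⟨f, s, rfl⟩, rfl⟩ := (isTestFamily_dual V H W).exists_covec_eq y α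
    obtain ⟨_, ⟨g, t, rfl⟩, rfl⟩ := (isTestFamily_dual V H W).exists_covec_eq y β
    refine Eq.trans ?_ (congrFun (K.linearBivector_test f g s t) y).symm
    rw [covec_test, map_add, LinearMap.add_apply, hvl _ _ (hbase f), zero_add, hsk, covec_test,
      map_add, LinearMap.add_apply, hvl _ _ (hbase g), zero_add, ← hsk]
    exact h2 s t y
  have hφ : D.φ = K.couplingTwo Ω := by
    funext y
    refine LinearMap.ext fun v ↦ LinearMap.ext fun w ↦ ?_
    obtain ⟨X, rfl⟩ := exists_section_eq (V := V) (F := V) v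
    obtain ⟨Y, rfl⟩ := exists_section_eq (V := V) (F := V) w
    exact (h3 X Y y).trans (K.couplingTwo_apply Ω X Y y).symm
  cases D
  simp only at hconn hν hφ
  subst hconn hν hφ
  rfl

/-- A smooth function which is linear on the fibers of the dual bundle is, over a neighbourhood of
each point, a linear combination of linear functions `ℓ(s i)` with coefficients on the base. -/
theorem exists_eq_sum_of_isLinearMap {F : DualTotal H W → ℝ}
    (hF : ContMDiff (totalModel V (DualFiber H)) 𝓘(ℝ, ℝ) ∞ F)
    (hlin : ∀ x, IsLinearMap ℝ fun ξ : DualBundle W x ↦ F ⟨x, ξ⟩) (x₀ : S) :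
    ∃ (s : Fin (Module.finrank ℝ H) → SmoothSection V H W)
      (g : Fin (Module.finrank ℝ H) → C^∞⟮𝓘(ℝ, V), S; ℝ⟯), ∀ᶠ x in 𝓝 x₀,
      ∀ ξ : DualBundle W x, F ⟨x, ξ⟩ = ∑ i, g i x * ellFn (s i) ⟨x, ξ⟩ := by
  let e := trivializationAt H W x₀
  let e' := trivializationAt (DualFiber H) (DualBundle W) x₀
  let b := Module.finBasis ℝ H
  have hx₀ : x₀ ∈ e.baseSet := FiberBundle.mem_baseSet_trivializationAt' x₀
  have hx₀' : x₀ ∈ e'.baseSet := FiberBundle.mem_baseSet_trivializationAt' x₀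
  choose s hs using fun i ↦ exists_section_eventuallyEq_symm (V := V) (W := W) x₀ (b i)
  have hθ (i) : ContMDiffOn 𝓘(ℝ, V) (𝓘(ℝ, V).prod 𝓘(ℝ, DualFiber H)) ∞
      (fun x ↦ TotalSpace.mk' (DualFiber H) x
        (e'.symm x (LinearMap.toContinuousLinearMap (b.coord i)))) e'.baseSet := by
    rw [e'.contMDiffOn_section_baseSet_iff]
    refine (contMDiffOn_const (c := LinearMap.toContinuousLinearMap (b.coord i))).congr
      fun y hy ↦ ?_
    rw [e'.apply_mk_symm hy]
  choose g hg using fun i ↦ exists_function_eventuallyEq (V := V) e'.open_baseSet hx₀'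
    (hF.comp_contMDiffOn (hθ i))
  refine ⟨s, g, ?_⟩
  filter_upwards [Filter.eventually_all.2 hs, Filter.eventually_all.2 hg,
    e.open_baseSet.mem_nhds hx₀, e'.open_baseSet.mem_nhds hx₀'] with x hsx hgx hx hx' ξ
  have hξ : ξ = ∑ i, ellFn (s i) ⟨x, ξ⟩ •
      e'.symm x (LinearMap.toContinuousLinearMap (b.coord i)) := by
    have h1 : (e' ⟨x, ξ⟩).2 = ∑ i, ellFn (s i) (⟨x, ξ⟩ : DualTotal H W) •
        LinearMap.toContinuousLinearMap (b.coord i) := by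
      ext h
      have hh : h = ∑ i, b.coord i h • b i := (b.sum_repr h).symm
      conv_lhs => rw [hh]
      rw [map_sum, sum_apply]
      refine Finset.sum_congr rfl fun i _ ↦ ?_
      have h2 := trivializationAt_dual_apply (W := W) (y := ⟨x, ξ⟩) hx (b i)
      rw [map_smul, h2, ← hsx i]
      exact mul_comm _ _
    have h3 : ξ = e'.symm x (e' ⟨x, ξ⟩).2 := (e'.symm_apply_apply_mk hx' ξ).symm
    have hL : ∀ v, e'.symm x v = e'.symmₗ ℝ x v := fun v ↦ (e'.symmₗ_apply (R := ℝ) hx' v).symm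
    conv_lhs => rw [h3, h1, hL, map_sum]
    exact Finset.sum_congr rfl fun i _ ↦ by rw [map_smul, hL]
  have h5 : ∀ η : DualBundle W x, F ⟨x, η⟩ = (hlin x).mk' _ η := fun η ↦ rfl
  conv_lhs => rw [hξ, h5, map_sum]
  refine Finset.sum_congr rfl fun i _ ↦ ?_
  rw [map_smul, hgx i, smul_eq_mul, mul_comm]
  rfl

theorem isHomogeneous_conn : K.conn.IsHomogeneous := by
  intro X F hF hlin
  refine ⟨contMDiffOn_univ.1 ((K.smoothFieldOn_liftField X).derivAlong isOpen_univ hF.contMDiffOn),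
    fun x₀ ↦ ?_⟩
  obtain ⟨s, g, hsg⟩ := exists_eq_sum_of_isLinearMap hF hlin x₀
  have key : ∀ ξ : DualBundle W x₀, derivAlong (K.conn.liftField X) F ⟨x₀, ξ⟩
      = ∑ i, (g i x₀ * ξ (K.nabla X (s i) x₀) + ξ (s i x₀) * derivField X (g i) x₀) := by
    intro ξ
    have hc : Filter.Tendsto (TotalSpace.proj : DualTotal H W → S) (𝓝 ⟨x₀, ξ⟩) (𝓝 x₀) :=
      (FiberBundle.continuous_proj (DualFiber H) (DualBundle W)).continuousAt
    have heq : F =ᶠ[𝓝 (⟨x₀, ξ⟩ : DualTotal H W)] fun y ↦ ∑ i, g i y.1 * ellFn (s i) y := by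
      filter_upwards [hc.eventually hsg] with y hy using hy y.2
    rw [derivAlong_congr _ heq, derivAlong_sum]
    · refine Finset.sum_congr rfl fun i _ ↦ ?_
      rw [derivAlong_mul _ (mdifferentiableAt_proj_comp (g i) _) (mdifferentiableAt_ellFn (s i) _),
        derivAlong_liftField_proj, K.derivAlong_liftField_ellFn]
      rfl
    · exact fun i ↦ (mdifferentiableAt_proj_comp (g i) _).mul (mdifferentiableAt_ellFn (s i) _)
  constructor
  · intro ξ η
    rw [key, key, key, ← Finset.sum_add_distrib]
    refine Finset.sum_congr rfl fun i _ ↦ ?_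
    simp only [add_apply]
    ring
  · intro c ξ
    rw [key, key, Finset.smul_sum]
    refine Finset.sum_congr rfl fun i _ ↦ ?_
    simp only [smul_apply, smul_eq_mul]
    ring

end CurvedLieBundle

end InducedData

/-! ### Integrability of the induced data -/

noncomputable section Integrability

variable {V : Type*} [NormedAddCommGroup V] [NormedSpace ℝ V] [FiniteDimensional ℝ V]
  {S : Type*} [TopologicalSpace S] [ChartedSpace V S] [IsManifold 𝓘(ℝ, V) ∞ S] [T2Space S]
  {H : Type*} [NormedAddCommGroup H] [NormedSpace ℝ H] [FiniteDimensional ℝ H]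
  {W : S → Type*} [TopologicalSpace (TotalSpace H W)]
  [∀ x, AddCommGroup (W x)] [∀ x, Module ℝ (W x)] [∀ x, TopologicalSpace (W x)]
  [∀ x, IsTopologicalAddGroup (W x)] [∀ x, ContinuousSMul ℝ (W x)]
  [FiberBundle H W] [VectorBundle ℝ H W] [ContMDiffVectorBundle ∞ H W 𝓘(ℝ, V)]

/-- Brackets of horizontal lifts project to brackets on the base. -/
theorem dproj_mlieBracket_liftField (Γ : EhresmannConnection V (DualFiber H) (DualBundle W))
    {X Y : SmoothVectorField V S} (hX : SmoothFieldOn (Γ.liftField X) univ)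
    (hY : SmoothFieldOn (Γ.liftField Y) univ) (y : DualTotal H W) :
    dproj (V := V) y (VectorField.mlieBracket (totalModel V (DualFiber H)) (Γ.liftField X)
      (Γ.liftField Y) y) = lieBracketField X Y y.1 := by
  have : CompleteSpace (V × DualFiber H) := FiniteDimensional.complete ℝ _
  rw [← sub_eq_zero]
  refine eq_zero_of_mvfderiv fun f ↦ ?_
  have h := derivAlong_mlieBracket isOpen_univ hX hY (contMDiff_proj_comp f).contMDiffOn
    (mem_univ y)
  rw [derivAlong_liftField_proj, derivAlong_liftField_proj, derivAlong_liftField_proj,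
    derivAlong_liftField_proj, derivAlong_eq_covec,
    covec_proj_comp (f.contMDiff.mdifferentiableAt (by simp))] at h
  rw [map_sub, h, mvfderiv_lieBracketField, sub_self]

namespace CurvedLieBundle

variable (K : CurvedLieBundle V H W) (Ω : SymplecticForm V S)

theorem linearBivector_ellFn_test (g : C^∞⟮𝓘(ℝ, V), S; ℝ⟯) (s t : SmoothSection V H W) :
    K.linearBivector.pair (ellFn s) (fun y ↦ g y.1 + ellFn t y) = ellFn (K.br s t) := by
  conv_lhs => rw [ellFn_eq_test s]
  exact K.linearBivector_test _ _ s t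

theorem isPoissonOn_linearBivector : K.linearBivector.IsPoissonOn univ := by
  refine (isTestFamily_dual V H W).isPoissonOn isOpen_univ K.isBivectorField_linearBivector ?_
  rintro _ ⟨a, s, rfl⟩ _ ⟨b, t, rfl⟩ _ ⟨c, r, rfl⟩ y _
  simp only [BivectorFamily.schouten, linearBivector_test, linearBivector_ellFn_test]
  have h1 : ellFn (K.br s (K.br t r) + K.br t (K.br r s) + K.br r (K.br s t)) y = 0 := by
    rw [K.br_jacobi, ellFn_zero]
  rw [ellFn_add, ellFn_add, K.br_skew s, K.br_skew t (K.br r s), K.br_skew r (K.br s t),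
    ellFn_neg, ellFn_neg, ellFn_neg] at h1
  linarith

theorem lieDeriv_linearBivector (X : SmoothVectorField V S) {f g : DualTotal H W → ℝ}
    (hf : ContMDiff (totalModel V (DualFiber H)) 𝓘(ℝ, ℝ) ∞ f)
    (hg : ContMDiff (totalModel V (DualFiber H)) 𝓘(ℝ, ℝ) ∞ g) (y : DualTotal H W) :
    K.linearBivector.lieDeriv (K.conn.liftField X) f g y = 0 := by
  refine (isTestFamily_dual V H W).lieDeriv_eq_zero isOpen_univ K.isBivectorField_linearBivector
    (K.smoothFieldOn_liftField X) (mem_univ y) ?_ hf.contMDiffOn hg.contMDiffOn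
  rintro _ ⟨a, s, rfl⟩ _ ⟨b, t, rfl⟩
  simp only [BivectorFamily.lieDeriv, derivAlong_liftField_test, linearBivector_test,
    derivAlong_liftField_ellFn, K.nabla_br, ellFn_add]
  ring

theorem couplingForm_liftField (X Y : SmoothVectorField V S) (z : DualTotal H W) :
    (K.geometricData Ω).couplingForm z (K.conn.liftField X z) (K.conn.liftField Y z)
      = Ω.fn X Y z.1 + ellFn (K.curv X Y) z := by
  rw [← K.couplingTwo_apply]
  change K.couplingTwo Ω z (dproj (V := V) z (K.conn.liftField X z))
    (dproj (V := V) z (K.conn.liftField Y z)) = _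
  rw [EhresmannConnection.liftField, EhresmannConnection.liftField, EhresmannConnection.dproj_lift,
    EhresmannConnection.dproj_lift]

theorem curv_conn (X Y : SmoothVectorField V S) (y : DualTotal H W)
    (β : Module.Dual ℝ (TangentSpace (totalModel V (DualFiber H)) y)) :
    β (K.conn.curv X Y y) = K.linearBivector y (covec (totalModel V (DualFiber H)) (fun z ↦
      (K.geometricData Ω).couplingForm z (K.conn.liftField X z) (K.conn.liftField Y z)) y) β := by
  have : CompleteSpace (V × DualFiber H) := FiniteDimensional.complete ℝ _
  have hT := isTestFamily_dual V H W
  obtain ⟨_, ⟨b, r, rfl⟩, rfl⟩ := hT.exists_covec_eq y β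
  have h1 := derivAlong_mlieBracket isOpen_univ (K.smoothFieldOn_liftField X)
    (K.smoothFieldOn_liftField Y) (hT.smooth _ ⟨b, r, rfl⟩).contMDiffOn (mem_univ y)
  have h2 := congrFun (K.derivAlong_liftField_test (lieBracketField X Y) b r) y
  have h3 : derivField (lieBracketField X Y) b y.1
      = derivField X (derivField Y b) y.1 - derivField Y (derivField X b) y.1 :=
    mvfderiv_lieBracketField X Y b y.1
  have h4 := congrArg (fun s ↦ ellFn s y) (K.nabla_comm X Y r)
  simp only [ellFn_sub] at h4
  simp only [derivAlong_liftField_test] at h1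
  simp only [couplingForm_liftField]
  refine Eq.trans ?_ (congrFun (K.linearBivector_test (Ω.fn X Y) b (K.curv X Y) r) y).symm
  rw [← h4, EhresmannConnection.curv, map_sub]
  change derivAlong (VectorField.mlieBracket _ _ _) _ y
    - derivAlong (K.conn.liftField (lieBracketField X Y)) _ y = _
  rw [h1, h2, h3]
  ring

theorem extDerivTwo_couplingForm (X Y Z : SmoothVectorField V S) (y : DualTotal H W) :
    extDerivTwo (I := totalModel V (DualFiber H))
      (fun z v w ↦ (K.geometricData Ω).couplingForm z v w) (K.conn.liftField X)
      (K.conn.liftField Y) (K.conn.liftField Z) y = 0 := by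
  have h1 : ∀ X Y Z : SmoothVectorField V S, (K.geometricData Ω).couplingForm y
      (VectorField.mlieBracket (totalModel V (DualFiber H)) (K.conn.liftField X)
        (K.conn.liftField Y) y) (K.conn.liftField Z y)
      = Ω.fn (lieBracketField X Y) Z y.1 + ellFn (K.curv (lieBracketField X Y) Z) y := by
    intro X Y Z
    rw [← K.couplingTwo_apply]
    change K.couplingTwo Ω y (dproj (V := V) y _) (dproj (V := V) y _) = _
    rw [dproj_mlieBracket_liftField K.conn (K.smoothFieldOn_liftField X)
      (K.smoothFieldOn_liftField Y), EhresmannConnection.liftField, EhresmannConnection.dproj_lift]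
  have h2 := congrArg (fun s ↦ ellFn s y) (K.bianchi X Y Z)
  simp only [ellFn_add] at h2
  have h3 : derivField X (Ω.fn Y Z) y.1 - Ω.fn (lieBracketField X Y) Z y.1
      + (derivField Y (Ω.fn Z X) y.1 - Ω.fn (lieBracketField Y Z) X y.1)
      + (derivField Z (Ω.fn X Y) y.1 - Ω.fn (lieBracketField Z X) Y y.1) = 0 := Ω.closed X Y Z y.1
  simp only [extDerivTwo, couplingForm_liftField, derivAlong_liftField_test, h1]
  linarith

theorem isIntegrable_geometricData : (K.geometricData Ω).IsIntegrable where
  ν_poisson := K.isPoissonOn_linearBivector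
  lieDeriv_ν X _ _ hf hg y := K.lieDeriv_linearBivector X hf hg y
  curvature := K.curv_conn Ω
  closed := K.extDerivTwo_couplingForm Ω

end CurvedLieBundle

end Integrability

/-! ### The Jacobi identity in a horizontal frame -/

noncomputable section CouplingFrames

variable {EM : Type*} [NormedAddCommGroup EM] [NormedSpace ℝ EM] [FiniteDimensional ℝ EM]
  {HM : Type*} [TopologicalSpace HM] {I : ModelWithCorners ℝ EM HM}
  {M : Type*} [TopologicalSpace M] [ChartedSpace HM M] [IsManifold I ∞ M]

/-- Being a Poisson bivector field is a local property. -/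
theorem BivectorFamily.IsPoissonOn.of_locally {P : BivectorFamily I M} {U : Set M}
    (h : ∀ y ∈ U, ∃ O, IsOpen O ∧ y ∈ O ∧ O ⊆ U ∧ P.IsPoissonOn O) : P.IsPoissonOn U where
  alt y hy := by
    obtain ⟨O, -, hyO, -, hP⟩ := h y hy
    exact hP.alt y hyO
  smooth f g hf hg y hy := by
    obtain ⟨O, hO, hyO, hOU, hP⟩ := h y hy
    exact ((hP.smooth f g (hf.mono hOU) (hg.mono hOU)).contMDiffAt
      (hO.mem_nhds hyO)).contMDiffWithinAt
  schouten_self f g k hf hg hk y hy := by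
    obtain ⟨O, hO, hyO, hOU, hP⟩ := h y hy
    exact hP.schouten_self f g k (hf.mono hOU) (hg.mono hOU) (hk.mono hOU) y hyO

/-- A local description of a coupling bivector `P = μ + ν` on an open set `O`: `X i` are horizontal
lifts of the coordinate fields of coordinates on the base, whose pullbacks are `q i`; `m i j` are
the coefficients of the coupling form, and `n` is the inverse matrix of `m`, so that
`μ = ∑ n i j X i ⊗ X j`. The last three fields are the integrability conditions. -/
structure CouplingFrame (ι : Type*) [Fintype ι] [DecidableEq ι] (P ν : BivectorFamily I M)
    (O : Set M) where
  X : ι → ∀ y : M, TangentSpace I y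
  q : ι → M → ℝ
  m : ι → ι → M → ℝ
  n : ι → ι → M → ℝ
  smooth_X : ∀ i, SmoothFieldOn (X i) O
  smooth_q : ∀ i, ContMDiffOn I 𝓘(ℝ, ℝ) ∞ (q i) O
  smooth_m : ∀ i j, ContMDiffOn I 𝓘(ℝ, ℝ) ∞ (m i j) O
  smooth_n : ∀ i j, ContMDiffOn I 𝓘(ℝ, ℝ) ∞ (n i j) O
  covec_q : ∀ y ∈ O, ∀ i j, covec I (q i) y (X j y) = if i = j then 1 else 0
  n_mul_m : ∀ y ∈ O, ∀ i j, ∑ k, n i k y * m k j y = if i = j then 1 else 0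
  m_mul_n : ∀ y ∈ O, ∀ i j, ∑ k, m i k y * n k j y = if i = j then 1 else 0
  n_skew : ∀ y ∈ O, ∀ i j, n i j y = - n j i y
  apply_eq : ∀ y ∈ O, ∀ α β, P y α β = ∑ i, ∑ j, α (X i y) * n i j y * β (X j y) + ν y α β
  ν_poisson : ν.IsPoissonOn O
  ν_q : ∀ y ∈ O, ∀ i β, ν y (covec I (q i) y) β = 0
  lieDeriv_ν : ∀ i (f g : M → ℝ), ContMDiffOn I 𝓘(ℝ, ℝ) ∞ f O → ContMDiffOn I 𝓘(ℝ, ℝ) ∞ g O →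
    ∀ y ∈ O, ν.lieDeriv (X i) f g y = 0
  curvature : ∀ y ∈ O, ∀ i j β, β (VectorField.mlieBracket I (X i) (X j) y)
    = ν y (covec I (m i j) y) β
  closed : ∀ y ∈ O, ∀ i j k,
    derivAlong (X i) (m j k) y + derivAlong (X j) (m k i) y + derivAlong (X k) (m i j) y = 0

namespace CouplingFrame

variable {ι : Type*} [Fintype ι] [DecidableEq ι] {P ν : BivectorFamily I M} {O : Set M}
  (C : CouplingFrame ι P ν O)
include C

theorem pair_eq {y : M} (hy : y ∈ O) (f g : M → ℝ) : P.pair f g y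
    = ∑ i, ∑ j, derivAlong (C.X i) f y * C.n i j y * derivAlong (C.X j) g y + ν.pair f g y :=
  C.apply_eq y hy _ _

theorem derivAlong_q {y : M} (hy : y ∈ O) (i j : ι) :
    derivAlong (C.X j) (C.q i) y = if i = j then 1 else 0 := C.covec_q y hy i j

theorem pair_q_left {y : M} (hy : y ∈ O) (a : ι) (g : M → ℝ) :
    P.pair (C.q a) g y = ∑ j, C.n a j y * derivAlong (C.X j) g y := by
  have h : ν.pair (C.q a) g y = 0 := C.ν_q y hy a _
  rw [C.pair_eq hy, h, add_zero, Finset.sum_eq_single a]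
  · simp [C.derivAlong_q hy]
  · intro i _ hi
    simp [C.derivAlong_q hy, hi.symm]
  · simp

theorem pair_q_right {y : M} (hy : y ∈ O) (f : M → ℝ) (b : ι) :
    P.pair f (C.q b) y = ∑ i, derivAlong (C.X i) f y * C.n i b y := by
  have h : ν.pair f (C.q b) y = 0 :=
    (C.ν_poisson.pair_skew hy _ _).trans (by rw [BivectorFamily.pair, C.ν_q y hy b, neg_zero])
  rw [C.pair_eq hy, h, add_zero]
  refine Finset.sum_congr rfl fun i _ ↦ ?_
  rw [Finset.sum_eq_single b]
  · simp [C.derivAlong_q hy]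
  · intro j _ hj
    simp [C.derivAlong_q hy, hj.symm]
  · simp

theorem pair_q_q {y : M} (hy : y ∈ O) (a b : ι) : P.pair (C.q a) (C.q b) y = C.n a b y := by
  simp [C.pair_q_left hy, C.derivAlong_q hy]

variable (hO : IsOpen O)
include hO

theorem smooth_derivAlong {f : M → ℝ} (hf : ContMDiffOn I 𝓘(ℝ, ℝ) ∞ f O) (i : ι) :
    ContMDiffOn I 𝓘(ℝ, ℝ) ∞ (derivAlong (C.X i) f) O := (C.smooth_X i).derivAlong hO hf

theorem isBivectorFieldOn : P.IsBivectorFieldOn O where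
  alt y hy α := by
    have h : ∑ i, ∑ j, α (C.X i y) * C.n i j y * α (C.X j y)
        = - ∑ i, ∑ j, α (C.X i y) * C.n i j y * α (C.X j y) := by
      conv_lhs => rw [Finset.sum_comm]
      rw [← Finset.sum_neg_distrib]
      refine Finset.sum_congr rfl fun i _ ↦ ?_
      rw [← Finset.sum_neg_distrib]
      refine Finset.sum_congr rfl fun j _ ↦ ?_
      rw [C.n_skew y hy j i]
      ring
    rw [C.apply_eq y hy, C.ν_poisson.alt y hy]
    linarith
  smooth f g hf hg := by
    refine ContMDiffOn.congr (f := fun y ↦ ∑ i, ∑ j, derivAlong (C.X i) f y * C.n i j y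
      * derivAlong (C.X j) g y + ν.pair f g y) ?_ fun y hy ↦ C.pair_eq hy f g
    refine ContMDiffOn.add ?_ (C.ν_poisson.smooth f g hf hg)
    refine contMDiffOn_finsetSum fun i _ ↦ contMDiffOn_finsetSum fun j _ ↦ ?_
    exact ((C.smooth_derivAlong hO hf i).mul (C.smooth_n i j)).mul (C.smooth_derivAlong hO hg j)

/-- The derivative of the inverse matrix. -/
theorem covec_n {y : M} (hy : y ∈ O) (a b : ι) :
    covec I (C.n a b) y = ∑ k, ∑ j, (C.n a k y * C.n b j y) • covec I (C.m k j) y := by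
  have hn (i j) := (C.smooth_n i j).mdifferentiableAt_of_isOpen hO hy
  have hm (i j) := (C.smooth_m i j).mdifferentiableAt_of_isOpen hO hy
  have h1 : ∀ j, ∑ k, (C.n a k y • covec I (C.m k j) y + C.m k j y • covec I (C.n a k) y) = 0 := by
    intro j
    have h2 : (fun z ↦ ∑ k, C.n a k z * C.m k j z) =ᶠ[𝓝 y] fun _ ↦ if a = j then 1 else 0 := by
      filter_upwards [hO.mem_nhds hy] with z hz using C.n_mul_m z hz a j
    have h3 := covec_congr (I := I) h2
    rw [covec_const, covec_sum (f := fun k z ↦ C.n a k z * C.m k j z) _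
      fun k ↦ (hn a k).mul (hm k j)] at h3
    rw [← h3]
    exact Finset.sum_congr rfl fun k _ ↦ (covec_mul (hn a k) (hm k j)).symm
  ext v
  have h2 : ∀ j, ∑ k, C.m k j y * covec I (C.n a k) y v
      = - ∑ k, C.n a k y * covec I (C.m k j) y v := by
    intro j
    have h3 := LinearMap.congr_fun (h1 j) v
    simp only [LinearMap.sum_apply, LinearMap.add_apply, LinearMap.smul_apply, smul_eq_mul,
      LinearMap.zero_apply, Finset.sum_add_distrib] at h3
    linarith
  have h3 : covec I (C.n a b) y v
      = ∑ j, C.n j b y * ∑ k, C.m k j y * covec I (C.n a k) y v := by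
    simp only [Finset.mul_sum]
    rw [Finset.sum_comm]
    have h4 : ∀ k, ∑ j, C.n j b y * (C.m k j y * covec I (C.n a k) y v)
        = (if k = b then 1 else 0) * covec I (C.n a k) y v := by
      intro k
      rw [← C.m_mul_n y hy k b, Finset.sum_mul]
      exact Finset.sum_congr rfl fun j _ ↦ by ring
    simp [h4]
  rw [h3]
  simp only [h2, LinearMap.sum_apply, LinearMap.smul_apply, smul_eq_mul, mul_neg,
    Finset.mul_sum, ← Finset.sum_neg_distrib]
  rw [Finset.sum_comm]
  refine Finset.sum_congr rfl fun k _ ↦ Finset.sum_congr rfl fun j _ ↦ ?_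
  rw [C.n_skew y hy b j]
  ring

/-- If `df` and `dg` vanish on the horizontal vectors at `y`, then `μ(df, dg)` vanishes to second
order at `y`. -/
theorem covec_pair_of_vertical {f g : M → ℝ} (hf : ContMDiffOn I 𝓘(ℝ, ℝ) ∞ f O)
    (hg : ContMDiffOn I 𝓘(ℝ, ℝ) ∞ g O) {y : M} (hy : y ∈ O)
    (hf0 : ∀ i, derivAlong (C.X i) f y = 0) (hg0 : ∀ i, derivAlong (C.X i) g y = 0) :
    covec I (P.pair f g) y = covec I (ν.pair f g) y := by
  have hdf (i) := (C.smooth_derivAlong hO hf i).mdifferentiableAt_of_isOpen hO hy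
  have hdg (i) := (C.smooth_derivAlong hO hg i).mdifferentiableAt_of_isOpen hO hy
  have hn (i j) := (C.smooth_n i j).mdifferentiableAt_of_isOpen hO hy
  have hsum (i j) : MDifferentiableAt I 𝓘(ℝ, ℝ) (fun z ↦ derivAlong (C.X i) f z * C.n i j z
      * derivAlong (C.X j) g z) y := ((hdf i).mul (hn i j)).mul (hdg j)
  have h1 : P.pair f g =ᶠ[𝓝 y] fun z ↦ ∑ i, ∑ j, derivAlong (C.X i) f z * C.n i j z
      * derivAlong (C.X j) g z + ν.pair f g z := by
    filter_upwards [hO.mem_nhds hy] with z hz using C.pair_eq hz f g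
  rw [covec_congr h1, covec_add (mdifferentiableAt_finsetSum _ fun i ↦
    mdifferentiableAt_finsetSum _ fun j ↦ hsum i j), covec_sum _ fun i ↦
    mdifferentiableAt_finsetSum _ fun j ↦ hsum i j]
  · rw [Finset.sum_eq_zero, zero_add]
    intro i _
    rw [covec_sum _ fun j ↦ hsum i j]
    refine Finset.sum_eq_zero fun j _ ↦ ?_
    refine (covec_mul ((hdf i).mul (hn i j)) (hdg j)).trans ?_
    simp [hf0, hg0]
  · exact (C.ν_poisson.smooth f g hf hg).mdifferentiableAt_of_isOpen hO hy

omit hO in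
theorem pair_of_vertical_right {y : M} (hy : y ∈ O) (f : M → ℝ) {g : M → ℝ}
    (hg0 : ∀ i, derivAlong (C.X i) g y = 0) : P.pair f g y = ν.pair f g y := by
  rw [C.pair_eq hy]
  simp [hg0]

/-- If `dg` vanishes on the horizontal vectors at `y`, the coefficients of `{q a, g}` may be
treated as constants when this function is differentiated at `y`. -/
theorem covec_pair_q_left (a : ι) {g : M → ℝ} (hg : ContMDiffOn I 𝓘(ℝ, ℝ) ∞ g O) {y : M}
    (hy : y ∈ O) (hg0 : ∀ i, derivAlong (C.X i) g y = 0) :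
    covec I (P.pair (C.q a) g) y = ∑ j, C.n a j y • covec I (derivAlong (C.X j) g) y := by
  have hdg (i) := (C.smooth_derivAlong hO hg i).mdifferentiableAt_of_isOpen hO hy
  have hn (i j) := (C.smooth_n i j).mdifferentiableAt_of_isOpen hO hy
  have h1 : P.pair (C.q a) g =ᶠ[𝓝 y] fun z ↦ ∑ j, C.n a j z * derivAlong (C.X j) g z := by
    filter_upwards [hO.mem_nhds hy] with z hz using C.pair_q_left hz a g
  rw [covec_congr h1, covec_sum (f := fun j z ↦ C.n a j z * derivAlong (C.X j) g z) _
    fun j ↦ (hn a j).mul (hdg j)]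
  refine Finset.sum_congr rfl fun j _ ↦ ?_
  rw [covec_mul (hn a j) (hdg j), hg0, zero_smul, add_zero]

/-- The Jacobi identity for three functions whose differentials vanish on the horizontal vectors. -/
theorem schouten_vertical {f g h : M → ℝ} (hf : ContMDiffOn I 𝓘(ℝ, ℝ) ∞ f O)
    (hg : ContMDiffOn I 𝓘(ℝ, ℝ) ∞ g O) (hh : ContMDiffOn I 𝓘(ℝ, ℝ) ∞ h O) {y : M} (hy : y ∈ O)
    (hf0 : ∀ i, derivAlong (C.X i) f y = 0) (hg0 : ∀ i, derivAlong (C.X i) g y = 0)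
    (hh0 : ∀ i, derivAlong (C.X i) h y = 0) : P.schouten P f g h y = 0 := by
  have key : ∀ {f g h : M → ℝ}, ContMDiffOn I 𝓘(ℝ, ℝ) ∞ f O → ContMDiffOn I 𝓘(ℝ, ℝ) ∞ g O →
      (∀ i, derivAlong (C.X i) f y = 0) → (∀ i, derivAlong (C.X i) g y = 0) →
      (∀ i, derivAlong (C.X i) h y = 0) → P.pair (P.pair f g) h y = ν.pair (ν.pair f g) h y := by
    intro f g h hf hg hf0 hg0 hh0
    rw [C.pair_of_vertical_right hy _ hh0, BivectorFamily.pair,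
      C.covec_pair_of_vertical hO hf hg hy hf0 hg0]
    rfl
  rw [BivectorFamily.schouten, key hf hg hf0 hg0 hh0, key hg hh hg0 hh0 hf0, key hh hf hh0 hf0 hg0]
  exact C.ν_poisson.schouten_self f g h hf hg hh y hy

/-- The Jacobi identity for one base coordinate and two functions whose differentials vanish on the
horizontal vectors follows from `[X i, ν] = 0`. -/
theorem schouten_q_vertical (a : ι) {g h : M → ℝ} (hg : ContMDiffOn I 𝓘(ℝ, ℝ) ∞ g O)
    (hh : ContMDiffOn I 𝓘(ℝ, ℝ) ∞ h O) {y : M} (hy : y ∈ O)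
    (hg0 : ∀ i, derivAlong (C.X i) g y = 0) (hh0 : ∀ i, derivAlong (C.X i) h y = 0) :
    P.schouten P (C.q a) g h y = 0 := by
  have hP := C.isBivectorFieldOn hO
  have key : ∀ {g h : M → ℝ}, ContMDiffOn I 𝓘(ℝ, ℝ) ∞ g O →
      (∀ i, derivAlong (C.X i) g y = 0) → (∀ i, derivAlong (C.X i) h y = 0) →
      P.pair (P.pair (C.q a) g) h y = ∑ j, C.n a j y * ν.pair (derivAlong (C.X j) g) h y := by
    intro g h hg hg0 hh0
    rw [C.pair_of_vertical_right hy _ hh0, BivectorFamily.pair,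
      C.covec_pair_q_left hO a hg hy hg0, map_sum, LinearMap.sum_apply]
    exact Finset.sum_congr rfl fun j _ ↦ by rw [map_smul]; rfl
  have h1 : P.pair (P.pair g h) (C.q a) y
      = ∑ i, derivAlong (C.X i) (ν.pair g h) y * C.n i a y := by
    rw [C.pair_q_right hy]
    refine Finset.sum_congr rfl fun i _ ↦ ?_
    rw [derivAlong_eq_covec, C.covec_pair_of_vertical hO hg hh hy hg0 hh0]
    rfl
  have h2 : P.pair (P.pair h (C.q a)) g y = - P.pair (P.pair (C.q a) h) g y := by
    rw [BivectorFamily.pair, hP.covec_pair_skew hO hy, map_neg]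
    rfl
  have h3 : P.pair (P.pair (C.q a) g) h y + P.pair (P.pair g h) (C.q a) y
      + P.pair (P.pair h (C.q a)) g y = 0 := by
    rw [h2, key hg hg0 hh0, h1, key hh hh0 hg0, ← sub_eq_add_neg, ← Finset.sum_add_distrib,
      ← Finset.sum_sub_distrib]
    refine Finset.sum_eq_zero fun j _ ↦ ?_
    have h4 := C.lieDeriv_ν j g h hg hh y hy
    rw [BivectorFamily.lieDeriv, C.ν_poisson.pair_skew hy g] at h4
    rw [C.n_skew y hy j a]
    linear_combination (- C.n a j y) * h4
  rw [BivectorFamily.schouten, h3, add_zero]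

/-- The Jacobi identity for two base coordinates and a function whose differential vanishes on the
horizontal vectors follows from the formula for the curvature. -/
theorem schouten_q_q_vertical (a b : ι) {h : M → ℝ}
    (hh : ContMDiffOn I 𝓘(ℝ, ℝ) ∞ h O) {y : M} (hy : y ∈ O)
    (hh0 : ∀ i, derivAlong (C.X i) h y = 0) : P.schouten P (C.q a) (C.q b) h y = 0 := by
  have : CompleteSpace EM := FiniteDimensional.complete ℝ EM
  have hP := C.isBivectorFieldOn hO
  let D (i j : ι) : ℝ := derivAlong (C.X i) (derivAlong (C.X j) h) y
  have h1 : P.pair (P.pair (C.q a) (C.q b)) h y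
      = ∑ k, ∑ j, (C.n a k y * C.n b j y) * (D k j - D j k) := by
    have h2 : P.pair (C.q a) (C.q b) =ᶠ[𝓝 y] C.n a b := by
      filter_upwards [hO.mem_nhds hy] with z hz using C.pair_q_q hz a b
    rw [C.pair_of_vertical_right hy _ hh0, BivectorFamily.pair, covec_congr h2, C.covec_n hO hy]
    simp only [map_sum, LinearMap.sum_apply, map_smul, LinearMap.smul_apply, smul_eq_mul]
    refine Finset.sum_congr rfl fun k _ ↦ Finset.sum_congr rfl fun j _ ↦ ?_
    rw [← C.curvature y hy, ← derivAlong_eq_covec,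
      derivAlong_mlieBracket hO (C.smooth_X k) (C.smooth_X j) hh hy]
  have key : ∀ a b, P.pair (P.pair (C.q b) h) (C.q a) y
      = - ∑ i, ∑ j, (C.n a i y * C.n b j y) * D i j := by
    intro a b
    rw [C.pair_q_right hy, ← Finset.sum_neg_distrib]
    refine Finset.sum_congr rfl fun i _ ↦ ?_
    rw [derivAlong_eq_covec, C.covec_pair_q_left hO b hh hy hh0, LinearMap.sum_apply,
      C.n_skew y hy i a, Finset.sum_mul, ← Finset.sum_neg_distrib]
    refine Finset.sum_congr rfl fun j _ ↦ ?_
    change C.n b j y * D i j * _ = _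
    ring
  have h2 : P.pair (P.pair h (C.q a)) (C.q b) y = - P.pair (P.pair (C.q a) h) (C.q b) y := by
    rw [BivectorFamily.pair, hP.covec_pair_skew hO hy, map_neg]
    rfl
  have h3 : P.pair (P.pair (C.q a) (C.q b)) h y + P.pair (P.pair (C.q b) h) (C.q a) y
      + P.pair (P.pair h (C.q a)) (C.q b) y = 0 := by
    rw [h2, h1, key a b, key b a, Finset.sum_comm (f := fun i j ↦ C.n b i y * C.n a j y * D i j),
      neg_neg, ← Finset.sum_neg_distrib, ← Finset.sum_add_distrib, ← Finset.sum_add_distrib]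
    refine Finset.sum_eq_zero fun i _ ↦ ?_
    rw [← Finset.sum_neg_distrib, ← Finset.sum_add_distrib, ← Finset.sum_add_distrib]
    exact Finset.sum_eq_zero fun j _ ↦ by ring
  rw [BivectorFamily.schouten, h3, add_zero]

/-- The Jacobi identity for three base coordinates follows from the closedness of the coupling
form. -/
theorem schouten_q_q_q (a b c : ι) {y : M} (hy : y ∈ O) :
    P.schouten P (C.q a) (C.q b) (C.q c) y = 0 := by
  have rotate : ∀ F : ι → ι → ι → ℝ, ∑ i, ∑ k, ∑ j, F i k j = ∑ k, ∑ j, ∑ i, F i k j := by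
    intro F
    rw [Finset.sum_comm]
    exact Finset.sum_congr rfl fun k _ ↦ Finset.sum_comm
  have key : ∀ a b c, P.pair (P.pair (C.q a) (C.q b)) (C.q c) y
      = - ∑ i, ∑ k, ∑ j, C.n c i y * C.n a k y * C.n b j y * derivAlong (C.X i) (C.m k j) y := by
    intro a b c
    have h2 : P.pair (C.q a) (C.q b) =ᶠ[𝓝 y] C.n a b := by
      filter_upwards [hO.mem_nhds hy] with z hz using C.pair_q_q hz a b
    rw [C.pair_q_right hy, ← Finset.sum_neg_distrib]
    refine Finset.sum_congr rfl fun i _ ↦ ?_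
    rw [derivAlong_congr _ h2, derivAlong_eq_covec, C.covec_n hO hy, C.n_skew y hy i c]
    simp only [LinearMap.sum_apply, LinearMap.smul_apply, smul_eq_mul, Finset.sum_mul,
      ← Finset.sum_neg_distrib]
    refine Finset.sum_congr rfl fun k _ ↦ Finset.sum_congr rfl fun j _ ↦ ?_
    rw [derivAlong_eq_covec]
    ring
  have h3 : P.pair (P.pair (C.q a) (C.q b)) (C.q c) y + P.pair (P.pair (C.q b) (C.q c)) (C.q a) y
      + P.pair (P.pair (C.q c) (C.q a)) (C.q b) y = 0 := by
    rw [key, key, key,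
      rotate (fun i k j ↦ C.n c i y * C.n a k y * C.n b j y * derivAlong (C.X i) (C.m k j) y),
      rotate (fun i k j ↦ C.n b i y * C.n c k y * C.n a j y * derivAlong (C.X i) (C.m k j) y),
      rotate (fun k j i ↦ C.n b i y * C.n c k y * C.n a j y * derivAlong (C.X i) (C.m k j) y)]
    simp only [← Finset.sum_neg_distrib, ← Finset.sum_add_distrib]
    refine Finset.sum_eq_zero fun i _ ↦ Finset.sum_eq_zero fun j _ ↦
      Finset.sum_eq_zero fun k _ ↦ ?_
    linear_combination (- C.n a i y * C.n b j y * C.n c k y) * C.closed y hy i j k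
  rw [BivectorFamily.schouten, h3, add_zero]

/-- To prove the Jacobi identity it suffices to consider base coordinates and functions whose
differentials vanish on the horizontal vectors at the given point. -/
theorem schouten_of_basic {T : Set (M → ℝ)} (hT : IsTestFamily I T) {f g : M → ℝ}
    (hf : ContMDiffOn I 𝓘(ℝ, ℝ) ∞ f O) (hg : ContMDiffOn I 𝓘(ℝ, ℝ) ∞ g O) {y : M} (hy : y ∈ O)
    (h1 : ∀ a, P.schouten P f g (C.q a) y = 0)
    (h2 : ∀ h, ContMDiffOn I 𝓘(ℝ, ℝ) ∞ h O → (∀ i, derivAlong (C.X i) h y = 0) →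
      P.schouten P f g h y = 0) {h : M → ℝ} (hh : ContMDiffOn I 𝓘(ℝ, ℝ) ∞ h O) :
    P.schouten P f g h y = 0 := by
  have hP := C.isBivectorFieldOn hO
  have hq (i) := (C.smooth_q i).mdifferentiableAt_of_isOpen hO hy
  have hs (i) : ContMDiffOn I 𝓘(ℝ, ℝ) ∞ (fun z ↦ -derivAlong (C.X i) h y * C.q i z) O :=
    contMDiffOn_const.mul (C.smooth_q i)
  have hcov (i) : covec I (fun z ↦ -derivAlong (C.X i) h y * C.q i z) y
      = -derivAlong (C.X i) h y • covec I (C.q i) y := by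
    rw [covec_mul mdifferentiableAt_const (hq i), covec_const, smul_zero, add_zero]
  have hsum : covec I (fun z ↦ h z + ∑ i, -derivAlong (C.X i) h y * C.q i z) y
      = covec I h y + ∑ i, -derivAlong (C.X i) h y • covec I (C.q i) y := by
    rw [covec_add (hh.mdifferentiableAt_of_isOpen hO hy) (mdifferentiableAt_finsetSum _
      fun i ↦ (hs i).mdifferentiableAt_of_isOpen hO hy),
      covec_sum _ fun i ↦ (hs i).mdifferentiableAt_of_isOpen hO hy]
    simp only [hcov]
  have hsmooth : ContMDiffOn I 𝓘(ℝ, ℝ) ∞ (fun z ↦ h z + ∑ i, -derivAlong (C.X i) h y * C.q i z) O :=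
    hh.add (contMDiffOn_finsetSum fun i _ ↦ hs i)
  have h3 := h2 _ hsmooth fun j ↦ by
    rw [derivAlong_eq_covec, hsum]
    simp [C.covec_q y hy, derivAlong_eq_covec]
  rw [hP.schouten_eq hO hT hf hg hsmooth hy, hsum] at h3
  rw [hP.schouten_eq hO hT hf hg hh hy]
  have h4 : ∀ a, covec I (C.q a) y (P.hamField (P.pair f g) y
      - VectorField.mlieBracket I (P.hamField f) (P.hamField g) y) = 0 := fun a ↦ by
    have h5 := h1 a
    rw [hP.schouten_eq hO hT hf hg (C.smooth_q a) hy] at h5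
    linarith
  simpa [LinearMap.add_apply, LinearMap.sum_apply, LinearMap.smul_apply, h4] using h3

/-- A coupling bivector with integrable coefficients is Poisson. -/
theorem isPoissonOn {T : Set (M → ℝ)} (hT : IsTestFamily I T) : P.IsPoissonOn O where
  toIsBivectorFieldOn := C.isBivectorFieldOn hO
  schouten_self f g h hf hg hh y hy := by
    have cyc := P.schouten_cyclic
    refine C.schouten_of_basic hO hT hf hg hy (fun c ↦ ?_) (fun h hh hh0 ↦ ?_) hh
    · rw [← cyc]
      refine C.schouten_of_basic hO hT (C.smooth_q c) hf hy (fun b ↦ ?_) (fun g hg hg0 ↦ ?_) hg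
      · rw [← cyc]
        refine C.schouten_of_basic hO hT (C.smooth_q b) (C.smooth_q c) hy (fun a ↦ ?_)
          (fun f hf hf0 ↦ ?_) hf
        · exact C.schouten_q_q_q hO b c a hy
        · exact C.schouten_q_q_vertical hO b c hf hy hf0
      · rw [← cyc]
        refine C.schouten_of_basic hO hT hg (C.smooth_q c) hy (fun a ↦ ?_)
          (fun f hf hf0 ↦ ?_) hf
        · rw [cyc]
          exact C.schouten_q_q_vertical hO c a hg hy hg0
        · rw [cyc]
          exact C.schouten_q_vertical hO c hf hg hy hf0 hg0
    · rw [← cyc]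
      refine C.schouten_of_basic hO hT hh hf hy (fun b ↦ ?_) (fun g hg hg0 ↦ ?_) hg
      · rw [← cyc]
        refine C.schouten_of_basic hO hT (C.smooth_q b) hh hy (fun a ↦ ?_)
          (fun f hf hf0 ↦ ?_) hf
        · rw [← cyc]
          exact C.schouten_q_q_vertical hO a b hh hy hh0
        · exact C.schouten_q_vertical hO b hh hf hy hh0 hf0
      · rw [← cyc]
        refine C.schouten_of_basic hO hT hg hh hy (fun a ↦ ?_) (fun f hf hf0 ↦ ?_) hf
        · rw [← cyc]
          exact C.schouten_q_vertical hO a hg hh hy hg0 hh0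
        · exact C.schouten_vertical hO hg hh hf hy hg0 hh0 hf0

end CouplingFrame

end CouplingFrames

/-! ### Coupling bivectors of integrable geometric data -/

noncomputable section Matrices

variable {EM : Type*} [NormedAddCommGroup EM] [NormedSpace ℝ EM]
  {HM : Type*} [TopologicalSpace HM] {I : ModelWithCorners ℝ EM HM}
  {M : Type*} [TopologicalSpace M] [ChartedSpace HM M]
  {ι : Type*} [Fintype ι] [DecidableEq ι] {A : M → Matrix ι ι ℝ}

theorem contMDiff_matrix_det (h : ∀ i j, ContMDiff I 𝓘(ℝ, ℝ) ∞ fun y ↦ A y i j) :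
    ContMDiff I 𝓘(ℝ, ℝ) ∞ fun y ↦ (A y).det := by
  simp only [Matrix.det_apply']
  exact contMDiff_finsetSum fun σ _ ↦ contMDiff_const.mul (contMDiff_finsetProd fun i _ ↦ h _ _)

theorem contMDiffOn_matrix_inv (h : ∀ i j, ContMDiff I 𝓘(ℝ, ℝ) ∞ fun y ↦ A y i j) (i j : ι) :
    ContMDiffOn I 𝓘(ℝ, ℝ) ∞ (fun y ↦ (A y)⁻¹ i j) {y | (A y).det ≠ 0} := by
  simp only [Matrix.inv_def, Matrix.smul_apply, Ring.inverse_eq_inv', Matrix.adjugate_apply,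
    smul_eq_mul]
  refine (ContMDiffOn.inv₀ (contMDiff_matrix_det h).contMDiffOn fun y hy ↦ hy).mul
    (contMDiff_matrix_det fun k l ↦ ?_).contMDiffOn
  by_cases hk : k = j
  · subst hk
    simpa using contMDiff_const
  · simpa [Matrix.updateRow_apply, hk] using h k l

end Matrices

noncomputable section CouplingPoisson

variable {V : Type*} [NormedAddCommGroup V] [NormedSpace ℝ V] [FiniteDimensional ℝ V]
  {S : Type*} [TopologicalSpace S] [ChartedSpace V S] [IsManifold 𝓘(ℝ, V) ∞ S] [T2Space S]
  {H : Type*} [NormedAddCommGroup H] [NormedSpace ℝ H] [FiniteDimensional ℝ H]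
  {W : S → Type*} [TopologicalSpace (TotalSpace H W)]
  [∀ x, AddCommGroup (W x)] [∀ x, Module ℝ (W x)] [∀ x, TopologicalSpace (W x)]
  [∀ x, IsTopologicalAddGroup (W x)] [∀ x, ContinuousSMul ℝ (W x)]
  [FiberBundle H W] [VectorBundle ℝ H W] [ContMDiffVectorBundle ∞ H W 𝓘(ℝ, V)]

/-- Brackets of coordinate vector fields vanish. -/
theorem lieBracketField_eq_zero_of_frame {ι : Type*} [Fintype ι] [DecidableEq ι]
    {X : ι → SmoothVectorField V S} {f : ι → C^∞⟮𝓘(ℝ, V), S; ℝ⟯} {B : Set S} (hB : IsOpen B)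
    (h1 : ∀ x ∈ B, ∀ v : TangentSpace 𝓘(ℝ, V) x, v = ∑ i, mvfderiv 𝓘(ℝ, V) (f i) x v • X i x)
    (h2 : ∀ x ∈ B, ∀ i j, mvfderiv 𝓘(ℝ, V) (f i) x (X j x) = if i = j then 1 else 0)
    {x : S} (hx : x ∈ B) (i j : ι) : lieBracketField (X i) (X j) x = 0 := by
  have h3 : ∀ i j k, derivField (X i) (derivField (X j) (f k)) x = 0 := by
    intro i j k
    have h4 : (derivField (X j) (f k) : S → ℝ) =ᶠ[𝓝 x] fun _ ↦ if k = j then 1 else 0 := by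
      filter_upwards [hB.mem_nhds hx] with z hz using h2 z hz k j
    change mvfderiv 𝓘(ℝ, V) (derivField (X j) (f k)) x (X i x) = 0
    rw [mvfderiv_congr h4, mvfderiv_const]
    rfl
  rw [h1 x hx (lieBracketField (X i) (X j) x)]
  refine Finset.sum_eq_zero fun k _ ↦ ?_
  rw [mvfderiv_lieBracketField, h3, h3, sub_zero, zero_smul]

namespace GeometricData

variable {Ω : SymplecticForm V S} (D : GeometricData (DualFiber H) (DualBundle W) Ω)

theorem φ_skew (y : DualTotal H W) (v w : TangentSpace 𝓘(ℝ, V) y.1) :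
    D.φ y v w = - D.φ y w v := by
  have := D.φ_alt y (v + w)
  simp only [map_add, LinearMap.add_apply, D.φ_alt, zero_add, add_zero] at this
  linarith

theorem couplingForm_lift_right (y : DualTotal H W)
    (v : TangentSpace (totalModel V (DualFiber H)) y) (w : TangentSpace 𝓘(ℝ, V) y.1) :
    D.couplingForm y v (D.conn.lift y w) = D.φ y (dproj (V := V) y v) w := by
  change D.φ y (dproj (V := V) y v) (dproj (V := V) y (D.conn.lift y w)) = _
  rw [D.conn.dproj_lift]

theorem couplingForm_liftField (X Y : SmoothVectorField V S) (y : DualTotal H W) :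
    D.couplingForm y (D.conn.liftField X y) (D.conn.liftField Y y) = D.φ y (X y.1) (Y y.1) := by
  rw [EhresmannConnection.liftField, EhresmannConnection.liftField, couplingForm_lift_right,
    D.conn.dproj_lift]

theorem zeroSection_mem_nondegenerateLocus (x : S) :
    zeroSection (DualFiber H) (DualBundle W) x ∈ D.nondegenerateLocus := fun v hv ↦
  Ω.nondegenerate x v fun w ↦ (D.φ_zeroSection x v w).symm.trans (hv w)

theorem bijective_couplingHor {y : DualTotal H W} (hy : y ∈ D.nondegenerateLocus) :
    Function.Bijective (D.couplingHor y) := by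
  have hinj : Function.Injective (D.couplingHor y) := by
    refine (injective_iff_map_eq_zero _).2 fun v hv ↦ Subtype.ext ?_
    have h1 : dproj (V := V) y (v : TangentSpace (totalModel V (DualFiber H)) y) = 0 :=
      hy _ fun w ↦ by
        rw [← D.couplingForm_lift_right]
        exact LinearMap.congr_fun hv ⟨_, D.conn.lift_mem_hor y w⟩
    rw [D.conn.eq_lift v.2, h1, map_zero]
    rfl
  exact ⟨hinj, (LinearMap.injective_iff_surjective_of_finrank_eq_finrank
    Subspace.dual_finrank_eq.symm).1 hinj⟩

theorem couplingSharp_eq {y : DualTotal H W} (hy : y ∈ D.nondegenerateLocus)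
    {α : Module.Dual ℝ (TangentSpace (totalModel V (DualFiber H)) y)}
    {w : TangentSpace (totalModel V (DualFiber H)) y} (hw : w ∈ D.conn.hor y)
    (h : ∀ v : TangentSpace 𝓘(ℝ, V) y.1, D.couplingForm y w (D.conn.lift y v)
      = α (D.conn.lift y v)) : D.couplingSharp y α = w := by
  rw [couplingSharp, dif_pos (D.bijective_couplingHor hy)]
  refine congrArg Subtype.val ((LinearEquiv.symm_apply_eq _).2 (LinearMap.ext fun v ↦ ?_) :
    (LinearEquiv.ofBijective (D.couplingHor y) (D.bijective_couplingHor hy)).symm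
      ((D.conn.hor y).dualRestrict α) = ⟨w, hw⟩)
  change α v = D.couplingForm y w v
  rw [D.conn.eq_lift v.2, h]

variable {D}

/-- Around each point at which `φ` is nondegenerate, lifting a coordinate frame of the base gives a
frame of the horizontal bundle in which the coupling bivector has integrable coefficients. -/
theorem IsIntegrable.exists_couplingFrame (hD : D.IsIntegrable)
    (hlift : ∀ X : SmoothVectorField V S, SmoothFieldOn (D.conn.liftField X) univ)
    {y₀ : DualTotal H W} (hy₀ : y₀ ∈ D.nondegenerateLocus) :
    ∃ O : Set (DualTotal H W), IsOpen O ∧ y₀ ∈ O ∧ O ⊆ D.nondegenerateLocus ∧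
      Nonempty (CouplingFrame (Fin (Module.finrank ℝ V)) D.couplingBivector D.ν O) := by
  obtain ⟨X, f, hXf⟩ := exists_coordinate_frame (V := V) y₀.1
  obtain ⟨B, hBsub, hB, hyB⟩ := mem_nhds_iff.1 hXf
  have hB1 : ∀ x ∈ B, ∀ v : TangentSpace 𝓘(ℝ, V) x,
      v = ∑ i, mvfderiv 𝓘(ℝ, V) (f i) x v • X i x := fun x hx ↦ (hBsub hx).1
  have hB2 : ∀ x ∈ B, ∀ i j, mvfderiv 𝓘(ℝ, V) (f i) x (X j x) = if i = j then 1 else 0 :=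
    fun x hx ↦ (hBsub hx).2
  let A (y : DualTotal H W) : Matrix (Fin (Module.finrank ℝ V)) (Fin (Module.finrank ℝ V)) ℝ :=
    Matrix.of fun i j ↦ D.φ y (X i y.1) (X j y.1)
  have hA : ∀ i j, ContMDiff (totalModel V (DualFiber H)) 𝓘(ℝ, ℝ) ∞ fun y ↦ A y i j :=
    fun i j ↦ D.φ_smooth (X i) (X j)
  -- In the frame, `a ᵥ* A y` represents the form `φ y (∑ i, a i • X i)`.
  have hvec : ∀ (y : DualTotal H W) (a : Fin (Module.finrank ℝ V) → ℝ) j,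
      Matrix.vecMul a (A y) j = D.φ y (∑ i, a i • X i y.1) (X j y.1) := by
    intro y a j
    rw [map_sum, LinearMap.sum_apply]
    simp only [map_smul, LinearMap.smul_apply, smul_eq_mul]
    rfl
  let O : Set (DualTotal H W) := TotalSpace.proj ⁻¹' B ∩ {y | (A y).det ≠ 0}
  have hO : IsOpen O :=
    (hB.preimage (FiberBundle.continuous_proj (DualFiber H) (DualBundle W))).inter
      (isOpen_ne_fun (contMDiff_matrix_det hA).continuous continuous_const)
  have hOU : O ⊆ D.nondegenerateLocus := by
    intro y hy v hv
    have h1 := hB1 y.1 hy.1 v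
    have h2 : (fun i ↦ mvfderiv 𝓘(ℝ, V) (f i) y.1 v) = 0 :=
      Matrix.eq_zero_of_vecMul_eq_zero hy.2 (funext fun j ↦ by rw [hvec, ← h1, hv]; rfl)
    rw [h1]
    exact Finset.sum_eq_zero fun i _ ↦ by rw [congrFun h2 i, Pi.zero_apply, zero_smul]
  have hy₀O : y₀ ∈ O := by
    refine ⟨hyB, fun h0 ↦ ?_⟩
    obtain ⟨a, ha, ha0⟩ := Matrix.exists_vecMul_eq_zero_iff.2 h0
    have h1 : ∑ i, a i • X i y₀.1 = 0 := hy₀ _ fun w ↦ by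
      rw [hB1 y₀.1 hyB w, map_sum]
      refine Finset.sum_eq_zero fun j _ ↦ ?_
      rw [map_smul, ← hvec, ha0, Pi.zero_apply, smul_zero]
    refine ha (funext fun i ↦ ?_)
    have h2 := congrArg (mvfderiv 𝓘(ℝ, V) (f i) y₀.1) h1
    rw [map_sum, map_zero] at h2
    simpa [hB2 y₀.1 hyB] using h2
  have hunit : ∀ y ∈ O, IsUnit (A y).det := fun y hy ↦ isUnit_iff_ne_zero.2 hy.2
  have hnm : ∀ y ∈ O, ∀ i j, ∑ k, (A y)⁻¹ i k * A y k j = if i = j then 1 else 0 := by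
    intro y hy i j
    rw [← Matrix.mul_apply, Matrix.nonsing_inv_mul _ (hunit y hy), Matrix.one_apply]
  have hT := isTestFamily_dual V H W
  refine ⟨O, hO, hy₀O, hOU, ⟨{
    X := fun i ↦ D.conn.liftField (X i)
    q := fun i y ↦ f i y.1
    m := fun i j y ↦ A y i j
    n := fun i j y ↦ (A y)⁻¹ i j
    smooth_X := fun i ↦ (hlift (X i)).mono (subset_univ O)
    smooth_q := fun i ↦ (contMDiff_proj_comp (f i)).contMDiffOn
    smooth_m := fun i j ↦ (hA i j).contMDiffOn
    smooth_n := fun i j ↦ (contMDiffOn_matrix_inv hA i j).mono inter_subset_right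
    covec_q := fun y hy i j ↦ ?_
    n_mul_m := hnm
    m_mul_n := fun y hy i j ↦ ?_
    n_skew := fun y hy i j ↦ ?_
    apply_eq := fun y hy α β ↦ ?_
    ν_poisson := hD.ν_poisson.restrict hT hO
    ν_q := fun y hy i β ↦ ?_
    lieDeriv_ν := fun i g h hg hh y hy ↦ ?_
    curvature := fun y hy i j β ↦ ?_
    closed := fun y hy i j k ↦ ?_ }⟩⟩
  · rw [covec_proj_comp ((f i).contMDiff.mdifferentiableAt (by simp)),
      EhresmannConnection.liftField, D.conn.dproj_lift]
    exact hB2 y.1 hy.1 i j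
  · rw [← Matrix.mul_apply, Matrix.mul_nonsing_inv _ (hunit y hy), Matrix.one_apply]
  · have h1 : (A y).transpose = - A y := Matrix.ext fun i j ↦ D.φ_skew y _ _
    have h2 : (A y)⁻¹.transpose = - (A y)⁻¹ := by
      rw [Matrix.transpose_nonsing_inv, h1]
      exact Matrix.inv_eq_right_inv (by rw [neg_mul_neg, Matrix.mul_nonsing_inv _ (hunit y hy)])
    exact congrFun (congrFun h2 j) i
  · let u : TangentSpace 𝓘(ℝ, V) y.1 :=
      ∑ j, (∑ i, α (D.conn.liftField (X i) y) * (A y)⁻¹ i j) • X j y.1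
    have h1 : D.couplingSharp y α = D.conn.lift y u := by
      refine D.couplingSharp_eq (hOU hy) (D.conn.lift_mem_hor y _) fun v ↦ ?_
      have hk : ∀ k, D.φ y u (X k y.1) = α (D.conn.lift y (X k y.1)) := by
        intro k
        refine (hvec y _ k).symm.trans ?_
        change Matrix.vecMul (Matrix.vecMul (fun i ↦ α (D.conn.liftField (X i) y)) (A y)⁻¹) (A y) k
          = _
        rw [Matrix.vecMul_vecMul, Matrix.nonsing_inv_mul _ (hunit y hy), Matrix.vecMul_one]
        rfl
      rw [D.couplingForm_lift_right, D.conn.dproj_lift, hB1 y.1 hy.1 v]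
      simp only [map_sum, map_smul, hk]
    have h2 : D.couplingBivector y α β = β (D.couplingSharp y α) + D.ν y α β := rfl
    rw [h2, h1]
    simp only [u, map_sum, map_smul, smul_eq_mul, Finset.sum_mul]
    rw [Finset.sum_comm]
    rfl
  · refine D.ν_vertical y _ β fun v hv ↦ ?_
    rw [covec_proj_comp ((f i).contMDiff.mdifferentiableAt (by simp)), hv, map_zero]
  · refine hT.lieDeriv_eq_zero hO (hD.ν_poisson.restrict hT hO).toIsBivectorFieldOn
      ((hlift (X i)).mono (subset_univ O)) hy (fun s hs t ht ↦ ?_) hg hh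
    exact hD.lieDeriv_ν (X i) s t (hT.smooth s hs) (hT.smooth t ht) y
  · have h1 := hD.curvature (X i) (X j) y β
    have h2 : VectorField.mlieBracket 𝓘(ℝ, V) (X i) (X j) y.1 = 0 :=
      lieBracketField_eq_zero_of_frame hB hB1 hB2 hy.1 i j
    rw [EhresmannConnection.curv, EhresmannConnection.liftField, h2, map_zero, sub_zero] at h1
    simp only [D.couplingForm_liftField] at h1
    exact h1
  · have h1 := hD.closed (X i) (X j) (X k) y
    have h2 : ∀ i j k, D.couplingForm y (VectorField.mlieBracket (totalModel V (DualFiber H))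
        (D.conn.liftField (X i)) (D.conn.liftField (X j)) y) (D.conn.liftField (X k) y) = 0 := by
      intro i j k
      change D.φ y (dproj (V := V) y _) _ = 0
      rw [dproj_mlieBracket_liftField D.conn (hlift _) (hlift _),
        lieBracketField_eq_zero_of_frame hB hB1 hB2 hy.1, map_zero, LinearMap.zero_apply]
    simp only [extDerivTwo, D.couplingForm_liftField, h2, sub_zero] at h1
    exact h1

theorem IsIntegrable.isOpen_nondegenerateLocus (hD : D.IsIntegrable)
    (hlift : ∀ X : SmoothVectorField V S, SmoothFieldOn (D.conn.liftField X) univ) :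
    IsOpen D.nondegenerateLocus := by
  refine isOpen_iff_mem_nhds.2 fun y hy ↦ ?_
  obtain ⟨O, hO, hyO, hOU, -⟩ := hD.exists_couplingFrame hlift hy
  exact Filter.mem_of_superset (hO.mem_nhds hyO) hOU

theorem IsIntegrable.isPoissonOn_couplingBivector (hD : D.IsIntegrable)
    (hlift : ∀ X : SmoothVectorField V S, SmoothFieldOn (D.conn.liftField X) univ) :
    D.couplingBivector.IsPoissonOn D.nondegenerateLocus := by
  refine .of_locally fun y hy ↦ ?_
  obtain ⟨O, hO, hyO, hOU, ⟨C⟩⟩ := hD.exists_couplingFrame hlift hy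
  exact ⟨O, hO, hyO, hOU, C.isPoissonOn hO (isTestFamily_dual V H W)⟩

end GeometricData

end CouplingPoisson

/-! ### The isotropy bundle of a transitive Lie algebroid -/

noncomputable section IsotropyBundle

variable {V : Type*} [NormedAddCommGroup V] [NormedSpace ℝ V] [FiniteDimensional ℝ V]
  {S : Type*} [TopologicalSpace S] [ChartedSpace V S] [IsManifold 𝓘(ℝ, V) ∞ S] [T2Space S]
  {F : Type*} [NormedAddCommGroup F] [NormedSpace ℝ F] [FiniteDimensional ℝ F]
  {E : S → Type*} [TopologicalSpace (TotalSpace F E)]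
  [∀ x, AddCommGroup (E x)] [∀ x, Module ℝ (E x)] [∀ x, TopologicalSpace (E x)]
  [∀ x, IsTopologicalAddGroup (E x)] [∀ x, ContinuousSMul ℝ (E x)]
  [FiberBundle F E] [VectorBundle ℝ F E] [ContMDiffVectorBundle ∞ F E 𝓘(ℝ, V)]

section Fields

variable (X Y Z : SmoothVectorField V S)

theorem lieBracketField_skew : lieBracketField X Y = - lieBracketField Y X :=
  ContMDiffSection.ext fun _ ↦ VectorField.mlieBracket_swap_apply

theorem lieBracketField_add_right :
    lieBracketField X (Y + Z) = lieBracketField X Y + lieBracketField X Z :=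
  ContMDiffSection.ext fun _ ↦ VectorField.mlieBracket_add_right
    (Y.contMDiff.mdifferentiableAt (by simp)) (Z.contMDiff.mdifferentiableAt (by simp))

theorem lieBracketField_smulSection_right (f : C^∞⟮𝓘(ℝ, V), S; ℝ⟯) :
    lieBracketField X (smulSection f Y)
      = smulSection f (lieBracketField X Y) + smulSection (derivField X f) Y :=
  ContMDiffSection.ext fun x ↦ lieBracketField_smul X Y f x

theorem lieBracketField_jacobi : lieBracketField (lieBracketField X Y) Z
    + lieBracketField (lieBracketField Y Z) X + lieBracketField (lieBracketField Z X) Y = 0 := by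
  have : IsManifold 𝓘(ℝ, V) (minSmoothness ℝ 3) S := by
    simpa using (inferInstance : IsManifold 𝓘(ℝ, V) 3 S)
  have h : lieBracketField X (lieBracketField Y Z)
      = lieBracketField (lieBracketField X Y) Z + lieBracketField Y (lieBracketField X Z) :=
    ContMDiffSection.ext fun x ↦ VectorField.leibniz_identity_mlieBracket_apply
      ((X.contMDiff x).of_le (by simp [ENat.LEInfty.out]))
      ((Y.contMDiff x).of_le (by simp [ENat.LEInfty.out]))
      ((Z.contMDiff x).of_le (by simp [ENat.LEInfty.out]))
  have h2 : lieBracketField Y (lieBracketField X Z) = lieBracketField (lieBracketField Z X) Y := by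
    have h3 : lieBracketField Y (- lieBracketField Z X) + lieBracketField Y (lieBracketField Z X)
        = 0 := by
      rw [← lieBracketField_add_right, neg_add_cancel,
        TransitiveLieAlgebroid.lieBracketField_zero_right]
    rw [lieBracketField_skew X Z, eq_neg_of_add_eq_zero_left h3, ← lieBracketField_skew]
  rw [lieBracketField_skew (lieBracketField Y Z) X, h, h2]
  abel

end Fields

theorem LieAlgebroid.bracket_skew (A : LieAlgebroid V F E) (u v : SmoothSection V F E) :
    A.bracket u v = - A.bracket v u := by
  have h := A.bracket_self (u + v)
  simp only [map_add, LinearMap.add_apply, A.bracket_self, zero_add, add_zero] at h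
  exact eq_neg_of_add_eq_zero_right h

theorem LieAlgebroid.bracket_bracket (A : LieAlgebroid V F E) (u v w : SmoothSection V F E) :
    A.bracket u (A.bracket v w) = A.bracket (A.bracket u v) w + A.bracket v (A.bracket u w) := by
  have h := A.jacobi u v w
  rw [A.bracket_skew w u, A.bracket_skew w, map_neg] at h
  rw [← sub_eq_zero, ← h]
  abel

theorem LieAlgebroid.bracket_smulSection (A : LieAlgebroid V F E) (f : C^∞⟮𝓘(ℝ, V), S; ℝ⟯)
    (u v : SmoothSection V F E) : A.bracket u (smulSection f v)
      = smulSection f (A.bracket u v) + smulSection (derivField (A.anchorField u) f) v :=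
  ContMDiffSection.ext fun x ↦ A.leibniz f u v x

theorem LieAlgebroid.smulSection_bracket (A : LieAlgebroid V F E) (f : C^∞⟮𝓘(ℝ, V), S; ℝ⟯)
    (u v : SmoothSection V F E) : A.bracket (smulSection f u) v
      = smulSection f (A.bracket u v) - smulSection (derivField (A.anchorField v) f) u := by
  rw [A.bracket_skew, A.bracket_smulSection, A.bracket_skew v u, CurvedLieBundle.smulSection_neg]
  abel

theorem smulSection_derivField_zero (f : C^∞⟮𝓘(ℝ, V), S; ℝ⟯) (u : SmoothSection V F E) :
    smulSection (derivField 0 f) u = 0 :=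
  ContMDiffSection.ext fun x ↦ by
    change mvfderiv 𝓘(ℝ, V) f x 0 • u x = 0
    rw [map_zero, zero_smul]

namespace TransitiveLieAlgebroid

variable {A : TransitiveLieAlgebroid V F E}

theorem incl_injective : Function.Injective (incl : A.IsoSection → SmoothSection V F E) :=
  fun _ _ h ↦ ContMDiffSection.ext fun x ↦
    Subtype.ext (congrArg (fun u : SmoothSection V F E ↦ u x) h)

theorem incl_add (s t : A.IsoSection) : incl (s + t) = incl s + incl t :=
  ContMDiffSection.ext fun _ ↦ rfl

theorem incl_sub (s t : A.IsoSection) : incl (s - t) = incl s - incl t :=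
  ContMDiffSection.ext fun _ ↦ rfl

theorem incl_neg (s : A.IsoSection) : incl (-s) = - incl s := ContMDiffSection.ext fun _ ↦ rfl

theorem incl_zero : incl (0 : A.IsoSection) = 0 := ContMDiffSection.ext fun _ ↦ rfl

theorem incl_smulSection (f : C^∞⟮𝓘(ℝ, V), S; ℝ⟯) (s : A.IsoSection) :
    incl (smulSection f s) = smulSection f (incl s) := ContMDiffSection.ext fun _ ↦ rfl

theorem incl_isoBracket (s t : A.IsoSection) :
    incl (isoBracket s t) = A.bracket (incl s) (incl t) := ContMDiffSection.ext fun _ ↦ rfl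

namespace Connection

variable (σ : A.Connection)

theorem incl_nabla (X : SmoothVectorField V S) (s : A.IsoSection) :
    incl (σ.nabla X s) = A.bracket (σ.section X) (incl s) := ContMDiffSection.ext fun _ ↦ rfl

theorem incl_curvature (X Y : SmoothVectorField V S) : incl (σ.curvature X Y)
    = A.bracket (σ.section X) (σ.section Y) - σ.section (lieBracketField X Y) :=
  ContMDiffSection.ext fun _ ↦ rfl

theorem section_add (X Y : SmoothVectorField V S) :
    σ.section (X + Y) = σ.section X + σ.section Y :=
  ContMDiffSection.ext fun x ↦ map_add (σ.toFun x) (X x) (Y x)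

theorem section_neg (X : SmoothVectorField V S) : σ.section (-X) = - σ.section X :=
  ContMDiffSection.ext fun x ↦ map_neg (σ.toFun x) (X x)

theorem section_zero : σ.section 0 = 0 := ContMDiffSection.ext fun x ↦ map_zero (σ.toFun x)

theorem section_smulSection (f : C^∞⟮𝓘(ℝ, V), S; ℝ⟯) (X : SmoothVectorField V S) :
    σ.section (smulSection f X) = smulSection f (σ.section X) :=
  ContMDiffSection.ext fun x ↦ map_smul (σ.toFun x) (f x) (X x)

/-- The isotropy bundle of a transitive Lie algebroid with the covariant derivative and the
curvature of a connection. All identities are instances of the Leibniz and Jacobi identities of the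
algebroid bracket. -/
def curvedLieBundle : CurvedLieBundle V (IsoFiber V F) A.Isotropy where
  br := isoBracket
  nabla := σ.nabla
  curv := σ.curvature
  br_skew s t := incl_injective (by rw [incl_neg, incl_isoBracket, incl_isoBracket, A.bracket_skew])
  br_add_right s t t' := incl_injective (by
    simp only [incl_add, incl_isoBracket, map_add])
  br_smul_right s f t := incl_injective (by
    rw [incl_isoBracket, incl_smulSection, incl_smulSection, A.bracket_smulSection,
      anchorField_incl, smulSection_derivField_zero, add_zero, incl_isoBracket])
  br_jacobi s t r := incl_injective (by
    simp only [incl_add, incl_isoBracket, incl_zero, A.jacobi])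
  nabla_add_left X X' s := incl_injective (by
    simp only [incl_add, incl_nabla, section_add, map_add, LinearMap.add_apply])
  nabla_smul_left f X s := incl_injective (by
    rw [incl_nabla, section_smulSection, A.smulSection_bracket, anchorField_incl,
      smulSection_derivField_zero, sub_zero, incl_smulSection, incl_nabla])
  nabla_add_right X s s' := incl_injective (by
    simp only [incl_add, incl_nabla, map_add])
  nabla_smul_right X f s := incl_injective (by
    rw [incl_nabla, incl_smulSection, A.bracket_smulSection, σ.anchorField_section, incl_add,
      incl_smulSection, incl_smulSection, incl_nabla])
  nabla_br X s t := incl_injective (by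
    simp only [incl_add, incl_nabla, incl_isoBracket]
    exact A.bracket_bracket _ _ _)
  curv_skew X Y := incl_injective (by
    rw [incl_neg, incl_curvature, incl_curvature, A.bracket_skew, lieBracketField_skew X Y,
      section_neg]
    abel)
  curv_add_right X Y Y' := incl_injective (by
    simp only [incl_add, incl_curvature, section_add, map_add, lieBracketField_add_right]
    abel)
  curv_smul_right X f Y := incl_injective (by
    rw [incl_curvature, section_smulSection, A.bracket_smulSection, σ.anchorField_section,
      lieBracketField_smulSection_right, section_add, section_smulSection, section_smulSection,
      incl_smulSection, incl_curvature, add_sub_add_right_eq_sub]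
    exact ContMDiffSection.ext fun x ↦ (smul_sub (f x) _ _).symm)
  nabla_comm X Y s := incl_injective (by
    simp only [incl_sub, incl_nabla, incl_isoBracket, incl_curvature, map_sub, LinearMap.sub_apply]
    rw [A.bracket_bracket (σ.section X)]
    abel)
  bianchi X Y Z := incl_injective (by
    have h1 := A.jacobi (σ.section X) (σ.section Y) (σ.section Z)
    have h2 := congrArg σ.section (lieBracketField_jacobi X Y Z)
    simp only [section_add, section_zero] at h2
    simp only [incl_add, incl_nabla, incl_curvature, map_sub]
    rw [A.bracket_skew (σ.section (lieBracketField X Y)),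
      A.bracket_skew (σ.section (lieBracketField Y Z)),
      A.bracket_skew (σ.section (lieBracketField Z X)), ← sub_eq_zero]
    refine Eq.trans ?_ ((congrArg₂ (· + ·) h1 h2).trans (add_zero 0))
    abel)

end Connection

end TransitiveLieAlgebroid

end IsotropyBundle

/-! ### The coupling Poisson structure of a connection -/

theorem theorem3
    {V : Type*} [NormedAddCommGroup V] [NormedSpace ℝ V] [FiniteDimensional ℝ V]
    {S : Type*} [TopologicalSpace S] [ChartedSpace V S] [IsManifold 𝓘(ℝ, V) ∞ S]
    [T2Space S] [SecondCountableTopology S]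
    {F : Type*} [NormedAddCommGroup F] [NormedSpace ℝ F] [FiniteDimensional ℝ F]
    {E : S → Type*} [TopologicalSpace (TotalSpace F E)]
    [∀ x, AddCommGroup (E x)] [∀ x, Module ℝ (E x)] [∀ x, TopologicalSpace (E x)]
    [∀ x, IsTopologicalAddGroup (E x)] [∀ x, ContinuousSMul ℝ (E x)]
    [FiberBundle F E] [VectorBundle ℝ F E] [ContMDiffVectorBundle ∞ F E 𝓘(ℝ, V)]
    (A : TransitiveLieAlgebroid V F E) (Ω : SymplecticForm V S) (σ : A.Connection) :
    ∃ D : GeometricData (TransitiveLieAlgebroid.CoIsoFiber V F) A.CoIsotropy Ω,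
      σ.Induces D ∧ (∀ D' : GeometricData (TransitiveLieAlgebroid.CoIsoFiber V F) A.CoIsotropy Ω,
        σ.Induces D' → D' = D) ∧
      D.conn.IsHomogeneous ∧
      D.IsIntegrable ∧
      IsOpen D.nondegenerateLocus ∧
      (∀ x, zeroSection (TransitiveLieAlgebroid.CoIsoFiber V F) A.CoIsotropy x
        ∈ D.nondegenerateLocus) ∧
      D.couplingBivector.IsPoissonOn D.nondegenerateLocus := by
  let K := σ.curvedLieBundle
  have hD := K.isIntegrable_geometricData Ω
  refine ⟨K.geometricData Ω, ⟨fun X s y ↦ congrFun (K.derivAlong_liftField_ellFn X s) y,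
    fun s t y ↦ congrFun (K.linearBivector_ellFn s t) y, K.couplingTwo_apply Ω⟩,
    fun D' h ↦ K.geometricData_unique D' h.lift_ell h.ν_ell h.φ_eq, K.isHomogeneous_conn, hD,
    hD.isOpen_nondegenerateLocus K.smoothFieldOn_liftField,
    (K.geometricData Ω).zeroSection_mem_nondegenerateLocus,
    hD.isPoissonOn_couplingBivector K.smoothFieldOn_liftField⟩
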